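/- Let $\mathcal X$ be a finite set, $n\ge 1$, and let $q^n$ be a probability measure on $\mathcal X^n$. For $y^n\in\mathcal X^n$ and $I\subset[1,n]$ write $y_I=(y_k)_{k\in I}$ and $\bar y_I=(y_k)_{k\notin I}$, and for the law $p^n$ of a random sequence $Y^n$ let $p_I(\cdot|\bar y_I)$ denote the conditional law of $Y_I$ given $\bar Y_I=\bar y_I$ (with $i$ in place of $\{i\}$). Let $q_i(\cdot|\bar x_i)$ ($1\le i\le n$, $x^n\in\mathcal X^n$) be the local specifications of $q^n$: probability laws on $\mathcal X$, given for every $\bar x_i$, that are the conditional laws of the $i$-th coordinate under $q^n$ given the other coordinates whenever $\bar x_i$ has positive $q^n$-probability. Let $$\alpha=\min\{q_i(x_i|\bar x_i):\ 1\le i\le n,\ q^n(x^n)>0\}.$$ Let $|r-s|=\sup_B|r(B)-s(B)|$ be the variational distance, let $D(r\|s)=\sum_u r(u)\log\frac{r(u)}{s(u)}$ be the relative entropy (with $0\log 0=0$, and $D(r\|s)=\infty$ if $r(u)>0=s(u)$ for some $u$), and for laws $r,s$ of sequences let $W_2(r,s)=\min_\pi\big(\sum_i \Pr_\pi^2\{Z_i\ne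 U_i\}\big)^{1/2}$, the minimum being over all joint laws $\pi$ of $(Z,U)$ with marginals $r$ and $s$. Assume that $q^n$ satisfies the $\ell_2$ version of Dobrushin's uniqueness condition with coupling matrix $A=(a_{k,i})_{k,i=1}^n$: $a_{i,i}=0$ for all $i$; $|q_i(\cdot|\bar z_i)-q_i(\cdot|\bar s_i)|\le a_{k,i}$ for all $k\ne i$ and all $z^n,s^n\in\mathcal X^n$ that differ only in the $k$-th coordinate; and $\|A\|<1$, where $\|A\|$ is the operator norm of $A$ on Euclidean $\mathbb R^n$. Let $p^n$ be a probability measure on $\mathcal X^n$ such that $q^n(x^n)=0$ implies $p^n(x^n)=0$, and let $Y^n$ have law $p^n$. Then: 1. For every $I\subset[1,n]$ and every $\bar y_I$ with $\Pr\{\bar Y_I=\bar y_I\}>0$, $$W_2^2\big(p_I(\cdot|\bar y_I),q_I(\cdot|\bar y_I)\big)\le\frac1{(1-\|A\|)^2}\,\mathbb E\Big\{\sum_{i\in I}\big|p_i(\cdot|\bar Y_i)-q_i(\cdot|\bar Y_i)\big|^2\,\Big|\,\bar Y_I=\bar y_I\Big\}.$$ 2. One has $$D(p^n\|q^n)\le\frac4\alpha\cdot\frac1{(1-\|A\|)^2}\sum_{i=1}^n\mathbb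 E\big|p_i(\cdot|\bar Y_i)-q_i(\cdot|\bar Y_i)\big|^2\le\frac2\alpha\cdot\frac1{(1-\|A\|)^2}\sum_{i=1}^n\mathbb E\,D\big(p_i(\cdot|\bar Y_i)\,\|\,q_i(\cdot|\bar Y_i)\big).$$ 3. Let $\Gamma=\frac1n\sum_{i=1}^n\Gamma_i$ be the Gibbs sampler, where the Markov kernel $\Gamma_i$ leaves all coordinates but the $i$-th unchanged and replaces the $i$-th coordinate of $y^n$ by one drawn from $q_i(\cdot|\bar y_i)$. Then $$D(p^n\Gamma\|q^n)\le\Big(1-\frac{\alpha(1-\|A\|)^2}{2n}\Big)D(p^n\|q^n).$$ -/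

import Mathlib

open scoped BigOperators

noncomputable section

/-- Variational distance `|r - s| = sup_A |r(A) - s(A)|` of two laws on a finite set. -/
def tvDist {Z : Type*} [Fintype Z] (r s : Z → ℝ) : ℝ :=
  ⨆ B : Finset Z, |(∑ z ∈ B, r z) - ∑ z ∈ B, s z|

open Classical in
/-- Relative entropy `D(r‖s) = ∑ r(u) log (r(u)/s(u))`, with `0 log 0 = 0` and the value `∞` as soon as
`r(u) > 0 = s(u)` for some `u`. -/
def relEntropy {Z : Type*} [Fintype Z] (r s : Z → ℝ) : EReal :=
  if ∀ u, s u = 0 → r u = 0 then ((∑ u, r u * Real.log (r u / s u) : ℝ) : EReal) else ⊤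

/-- `π` is a joint law with marginals `r` and `s`. -/
def IsCoupling {Z : Type*} [Fintype Z] (r s : Z → ℝ) (π : Z × Z → ℝ) : Prop :=
  π ∈ stdSimplex ℝ (Z × Z) ∧ (∀ z, ∑ u, π (z, u) = r z) ∧ (∀ u, ∑ z, π (z, u) = s u)

/-- `Pr_π {Z_i ≠ U_i}`. -/
def disagreeProb {ι X : Type*} [Fintype ι] [DecidableEq ι] [Fintype X] [DecidableEq X]
    (π : (ι → X) × (ι → X) → ℝ) (i : ι) : ℝ :=
  ∑ w : (ι → X) × (ι → X), if w.1 i ≠ w.2 i then π w else 0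

/-- The distance `W₂(r, s) = min_π (∑_i Pr_π {Z_i ≠ U_i}²)^{1/2}`, over all couplings of `r` and `s`. -/
def W2 {ι X : Type*} [Fintype ι] [DecidableEq ι] [Fintype X] [DecidableEq X]
    (r s : (ι → X) → ℝ) : ℝ :=
  sInf {d : ℝ | ∃ π : (ι → X) × (ι → X) → ℝ, IsCoupling r s π ∧
    d = Real.sqrt (∑ i, disagreeProb π i ^ 2)}

variable {X : Type*} [Fintype X] [DecidableEq X] {n : ℕ}

/-- The sequence equal to `u` on `I` and to `y` off `I`. -/
def glue (I : Finset (Fin n)) (u : {k // k ∈ I} → X) (y : Fin n → X) : Fin n → X :=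
  fun k => if h : k ∈ I then u ⟨k, h⟩ else y k

/-- The probability, under `p`, that the coordinates outside `I` agree with those of `y`. -/
def outerMass (p : (Fin n → X) → ℝ) (I : Finset (Fin n)) (y : Fin n → X) : ℝ :=
  ∑ u : {k // k ∈ I} → X, p (glue I u y)

/-- The conditional law `p_I(· | ȳ_I)` of the coordinates in `I`, given that the coordinates outside `I`
agree with those of `y` (the values `y k`, `k ∈ I`, are not used). -/
def condLaw (p : (Fin n → X) → ℝ) (I : Finset (Fin n)) (y : Fin n → X) :
    ({k // k ∈ I} → X) → ℝ :=
  fun u => p (glue I u y) / outerMass p I y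

/-- The conditional law `p_i(· | ȳ_i)` of the `i`-th coordinate, given that all other coordinates
agree with those of `y` (the value `y i` is not used). -/
def condSite (p : (Fin n → X) → ℝ) (i : Fin n) (y : Fin n → X) : X → ℝ :=
  fun a => p (Function.update y i a) / ∑ b, p (Function.update y i b)

/-- `Q i x = q_i(· | x̄_i)`, `i ∈ [1,n]`, are local specifications of `q`: probability laws on `X` which
depend only on the coordinates of `x` other than the `i`-th, and which are the conditional laws of `q`
wherever these are determined, i.e. wherever `x̄_i` has positive probability. -/
def IsLocalSpec (q : (Fin n → X) → ℝ) (Q : Fin n → (Fin n → X) → X → ℝ) : Prop :=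
  (∀ i x, Q i x ∈ stdSimplex ℝ X) ∧
  (∀ i x y, (∀ k, k ≠ i → x k = y k) → Q i x = Q i y) ∧
  (∀ i x, 0 < ∑ b, q (Function.update x i b) → Q i x = condSite q i x)

/-- The minimum `α` of `q_i(x_i | x̄_i)` over all `i` and all `x` with `q(x) > 0`. -/
def minLocal (q : (Fin n → X) → ℝ) (Q : Fin n → (Fin n → X) → X → ℝ) : ℝ :=
  sInf {a : ℝ | ∃ (i : Fin n) (x : Fin n → X), 0 < q x ∧ a = Q i x (x i)}

/-- The operator norm of a matrix on Euclidean space. -/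
def l2Norm (A : Matrix (Fin n) (Fin n) ℝ) : ℝ :=
  ‖Matrix.toEuclideanCLM (n := Fin n) (𝕜 := ℝ) A‖

/-- The `ℓ₂` version of Dobrushin's uniqueness condition with coupling matrix `A = (a_{k,i})`. -/
def DobrushinL2 (Q : Fin n → (Fin n → X) → X → ℝ) (A : Matrix (Fin n) (Fin n) ℝ) : Prop :=
  (∀ k i : Fin n, k ≠ i → ∀ z s : Fin n → X, z k ≠ s k → (∀ l, l ≠ k → z l = s l) →
    tvDist (Q i z) (Q i s) ≤ A k i) ∧
  (∀ i, A i i = 0) ∧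
  l2Norm A < 1

/-- The kernel `Γ_i(z | y)`: update the `i`-th coordinate of `y` according to `q_i(· | ȳ_i)`. -/
def gibbsSite (Q : Fin n → (Fin n → X) → X → ℝ) (i : Fin n) (y z : Fin n → X) : ℝ :=
  if ∀ k, k ≠ i → y k = z k then Q i y (z i) else 0

/-- The Gibbs sampler `Γ(z | y) = (1/n) ∑_i Γ_i(z | y)`. -/
def gibbs (Q : Fin n → (Fin n → X) → X → ℝ) (y z : Fin n → X) : ℝ :=
  (1 / (n : ℝ)) * ∑ i, gibbsSite Q i y z

/-- The law `p Γ`. -/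
def gibbsStep (Q : Fin n → (Fin n → X) → X → ℝ) (p : (Fin n → X) → ℝ) : (Fin n → X) → ℝ :=
  fun z => ∑ y, p y * gibbs Q y z

/-- `|p_i(· | ȳ_i) - q_i(· | ȳ_i)|²`. -/
def siteGapSq (p : (Fin n → X) → ℝ) (Q : Fin n → (Fin n → X) → X → ℝ) (i : Fin n)
    (y : Fin n → X) : ℝ :=
  tvDist (condSite p i y) (Q i y) ^ 2

end

/-! All entropy bounds run through the Green matrix `G = (1 - A_S)⁻¹` of a set `S` of sites. Let
`Γ_k` resample site `k` by `Q`, and let `g k` bound the failure of `p` to be invariant: `p h - p Γ_k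
h ≤ g k * osc_k h`. Under Dobrushin's condition `Γ_k` adds at most `A j k * osc_k h` to the
oscillation of `h` at `j`. Iterating a lazy random scan and adding up the failures gives `p h - q h
≤ ∑ k, (g G) k * osc_k h` (`IsDobrushin.green_comparison`). Root mean square local gaps serve as `g`
(`IsDobrushin.source_le`).

Entropy is peeled off one coordinate at a time by the chain rule. Put `x = g G` and `u = G x`, and
let `o` be the oscillation of the density `f` of the `i`-th marginal of `p` against that of `q`. The
marginal entropy is at most the chi-square divergence, hence at most `x i * o`, and the Dirichlet
form of `f` under `Γ_i` is at most `y i * o` with `y i = x i / G i i`. Bounding that form below by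
`o ^ 2` requires that any possible symbol can replace any other at `i` with definite probability,
which zeros of `q` may obstruct. Some site always allows it with parameter `x i / u i`
(`exists_flippable`, again by comparison). For this site `α` times the marginal entropy is at most
`4 * y i * u i`, which the drop of `4 * |x|²` on removing `i` pays for (`green_energy_decrease`).
Conditioning on coordinate `i` keeps the gaps in mean square, so Minkowski's inequality closes the
induction (`IsDobrushin.entropy_le_green`); finally `|x| ≤ |g| / (1 - ‖A‖)` (`sum_sq_green_le`).

The transportation bound comes from lazily resampling a coupling by maximal couplings of the local
laws: the disagreement vector `d` is replaced by roughly `g + d A`, and a nearly optimal coupling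
cannot be improved much (`IsDobrushin.W2_le`). Pinsker's inequality turns gaps into local entropies.
A single-site update loses exactly the mean local entropy, and convexity averages this over sites,
so the entropy bound gives the contraction of the Gibbs sampler. -/

set_option linter.unusedSectionVars false

/-! ### Variational distance and its pairing with oscillation -/

section TotalVariation

variable {Z : Type*} [Fintype Z]

lemma abs_sum_sub_sum_le_tvDist (r s : Z → ℝ) (B : Finset Z) :
    |(∑ z ∈ B, r z) - ∑ z ∈ B, s z| ≤ tvDist r s :=
  le_ciSup (f := fun B : Finset Z => |(∑ z ∈ B, r z) - ∑ z ∈ B, s z|)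
    (Set.finite_range _).bddAbove B

lemma tvDist_le {r s : Z → ℝ} {d : ℝ}
    (h : ∀ B : Finset Z, |(∑ z ∈ B, r z) - ∑ z ∈ B, s z| ≤ d) : tvDist r s ≤ d :=
  ciSup_le h

lemma tvDist_nonneg (r s : Z → ℝ) : 0 ≤ tvDist r s := by
  simpa using abs_sum_sub_sum_le_tvDist r s ∅

lemma tvDist_self (r : Z → ℝ) : tvDist r r = 0 :=
  le_antisymm (tvDist_le fun B => by simp) (tvDist_nonneg r r)

lemma tvDist_triangle (r s t : Z → ℝ) : tvDist r t ≤ tvDist r s + tvDist s t := by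
  refine tvDist_le fun B => ?_
  calc |(∑ z ∈ B, r z) - ∑ z ∈ B, t z|
      = |((∑ z ∈ B, r z) - ∑ z ∈ B, s z) + ((∑ z ∈ B, s z) - ∑ z ∈ B, t z)| := by ring_nf
    _ ≤ _ := (abs_add_le _ _).trans
      (add_le_add (abs_sum_sub_sum_le_tvDist r s B) (abs_sum_sub_sum_le_tvDist s t B))

/-- Equal total masses allow the minimum of `φ` to be shifted to `0`. Then only the set where `s ≤
r` contributes positively, and there the shifted `φ` is at most `c`. -/
lemma sum_sub_mul_le_tvDist_mul {r s φ : Z → ℝ} {c : ℝ} (hrs : ∑ z, r z = ∑ z, s z)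
    (hφ : ∀ a b, φ a - φ b ≤ c) : ∑ z, (r z - s z) * φ z ≤ tvDist r s * c := by
  classical
  rcases isEmpty_or_nonempty Z with hZ | hZ
  · have : tvDist r s = 0 := le_antisymm (tvDist_le fun B => by
      simp [Finset.eq_empty_of_isEmpty B]) (tvDist_nonneg r s)
    simp [this]
  obtain ⟨b, hb⟩ := Finite.exists_min φ
  have hc : 0 ≤ c := by simpa using hφ b b
  have h1 : ∑ z, (r z - s z) * φ z = ∑ z, (r z - s z) * (φ z - φ b) := by
    simp only [mul_sub, Finset.sum_sub_distrib, ← Finset.sum_mul, hrs]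
    ring
  have h2 : ∀ z, (r z - s z) * (φ z - φ b) ≤ if s z ≤ r z then (r z - s z) * c else 0 := by
    intro z
    split_ifs with h
    · exact mul_le_mul_of_nonneg_left (hφ z b) (by linarith)
    · exact mul_nonpos_of_nonpos_of_nonneg (by linarith) (by linarith [hb z])
  rw [h1]
  refine (Finset.sum_le_sum fun z _ => h2 z).trans ?_
  rw [← Finset.sum_filter, ← Finset.sum_mul]
  refine mul_le_mul_of_nonneg_right ?_ hc
  rw [Finset.sum_sub_distrib]
  exact (le_abs_self _).trans (abs_sum_sub_sum_le_tvDist r s _)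

end TotalVariation

/-! ### Single-site resampling and the comparison of two laws -/

section Gibbs

variable {ι X : Type*} [Fintype ι] [DecidableEq ι] [Fintype X]

/-- Resampling of the coordinate `k` by the specification `Q k`, acting on functions. -/
noncomputable def gibbsOp (Q : ι → (ι → X) → X → ℝ) (k : ι) (h : (ι → X) → ℝ) (x : ι → X) : ℝ :=
  ∑ c, Q k x c * h (Function.update x k c)

/-- `c` bounds the oscillation of `h` in the coordinate `k`. -/
def OscLe (h : (ι → X) → ℝ) (k : ι) (c : ℝ) : Prop :=
  ∀ x a b, h (Function.update x k a) - h (Function.update x k b) ≤ c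

lemma OscLe.sub_le {h : (ι → X) → ℝ} {k : ι} {c : ℝ} (H : OscLe h k c) (x : ι → X) (a : X) :
    h x - h (Function.update x k a) ≤ c := by
  simpa using H x (x k) a

lemma OscLe.sub_le' {h : (ι → X) → ℝ} {k : ι} {c : ℝ} (H : OscLe h k c) (x : ι → X) (a : X) :
    h (Function.update x k a) - h x ≤ c := by
  simpa using H x a (x k)

/-- The local specifications `Q` satisfy Dobrushin's condition with the nonnegative coupling matrix
`A`, whose transpose has Euclidean operator norm at most `a < 1`. -/
structure IsDobrushin (Q : ι → (ι → X) → X → ℝ) (A : ι → ι → ℝ) (a : ℝ) : Prop where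
  entry_nonneg : ∀ k i, 0 ≤ A k i
  diag : ∀ i, A i i = 0
  nonneg : ∀ i x c, 0 ≤ Q i x c
  sum_eq_one : ∀ i x, ∑ c, Q i x c = 1
  update_self : ∀ i x c, Q i (Function.update x i c) = Q i x
  tv_le : ∀ k i x b c, k ≠ i →
    tvDist (Q i (Function.update x k b)) (Q i (Function.update x k c)) ≤ A k i
  norm_nonneg : 0 ≤ a
  norm_lt_one : a < 1
  quad : ∀ v : ι → ℝ, ∑ j, (∑ k, A k j * v k) ^ 2 ≤ a ^ 2 * ∑ k, v k ^ 2

/-- Exchanging the old and the new symbol at `k` is an involution; this is the change of variables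
behind the reversibility of resampling. -/
lemma sum_sum_update_swap (k : ι) (F : (ι → X) → X → ℝ) :
    ∑ x, ∑ c, F x c = ∑ x, ∑ c, F (Function.update x k c) (x k) := by
  classical
  rw [← Fintype.sum_prod_type', ← Fintype.sum_prod_type']
  refine Fintype.sum_bijective (fun w : (ι → X) × X => (Function.update w.1 k w.2, w.1 k))
    (Function.Involutive.bijective fun w => by simp) _ _ fun w => by simp

lemma sum_mul_gibbsOp {p : (ι → X) → ℝ} {Q : ι → (ι → X) → X → ℝ} {k : ι}
    (hQ : ∀ x c, Q k (Function.update x k c) = Q k x)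
    (hp : ∀ x c, p (Function.update x k c) = (∑ b, p (Function.update x k b)) * Q k x c)
    (h : (ι → X) → ℝ) : ∑ x, p x * gibbsOp Q k h x = ∑ x, p x * h x := by
  unfold gibbsOp
  simp only [Finset.mul_sum]
  rw [sum_sum_update_swap k]
  refine Finset.sum_congr rfl fun x _ => ?_
  have := hp x (x k)
  rw [Function.update_eq_self] at this
  simp only [Function.update_idem, Function.update_eq_self, hQ]
  rw [← Finset.sum_mul, this]
  ring

/-- `p` is invariant under resampling by its own conditional laws `R`, so the defect is the mean of
`R k - Q k` tested against `h` along one fibre, where `h` oscillates by at most `c`. -/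
lemma sum_sub_sum_gibbsOp_le {p : (ι → X) → ℝ} (hp0 : ∀ x, 0 ≤ p x)
    {R Q : ι → (ι → X) → X → ℝ} {k : ι}
    (hR : ∀ x c, R k (Function.update x k c) = R k x)
    (hp : ∀ x c, p (Function.update x k c) = (∑ b, p (Function.update x k b)) * R k x c)
    (hRQ : ∀ x, 0 < p x → ∑ c, R k x c = ∑ c, Q k x c)
    {h : (ι → X) → ℝ} {c : ℝ} (hh : OscLe h k c) :
    ∑ x, p x * h x - ∑ x, p x * gibbsOp Q k h x ≤ (∑ x, p x * tvDist (R k x) (Q k x)) * c := by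
  rw [← sum_mul_gibbsOp hR hp h, ← Finset.sum_sub_distrib, Finset.sum_mul]
  refine Finset.sum_le_sum fun x _ => ?_
  rcases (hp0 x).eq_or_lt with h0 | h0
  · simp [← h0]
  rw [← mul_sub, mul_assoc]
  refine mul_le_mul_of_nonneg_left ?_ (hp0 x)
  unfold gibbsOp
  rw [← Finset.sum_sub_distrib]
  simp only [← sub_mul]
  exact sum_sub_mul_le_tvDist_mul (hRQ x h0) fun a b => hh x a b

variable {Q : ι → (ι → X) → X → ℝ} {A : ι → ι → ℝ} {a : ℝ}

lemma IsDobrushin.oscLe_gibbsOp_self (hQ : IsDobrushin Q A a) (k : ι) (h : (ι → X) → ℝ) :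
    OscLe (gibbsOp Q k h) k 0 := by
  intro x b c
  simp [gibbsOp, hQ.update_self]

/-- A change at `j` acts twice: on the integrand, at cost `cj`, and on the resampling law, which
moves by at most `A j k` in variation and is tested against the oscillation of `h` at `k`. -/
lemma IsDobrushin.oscLe_gibbsOp (hQ : IsDobrushin Q A a) {k j : ι} (hjk : j ≠ k)
    {h : (ι → X) → ℝ} {cj ck : ℝ} (hj : OscLe h j cj) (hk : OscLe h k ck) :
    OscLe (gibbsOp Q k h) j (cj + A j k * ck) := by
  intro x b c
  have hck : 0 ≤ ck := by simpa using hk x b b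
  have e : gibbsOp Q k h (Function.update x j b) - gibbsOp Q k h (Function.update x j c) =
      ∑ d, Q k (Function.update x j b) d * (h (Function.update (Function.update x j b) k d)
        - h (Function.update (Function.update x j c) k d)) +
      ∑ d, (Q k (Function.update x j b) d - Q k (Function.update x j c) d) *
        h (Function.update (Function.update x j c) k d) := by
    unfold gibbsOp
    rw [← Finset.sum_sub_distrib, ← Finset.sum_add_distrib]
    exact Finset.sum_congr rfl fun d _ => by ring
  rw [e]
  refine add_le_add ?_ ?_
  · calc _ ≤ ∑ d, Q k (Function.update x j b) d * cj := by
          refine Finset.sum_le_sum fun d _ => mul_le_mul_of_nonneg_left ?_ (hQ.nonneg _ _ _)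
          rw [Function.update_comm hjk, Function.update_comm hjk]
          exact hj _ _ _
      _ = cj := by rw [← Finset.sum_mul, hQ.sum_eq_one, one_mul]
  · refine (sum_sub_mul_le_tvDist_mul (c := ck) (by rw [hQ.sum_eq_one, hQ.sum_eq_one])
      fun d d' => hk _ d d').trans ?_
    exact mul_le_mul_of_nonneg_right (hQ.tv_le _ _ _ _ _ hjk) hck

lemma sub_piecewise_le {h : (ι → X) → ℝ} {c : ι → ℝ} (S : Finset ι)
    (hc : ∀ k ∈ S, OscLe h k (c k)) (x₀ x : ι → X) :
    |h x - h (S.piecewise x₀ x)| ≤ ∑ k ∈ S, c k := by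
  induction S using Finset.induction_on with
  | empty => simp
  | insert k S hk ih =>
    have ih := ih fun j hj => hc j (Finset.mem_insert_of_mem hj)
    rw [Finset.piecewise_insert, Finset.sum_insert hk]
    have h1 := (hc k (Finset.mem_insert_self _ _)).sub_le (S.piecewise x₀ x) (x₀ k)
    have h2 := (hc k (Finset.mem_insert_self _ _)).sub_le' (S.piecewise x₀ x) (x₀ k)
    rw [abs_le] at *
    constructor <;> linarith [ih.1, ih.2]

/-- The lazy random scan sampler on `S`, acting on functions. -/
noncomputable def lazyOp (Q : ι → (ι → X) → X → ℝ) (S : Finset ι) (h : (ι → X) → ℝ)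
    (x : ι → X) : ℝ :=
  1 / ((S.card : ℝ) + 1) * (h x + ∑ k ∈ S, gibbsOp Q k h x)

lemma IsDobrushin.oscLe_lazyOp (hQ : IsDobrushin Q A a) {S : Finset ι} {h : (ι → X) → ℝ}
    {c : ι → ℝ} (hc : ∀ k ∈ S, OscLe h k (c k)) {j : ι} (hj : j ∈ S) :
    OscLe (lazyOp Q S h) j
      (1 / ((S.card : ℝ) + 1) * (S.card * c j + ∑ k ∈ S, A j k * c k)) := by
  intro x b d
  unfold lazyOp
  rw [← mul_sub]
  refine mul_le_mul_of_nonneg_left ?_ (by positivity)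
  have h0 := hc j hj x b d
  -- Resampling `j` itself erases the oscillation at `j`. The subtracted term records this and
  -- leaves `card` copies of `c j` among `card + 1` summands.
  have h1 : ∀ k ∈ S, gibbsOp Q k h (Function.update x j b) - gibbsOp Q k h (Function.update x j d)
      ≤ c j + A j k * c k - if k = j then c j else 0 := by
    intro k hk
    split_ifs with hkj
    · subst hkj
      simpa [hQ.diag] using hQ.oscLe_gibbsOp_self k h x b d
    · simpa using hQ.oscLe_gibbsOp (Ne.symm hkj) (hc j hj) (hc k hk) x b d
  have h2 := Finset.sum_le_sum h1
  rw [Finset.sum_sub_distrib, Finset.sum_sub_distrib, Finset.sum_add_distrib, Finset.sum_const,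
    nsmul_eq_mul, Finset.sum_ite_eq' S j, if_pos hj] at h2
  linarith

lemma sum_mul_lazyOp (p h : (ι → X) → ℝ) (S : Finset ι) :
    ∑ x, p x * lazyOp Q S h x =
      1 / ((S.card : ℝ) + 1) * (∑ x, p x * h x + ∑ k ∈ S, ∑ x, p x * gibbsOp Q k h x) := by
  unfold lazyOp
  rw [Finset.sum_comm, ← Finset.sum_add_distrib, Finset.mul_sum]
  refine Finset.sum_congr rfl fun x _ => ?_
  rw [← Finset.mul_sum]
  ring

/-- Weighted by a supersolution `x ≥ g + x A`, the oscillations drop in one lazy step by at least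
what the sources `g` contribute in that step. It serves both the main term and, with source `1`, the
remainder. -/
lemma sum_mul_lazyOp_osc_le {S : Finset ι} {c g x : ι → ℝ}
    (hc : ∀ k ∈ S, 0 ≤ c k) (hx : ∀ k ∈ S, g k + ∑ l ∈ S, A l k * x l ≤ x k) :
    ∑ j ∈ S, x j * (1 / ((S.card : ℝ) + 1) * (S.card * c j + ∑ k ∈ S, A j k * c k)) ≤
      ∑ j ∈ S, x j * c j - 1 / ((S.card : ℝ) + 1) * ∑ j ∈ S, g j * c j := by
  have h1 : ∑ j ∈ S, x j * ∑ k ∈ S, A j k * c k = ∑ k ∈ S, (∑ l ∈ S, A l k * x l) * c k := by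
    simp only [Finset.mul_sum, Finset.sum_mul]
    rw [Finset.sum_comm]
    exact Finset.sum_congr rfl fun k _ => Finset.sum_congr rfl fun l _ => by ring
  have h2 : ∑ k ∈ S, (∑ l ∈ S, A l k * x l) * c k ≤ ∑ k ∈ S, (x k - g k) * c k :=
    Finset.sum_le_sum fun k hk =>
      mul_le_mul_of_nonneg_right (by linarith [hx k hk]) (hc k hk)
  have h3 : ∑ j ∈ S, x j * (1 / ((S.card : ℝ) + 1) * (S.card * c j + ∑ k ∈ S, A j k * c k)) =
      1 / ((S.card : ℝ) + 1) *
        (S.card * ∑ j ∈ S, x j * c j + ∑ j ∈ S, x j * ∑ k ∈ S, A j k * c k) := by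
    rw [Finset.mul_sum (a := (S.card : ℝ)), ← Finset.sum_add_distrib, Finset.mul_sum]
    exact Finset.sum_congr rfl fun j _ => by ring
  have h4 : ∑ k ∈ S, (x k - g k) * c k = ∑ k ∈ S, x k * c k - ∑ k ∈ S, g k * c k := by
    simp [sub_mul]
  have hN : (0 : ℝ) < (S.card : ℝ) + 1 := by positivity
  rw [h3, h1]
  have h5 : ∀ t : ℝ, t = 1 / ((S.card : ℝ) + 1) * (S.card * t + t) := fun t => by
    field_simp
  rw [h4] at h2
  refine le_of_le_of_eq ?_ (congrArg (· - _) (h5 _).symm)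
  rw [← mul_sub]
  exact mul_le_mul_of_nonneg_left (by linarith) (one_div_nonneg.2 hN.le)

/-- Comparison of `p` with the `Γ`-invariant law `q`: sources `g` in the sites of `S` propagate to
oscillation weights `x` that dominate `g + x A`. -/
theorem IsDobrushin.comparison (hQ : IsDobrushin Q A a) {S : Finset ι} {p q : (ι → X) → ℝ}
    (hp0 : ∀ x, 0 ≤ p x) (hp1 : ∑ x, p x = 1) (hq0 : ∀ x, 0 ≤ q x) (hq1 : ∑ x, q x = 1)
    (hq : ∀ k ∈ S, ∀ h, ∑ x, q x * gibbsOp Q k h x = ∑ x, q x * h x)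
    {g : ι → ℝ} (hp : ∀ k ∈ S, ∀ h c, OscLe h k c →
      ∑ x, p x * h x - ∑ x, p x * gibbsOp Q k h x ≤ g k * c)
    (hoff : ∀ h : (ι → X) → ℝ, (∀ k ∈ S, ∀ x c, h (Function.update x k c) = h x) →
      ∑ x, p x * h x = ∑ x, q x * h x)
    {x e : ι → ℝ} (hx0 : ∀ k ∈ S, 0 ≤ x k) (hx : ∀ k ∈ S, g k + ∑ l ∈ S, A l k * x l ≤ x k)
    (he1 : ∀ k ∈ S, 1 ≤ e k) (he : ∀ k ∈ S, 1 + ∑ l ∈ S, A l k * e l ≤ e k)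
    {h : (ι → X) → ℝ} {c : ι → ℝ} (hc : ∀ k ∈ S, OscLe h k (c k)) :
    ∑ z, p z * h z - ∑ z, q z * h z ≤ ∑ k ∈ S, x k * c k := by
  classical
  obtain ⟨x₀⟩ : Nonempty (ι → X) := by
    by_contra H
    rw [not_nonempty_iff] at H
    simp at hq1
  have cnonneg : ∀ (h : (ι → X) → ℝ) (c : ι → ℝ), (∀ k ∈ S, OscLe h k (c k)) →
      ∀ k ∈ S, 0 ≤ c k := fun h c hc k hk => by
    simpa using hc k hk x₀ (x₀ k) (x₀ k)
  set ε : ℝ := 1 / ((S.card : ℝ) + 1) with hε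
  have hε0 : 0 < ε := by positivity
  set M : ℝ := ∑ k ∈ S, e k + 1 with hM
  have heS : 0 ≤ ∑ k ∈ S, e k := Finset.sum_nonneg fun k hk => by linarith [he1 k hk]
  have hM1 : 1 ≤ M := by linarith
  have heM : ∀ k ∈ S, e k ≤ M := fun k hk => by
    have := Finset.single_le_sum (f := e) (fun k hk => by linarith [he1 k hk]) hk
    linarith
  -- As `e ≤ M` on `S`, the loss `ε * ∑ c` due to source `1` is at least the fraction `ε / M` of `∑
  -- e * c`, so the remainder contracts by `ρ` per step.
  set ρ : ℝ := 1 - ε / M with hρ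
  have hε1 : ε ≤ 1 := by
    rw [hε, div_le_one (by positivity)]
    linarith [(Nat.cast_nonneg S.card : (0 : ℝ) ≤ S.card)]
  have hρ1 : ρ < 1 := by
    have : 0 < ε / M := by positivity
    linarith
  have hρ0 : 0 ≤ ρ := by
    have : ε / M ≤ 1 := by rw [div_le_one (by positivity)]; linarith
    linarith
  have key : ∀ (T : ℕ) (h : (ι → X) → ℝ) (c : ι → ℝ), (∀ k ∈ S, OscLe h k (c k)) →
      ∑ z, p z * h z - ∑ z, q z * h z ≤
        ∑ k ∈ S, x k * c k + ρ ^ T * (2 * ∑ k ∈ S, e k * c k) := by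
    intro T
    induction T with
    | zero =>
      intro h c hc
      have c0 := cnonneg h c hc
      -- Freezing the coordinates of `S` at `x₀` makes the two means equal and costs each law at
      -- most `∑ c ≤ ∑ e * c`; hence the factor `2`.
      have hsum := hoff (fun z => h (S.piecewise x₀ z)) (fun k hk z d => by
        congr 1
        ext j
        by_cases hj : j ∈ S
        · simp [hj]
        · have : j ≠ k := fun e => hj (e ▸ hk)
          simp [hj, this])
      have hbd := fun z => abs_le.1 (sub_piecewise_le S hc x₀ z)
      have hP : ∑ z, p z * h z ≤ ∑ z, p z * h (S.piecewise x₀ z) + ∑ k ∈ S, c k := by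
        rw [← one_mul (∑ k ∈ S, c k), ← hp1, Finset.sum_mul, ← Finset.sum_add_distrib]
        refine Finset.sum_le_sum fun z _ => ?_
        rw [← mul_add]
        exact mul_le_mul_of_nonneg_left (by linarith [(hbd z).2]) (hp0 z)
      have hP' : ∑ z, q z * h (S.piecewise x₀ z) ≤ ∑ z, q z * h z + ∑ k ∈ S, c k := by
        rw [← one_mul (∑ k ∈ S, c k), ← hq1, Finset.sum_mul, ← Finset.sum_add_distrib]
        refine Finset.sum_le_sum fun z _ => ?_
        rw [← mul_add]
        exact mul_le_mul_of_nonneg_left (by linarith [(hbd z).1]) (hq0 z)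
      have h1 : ∑ k ∈ S, c k ≤ ∑ k ∈ S, e k * c k := Finset.sum_le_sum fun k hk => by
        nlinarith [he1 k hk, c0 k hk]
      have h2 : 0 ≤ ∑ k ∈ S, x k * c k :=
        Finset.sum_nonneg fun k hk => mul_nonneg (hx0 k hk) (c0 k hk)
      simp only [pow_zero, one_mul]
      linarith
    | succ T ih =>
      intro h c hc
      have c0 := cnonneg h c hc
      have hstep := ih (lazyOp Q S h)
        (fun j => 1 / ((S.card : ℝ) + 1) * (S.card * c j + ∑ k ∈ S, A j k * c k))
        fun j hj => hQ.oscLe_lazyOp hc hj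
      have hxs := sum_mul_lazyOp_osc_le c0 hx
      have hes := sum_mul_lazyOp_osc_le (g := fun _ => 1) c0 he
      rw [sum_mul_lazyOp, sum_mul_lazyOp, Finset.sum_congr rfl fun k hk => hq k hk h] at hstep
      have hps : S.card * ∑ z, p z * h z - ∑ k ∈ S, ∑ z, p z * gibbsOp Q k h z ≤
          ∑ k ∈ S, g k * c k := by
        have := Finset.sum_le_sum fun k hk => hp k hk h (c k) (hc k hk)
        rwa [Finset.sum_sub_distrib, Finset.sum_const, nsmul_eq_mul] at this
      rw [Finset.sum_const, nsmul_eq_mul] at hstep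
      simp only [one_mul] at hes
      rw [← hε] at hstep hxs hes
      have hεS : ε * ((S.card : ℝ) + 1) = 1 := by
        rw [hε]; field_simp
      have hlow : ∑ k ∈ S, e k * c k ≤ M * ∑ k ∈ S, c k := by
        rw [Finset.mul_sum]
        exact Finset.sum_le_sum fun k hk => mul_le_mul_of_nonneg_right (heM k hk) (c0 k hk)
      have hes' : ∑ j ∈ S, e j * (ε * (S.card * c j + ∑ k ∈ S, A j k * c k)) ≤
          ρ * ∑ k ∈ S, e k * c k := by
        refine hes.trans ?_
        have : ε / M * ∑ k ∈ S, e k * c k ≤ ε * ∑ k ∈ S, c k := by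
          rw [div_mul_eq_mul_div, div_le_iff₀ (by linarith), mul_assoc, mul_comm (∑ k ∈ S, c k)]
          exact mul_le_mul_of_nonneg_left hlow hε0.le
        rw [hρ, sub_mul, one_mul]
        linarith
      have hpow : ρ ^ T * (2 * ∑ j ∈ S, e j * (ε * (S.card * c j + ∑ k ∈ S, A j k * c k))) ≤
          ρ ^ (T + 1) * (2 * ∑ k ∈ S, e k * c k) := by
        rw [pow_succ, mul_assoc]
        exact mul_le_mul_of_nonneg_left (by linarith) (pow_nonneg hρ0 _)
      -- One step of the telescoping: the source terms, at most `ε * ∑ g * c`, are exactly what the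
      -- `x`-weighted oscillation has lost in `hxs`.
      have e1 : ∑ z, p z * h z - ∑ z, q z * h z =
          ε * (S.card * ∑ z, p z * h z - ∑ k ∈ S, ∑ z, p z * gibbsOp Q k h z) +
          (ε * (∑ z, p z * h z + ∑ k ∈ S, ∑ z, p z * gibbsOp Q k h z) -
            ε * (∑ z, q z * h z + S.card * ∑ z, q z * h z)) := by
        linear_combination (-(∑ z, p z * h z) + ∑ z, q z * h z) * hεS
      rw [e1]
      have := mul_le_mul_of_nonneg_left hps hε0.le
      linarith
  have hlim : Filter.Tendsto (fun T : ℕ => ∑ k ∈ S, x k * c k + ρ ^ T * (2 * ∑ k ∈ S, e k * c k))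
      Filter.atTop (nhds (∑ k ∈ S, x k * c k + 0 * (2 * ∑ k ∈ S, e k * c k))) :=
    ((tendsto_pow_atTop_nhds_zero_of_lt_one hρ0 hρ1).mul_const _).const_add _
  rw [zero_mul, add_zero] at hlim
  exact ge_of_tendsto' hlim fun T => key T h c hc

end Gibbs

/-! ### The Green matrix of the coupling matrix -/

section Green

variable {ι X : Type*} [Fintype ι] [DecidableEq ι] [Fintype X]

/-- The matrix `A` with the rows and columns outside `S` replaced by zero. -/
def maskMatrix (A : ι → ι → ℝ) (S : Finset ι) : Matrix ι ι ℝ :=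
  Matrix.of fun k l => if k ∈ S ∧ l ∈ S then A k l else 0

/-- The Green matrix `(1 - A_S)⁻¹`. -/
noncomputable def green (A : ι → ι → ℝ) (S : Finset ι) : Matrix ι ι ℝ :=
  (1 - maskMatrix A S)⁻¹

variable {Q : ι → (ι → X) → X → ℝ} {A : ι → ι → ℝ} {a : ℝ}

lemma sum_mul_maskMatrix (A : ι → ι → ℝ) {S : Finset ι} {j : ι} (hj : j ∈ S) (v : ι → ℝ) :
    ∑ l, v l * maskMatrix A S l j = ∑ l ∈ S, v l * A l j := by
  rw [← Finset.sum_subset (Finset.subset_univ S)]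
  · exact Finset.sum_congr rfl fun l hl => by simp [maskMatrix, hl, hj]
  · intro l _ hl
    simp [maskMatrix, hl]

lemma sum_maskMatrix_mul (A : ι → ι → ℝ) {S : Finset ι} {i : ι} (hi : i ∈ S) (v : ι → ℝ) :
    ∑ l, maskMatrix A S i l * v l = ∑ l ∈ S, A i l * v l := by
  rw [← Finset.sum_subset (Finset.subset_univ S)]
  · exact Finset.sum_congr rfl fun l hl => by simp [maskMatrix, hl, hi]
  · intro l _ hl
    simp [maskMatrix, hl]

lemma maskMatrix_nonneg (hQ : IsDobrushin Q A a) (S : Finset ι) (k l : ι) :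
    0 ≤ maskMatrix A S k l := by
  simp only [maskMatrix, Matrix.of_apply]
  split_ifs
  exacts [hQ.entry_nonneg _ _, le_rfl]

lemma maskMatrix_quad (hQ : IsDobrushin Q A a) (S : Finset ι) (v : ι → ℝ) :
    ∑ j, (∑ k, v k * maskMatrix A S k j) ^ 2 ≤ a ^ 2 * ∑ k, v k ^ 2 := by
  calc ∑ j, (∑ k, v k * maskMatrix A S k j) ^ 2
      ≤ ∑ j, (∑ k, A k j * (if k ∈ S then v k else 0)) ^ 2 := by
        refine Finset.sum_le_sum fun j _ => ?_
        by_cases hj : j ∈ S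
        · refine le_of_eq ?_
          congr 1
          refine Finset.sum_congr rfl fun k _ => ?_
          by_cases hk : k ∈ S <;> simp [maskMatrix, hj, hk, mul_comm]
        · simp [maskMatrix, hj]
          positivity
    _ ≤ a ^ 2 * ∑ k, (if k ∈ S then v k else 0) ^ 2 := hQ.quad _
    _ ≤ _ := by
        refine mul_le_mul_of_nonneg_left (Finset.sum_le_sum fun k _ => ?_) (sq_nonneg a)
        split_ifs
        · exact le_rfl
        · simp only [ne_eq, OfNat.ofNat_ne_zero, not_false_eq_true, zero_pow]
          positivity

lemma eq_zero_of_sum_sq_le {a : ℝ} (h0 : 0 ≤ a) (h1 : a < 1) {v w : ι → ℝ}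
    (hvw : ∀ k, v k ^ 2 ≤ w k ^ 2) (hw : ∑ k, w k ^ 2 ≤ a ^ 2 * ∑ k, v k ^ 2) : v = 0 := by
  have h2 : ∑ k, v k ^ 2 ≤ ∑ k, w k ^ 2 := Finset.sum_le_sum fun k _ => hvw k
  have h3 : 0 ≤ ∑ k, v k ^ 2 := Finset.sum_nonneg fun k _ => sq_nonneg _
  have h4 : a ^ 2 < 1 := by nlinarith
  have h5 : ∑ k, v k ^ 2 = 0 := by nlinarith
  rw [Finset.sum_eq_zero_iff_of_nonneg fun k _ => sq_nonneg _] at h5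
  ext k
  simpa using h5 k (Finset.mem_univ k)

/-- A contraction with factor `a < 1` has no nonzero fixed row vector. -/
lemma isUnit_one_sub_maskMatrix (hQ : IsDobrushin Q A a) (S : Finset ι) :
    IsUnit (1 - maskMatrix A S) := by
  rw [← Matrix.vecMul_injective_iff_isUnit, ← Matrix.coe_vecMulLinear, injective_iff_map_eq_zero]
  intro v hv
  have hv' : ∀ k, v k = ∑ l, v l * maskMatrix A S l k := by
    intro k
    rw [Matrix.vecMulLinear_apply, Matrix.vecMul_sub, Matrix.vecMul_one, sub_eq_zero] at hv
    exact congrFun hv k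
  refine eq_zero_of_sum_sq_le hQ.norm_nonneg hQ.norm_lt_one (fun k => le_rfl) ?_
  calc ∑ k, v k ^ 2 = ∑ k, (∑ l, v l * maskMatrix A S l k) ^ 2 :=
        Finset.sum_congr rfl fun k _ => by rw [← hv' k]
    _ ≤ _ := maskMatrix_quad hQ S v

lemma green_mul (hQ : IsDobrushin Q A a) (S : Finset ι) : green A S * (1 - maskMatrix A S) = 1 :=
  Matrix.nonsing_inv_mul _ ((Matrix.isUnit_iff_isUnit_det _).1 (isUnit_one_sub_maskMatrix hQ S))

lemma mul_green (hQ : IsDobrushin Q A a) (S : Finset ι) : (1 - maskMatrix A S) * green A S = 1 :=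
  Matrix.mul_nonsing_inv _ ((Matrix.isUnit_iff_isUnit_det _).1 (isUnit_one_sub_maskMatrix hQ S))

lemma green_eq_add (hQ : IsDobrushin Q A a) (S : Finset ι) (i j : ι) :
    green A S i j = (1 : Matrix ι ι ℝ) i j + ∑ l, green A S i l * maskMatrix A S l j := by
  have := congrFun (congrFun (green_mul hQ S) i) j
  rw [mul_sub, mul_one, Matrix.sub_apply, Matrix.mul_apply] at this
  linarith

lemma green_row (hQ : IsDobrushin Q A a) {S : Finset ι} (i : ι) {j : ι} (hj : j ∈ S) :
    green A S i j = (if i = j then 1 else 0) + ∑ l ∈ S, green A S i l * A l j := by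
  rw [green_eq_add hQ, sum_mul_maskMatrix A hj, Matrix.one_apply]

lemma green_col (hQ : IsDobrushin Q A a) {S : Finset ι} {i : ι} (hi : i ∈ S) (j : ι) :
    green A S i j = (if i = j then 1 else 0) + ∑ l ∈ S, A i l * green A S l j := by
  have := congrFun (congrFun (mul_green hQ S) i) j
  rw [sub_mul, one_mul, Matrix.sub_apply, Matrix.mul_apply, sum_maskMatrix_mul A hi,
    Matrix.one_apply] at this
  linarith

/-- The negative part `v` of a row satisfies `v ≤ v A_S` entrywise, since `1` and `A_S` are
nonnegative; contraction then forces `v = 0`. -/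
lemma green_nonneg (hQ : IsDobrushin Q A a) (S : Finset ι) (i j : ι) : 0 ≤ green A S i j := by
  set v : ι → ℝ := fun j => max (-green A S i j) 0 with hv
  have hv0 : ∀ j, 0 ≤ v j := fun j => le_max_right _ _
  have hle : ∀ j, v j ≤ ∑ l, v l * maskMatrix A S l j := by
    intro j
    refine max_le ?_ (Finset.sum_nonneg fun l _ => mul_nonneg (hv0 l) (maskMatrix_nonneg hQ S l j))
    have h1 := green_eq_add hQ S i j
    have h2 : 0 ≤ (1 : Matrix ι ι ℝ) i j := by
      rw [Matrix.one_apply]; split_ifs <;> norm_num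
    have h3 : -∑ l, green A S i l * maskMatrix A S l j ≤ ∑ l, v l * maskMatrix A S l j := by
      rw [← Finset.sum_neg_distrib]
      refine Finset.sum_le_sum fun l _ => ?_
      rw [← neg_mul]
      exact mul_le_mul_of_nonneg_right (le_max_left _ _) (maskMatrix_nonneg hQ S l j)
    linarith
  have h0 : v = 0 := eq_zero_of_sum_sq_le hQ.norm_nonneg hQ.norm_lt_one
    (fun k => pow_le_pow_left₀ (hv0 k) (hle k) 2) (maskMatrix_quad hQ S v)
  have := congrFun h0 j
  simp only [hv, Pi.zero_apply] at this
  have := le_max_left (-green A S i j) 0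
  linarith

lemma one_le_green_self (hQ : IsDobrushin Q A a) {S : Finset ι} {i : ι} (hi : i ∈ S) :
    1 ≤ green A S i i := by
  rw [green_row hQ i hi, if_pos rfl]
  have : 0 ≤ ∑ l ∈ S, green A S i l * A l i :=
    Finset.sum_nonneg fun l _ => mul_nonneg (green_nonneg hQ S i l) (hQ.entry_nonneg l i)
  linarith

/-- The tool for identifying Green matrices of smaller sets: checking the row equation on `S`
suffices. -/
lemma green_unique (hQ : IsDobrushin Q A a) {S : Finset ι} {w m : ι → ℝ}
    (h : ∀ j ∈ S, w j = m j + ∑ l ∈ S, w l * A l j) {j : ι} (hj : j ∈ S) :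
    w j = ∑ l ∈ S, m l * green A S l j := by
  have h1 : ∑ l ∈ S, w l * (green A S l j - ∑ l' ∈ S, A l l' * green A S l' j) = w j := by
    rw [Finset.sum_congr rfl fun l hl => by
      rw [green_col hQ hl j, add_sub_cancel_right]]
    simp [hj]
  rw [← h1]
  simp only [mul_sub, Finset.sum_sub_distrib, Finset.mul_sum]
  rw [Finset.sum_comm, ← Finset.sum_sub_distrib]
  refine Finset.sum_congr rfl fun l hl => ?_
  have : m l = w l - ∑ l' ∈ S, w l' * A l' l := by linarith [h l hl]
  rw [this, sub_mul, Finset.sum_mul]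
  simp only [mul_assoc]

/-- A Schur complement: the rank-one correction annihilates column `i` of `green A S`, so the row
equation on `S` becomes one on `S.erase i`. -/
lemma green_erase (hQ : IsDobrushin Q A a) {S : Finset ι} {i : ι} (hi : i ∈ S) {l k : ι}
    (hl : l ∈ S.erase i) (hk : k ∈ S.erase i) :
    green A (S.erase i) l k =
      green A S l k - green A S l i * green A S i k / green A S i i := by
  have hG : green A S i i ≠ 0 := by linarith [one_le_green_self hQ hi]
  have := green_unique hQ (S := S.erase i) (m := fun j => if l = j then 1 else 0)
    (w := fun k => green A S l k - green A S l i * green A S i k / green A S i i)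
    (fun j hj => by
      have hjS := Finset.mem_of_mem_erase hj
      have hij : i ≠ j := (Finset.ne_of_mem_erase hj).symm
      have h1 := green_row hQ l hjS
      have h2 := green_row hQ i hjS
      rw [if_neg hij, zero_add] at h2
      rw [← Finset.add_sum_erase _ _ hi] at h1 h2
      have h3 : ∑ j' ∈ S.erase i, (green A S l j' - green A S l i * green A S i j' / green A S i i)
          * A j' j = ∑ j' ∈ S.erase i, green A S l j' * A j' j -
          green A S l i / green A S i i * ∑ j' ∈ S.erase i, green A S i j' * A j' j := by
        rw [Finset.mul_sum, ← Finset.sum_sub_distrib]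
        exact Finset.sum_congr rfl fun j' _ => by ring
      simp only [h3]
      rw [h1, h2]
      field_simp
      ring) hk
  refine Eq.symm (this.trans ?_)
  simp only [ite_mul, one_mul, zero_mul]
  rw [Finset.sum_ite_eq, if_pos hl]

/-- Removing a site from the row solution `x = g + x A`. -/
lemma sum_mul_green_erase (hQ : IsDobrushin Q A a) {S : Finset ι} {i : ι} (hi : i ∈ S)
    (g : ι → ℝ) {k : ι} (hk : k ∈ S.erase i) :
    ∑ l ∈ S.erase i, g l * green A (S.erase i) l k =
      ∑ l ∈ S, g l * green A S l k -
        (∑ l ∈ S, g l * green A S l i) * (green A S i k / green A S i i) := by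
  have hG : green A S i i ≠ 0 := by linarith [one_le_green_self hQ hi]
  rw [Finset.sum_congr rfl fun l hl => by rw [green_erase hQ hi hl hk], ← Finset.add_sum_erase S _ hi,
    ← Finset.add_sum_erase S _ hi, add_mul, Finset.sum_mul]
  have : g i * green A S i i * (green A S i k / green A S i i) = g i * green A S i k := by
    field_simp
  rw [this, add_sub_add_left_eq_sub, ← Finset.sum_sub_distrib]
  exact Finset.sum_congr rfl fun l _ => by ring

/-- Removing a site from the column solution `u = m + A u`. -/
lemma sum_green_erase_mul (hQ : IsDobrushin Q A a) {S : Finset ι} {i : ι} (hi : i ∈ S)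
    (m : ι → ℝ) {k : ι} (hk : k ∈ S.erase i) :
    ∑ l ∈ S.erase i, green A (S.erase i) k l * m l =
      ∑ l ∈ S, green A S k l * m l -
        (green A S k i / green A S i i) * ∑ l ∈ S, green A S i l * m l := by
  have hG : green A S i i ≠ 0 := by linarith [one_le_green_self hQ hi]
  rw [Finset.sum_congr rfl fun l hl => by rw [green_erase hQ hi hk hl], ← Finset.add_sum_erase S _ hi,
    ← Finset.add_sum_erase S _ hi, mul_add, Finset.mul_sum]
  have : green A S k i / green A S i i * (green A S i i * m i) = green A S k i * m i := by
    field_simp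
  rw [this, add_sub_add_left_eq_sub, ← Finset.sum_sub_distrib]
  exact Finset.sum_congr rfl fun l _ => by ring

lemma sum_mul_green_row (hQ : IsDobrushin Q A a) {S : Finset ι} (g : ι → ℝ) {k : ι} (hk : k ∈ S) :
    ∑ l ∈ S, g l * green A S l k = g k + ∑ j ∈ S, A j k * ∑ l ∈ S, g l * green A S l j := by
  rw [Finset.sum_congr rfl fun l hl => by rw [green_row hQ l hk]]
  simp only [mul_add, Finset.sum_add_distrib, mul_ite, mul_one, mul_zero, Finset.sum_ite_eq', hk,
    if_true]
  congr 1
  simp only [Finset.mul_sum]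
  rw [Finset.sum_comm]
  exact Finset.sum_congr rfl fun j _ => Finset.sum_congr rfl fun l _ => by ring

/-- The comparison theorem with the propagated sources given by the Green matrix. -/
theorem IsDobrushin.green_comparison (hQ : IsDobrushin Q A a) {S : Finset ι} {p q : (ι → X) → ℝ}
    (hp0 : ∀ x, 0 ≤ p x) (hp1 : ∑ x, p x = 1) (hq0 : ∀ x, 0 ≤ q x) (hq1 : ∑ x, q x = 1)
    (hq : ∀ k ∈ S, ∀ h, ∑ x, q x * gibbsOp Q k h x = ∑ x, q x * h x)
    {g : ι → ℝ} (hg : ∀ k ∈ S, 0 ≤ g k) (hp : ∀ k ∈ S, ∀ h c, OscLe h k c →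
      ∑ x, p x * h x - ∑ x, p x * gibbsOp Q k h x ≤ g k * c)
    (hoff : ∀ h : (ι → X) → ℝ, (∀ k ∈ S, ∀ x c, h (Function.update x k c) = h x) →
      ∑ x, p x * h x = ∑ x, q x * h x)
    {h : (ι → X) → ℝ} {c : ι → ℝ} (hc : ∀ k ∈ S, OscLe h k (c k)) :
    ∑ z, p z * h z - ∑ z, q z * h z ≤ ∑ k ∈ S, (∑ l ∈ S, g l * green A S l k) * c k := by
  refine hQ.comparison hp0 hp1 hq0 hq1 hq hp hoff
    (e := fun k => ∑ l ∈ S, 1 * green A S l k)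
    (fun k _ => Finset.sum_nonneg fun l hl => mul_nonneg (hg l hl) (green_nonneg hQ S l k))
    (fun k hk => (sum_mul_green_row hQ g hk).ge) (fun k hk => ?_)
    (fun k hk => (sum_mul_green_row hQ (fun _ => 1) hk).ge) hc
  refine (one_le_green_self hQ hk).trans ?_
  simpa using Finset.single_le_sum (f := fun l => green A S l k)
    (fun l _ => green_nonneg hQ S l k) hk

end Green

/-! ### Flippable sites: coping with zeros of `q` -/

section Cylinder

variable {ι X : Type*} [Fintype ι] [DecidableEq ι] [Fintype X]

/-- On the sites of `S`, the conditional laws of `q` are given by `Q`. -/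
def HasSpec (q : (ι → X) → ℝ) (Q : ι → (ι → X) → X → ℝ) (S : Finset ι) : Prop :=
  ∀ k ∈ S, ∀ x c, q (Function.update x k c) = (∑ b, q (Function.update x k b)) * Q k x c

lemma HasSpec.mono {q : (ι → X) → ℝ} {Q : ι → (ι → X) → X → ℝ} {S T : Finset ι}
    (h : HasSpec q Q T) (hST : S ⊆ T) : HasSpec q Q S := fun k hk => h k (hST hk)

/-- `x` and `z` agree off `U`. -/
def AgreeOff (U : Finset ι) (z x : ι → X) : Prop := ∀ k, k ∉ U → x k = z k

lemma agreeOff_update {U : Finset ι} {z x : ι → X} {k : ι} (hk : k ∈ U) (c : X) :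
    AgreeOff U z (Function.update x k c) ↔ AgreeOff U z x := by
  refine forall_congr' fun l => imp_congr_right fun hl => ?_
  rw [Function.update_of_ne (by rintro rfl; exact hl hk)]

open Classical in
/-- The restriction of `f` to the configurations that agree with `z` off `U`. -/
noncomputable def slice (U : Finset ι) (z : ι → X) (f : (ι → X) → ℝ) (x : ι → X) : ℝ :=
  if AgreeOff U z x then f x else 0

/-- The mass of the slice. -/
noncomputable def cyl (U : Finset ι) (z : ι → X) (f : (ι → X) → ℝ) : ℝ := ∑ x, slice U z f x

lemma slice_nonneg {U : Finset ι} {z : ι → X} {f : (ι → X) → ℝ} (hf : ∀ x, 0 ≤ f x) (x : ι → X) :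
    0 ≤ slice U z f x := by
  unfold slice
  split_ifs
  exacts [hf x, le_rfl]

lemma cyl_nonneg {U : Finset ι} {z : ι → X} {f : (ι → X) → ℝ} (hf : ∀ x, 0 ≤ f x) :
    0 ≤ cyl U z f := Finset.sum_nonneg fun x _ => slice_nonneg hf x

open Classical in
lemma slice_update {U : Finset ι} {k : ι} (hk : k ∈ U) (z : ι → X) (f : (ι → X) → ℝ) (x : ι → X)
    (c : X) : slice U z f (Function.update x k c) =
      if AgreeOff U z x then f (Function.update x k c) else 0 := by
  unfold slice
  exact if_congr (agreeOff_update hk c) rfl rfl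

lemma HasSpec.slice {q : (ι → X) → ℝ} {Q : ι → (ι → X) → X → ℝ} {U : Finset ι}
    (h : HasSpec q Q U) (z : ι → X) : HasSpec (slice U z q) Q U := by
  intro k hk x c
  simp only [slice_update hk]
  split_ifs
  · exact h k hk x c
  · simp

lemma HasSpec.const_mul {q : (ι → X) → ℝ} {Q : ι → (ι → X) → X → ℝ} {U : Finset ι}
    (h : HasSpec q Q U) (t : ℝ) : HasSpec (fun x => t * q x) Q U := by
  intro k hk x c
  change t * q _ = (∑ b, t * q _) * _
  rw [h k hk x c, ← Finset.mul_sum, mul_assoc]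

lemma eq_of_update_invariant {β : Type*} {U : Finset ι} {h : (ι → X) → β}
    (hh : ∀ k ∈ U, ∀ x c, h (Function.update x k c) = h x) {z x : ι → X} (hx : AgreeOff U z x) :
    h x = h z := by
  have key : ∀ V : Finset ι, V ⊆ U → h (V.piecewise z x) = h x := by
    intro V
    induction V using Finset.induction_on with
    | empty => simp
    | insert k V hk ih =>
      intro hV
      rw [Finset.piecewise_insert, hh k (hV (Finset.mem_insert_self _ _)),
        ih fun l hl => hV (Finset.mem_insert_of_mem hl)]
  rw [← key U subset_rfl]
  congr 1
  ext k
  by_cases hk : k ∈ U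
  · simp [hk]
  · simp [hk, hx k hk]

lemma sum_mul_eq_of_supported {U : Finset ι} {z : ι → X} {p h : (ι → X) → ℝ}
    (hp1 : ∑ x, p x = 1) (hp : ∀ x, p x ≠ 0 → AgreeOff U z x)
    (hh : ∀ k ∈ U, ∀ x c, h (Function.update x k c) = h x) : ∑ x, p x * h x = h z := by
  rw [← one_mul (h z), ← hp1, Finset.sum_mul]
  refine Finset.sum_congr rfl fun x _ => ?_
  by_cases hx : p x = 0
  · simp [hx]
  · rw [eq_of_update_invariant hh (hp x hx)]

lemma cyl_eq_sum_erase {U : Finset ι} {k : ι} (hk : k ∈ U) (z : ι → X) (f : (ι → X) → ℝ) :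
    cyl U z f = ∑ d, cyl (U.erase k) (Function.update z k d) f := by
  classical
  unfold cyl
  rw [Finset.sum_comm]
  refine Finset.sum_congr rfl fun x _ => ?_
  have : ∀ d, AgreeOff (U.erase k) (Function.update z k d) x ↔ x k = d ∧ AgreeOff U z x := by
    intro d
    constructor
    · intro h
      refine ⟨by simpa using h k (Finset.notMem_erase k U), fun l hl => ?_⟩
      have hlk : l ≠ k := by rintro rfl; exact hl hk
      simpa [hlk] using h l (fun h' => hl (Finset.mem_of_mem_erase h'))
    · rintro ⟨h1, h2⟩ l hl
      by_cases hlk : l = k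
      · subst hlk; simpa using h1
      · rw [Function.update_of_ne hlk]
        exact h2 l fun h' => hl (Finset.mem_erase.2 ⟨hlk, h'⟩)
  unfold slice
  simp only [this]
  split_ifs with h
  · simp [h]
  · simp [h]

lemma cyl_empty (z : ι → X) (f : (ι → X) → ℝ) : cyl ∅ z f = f z := by
  classical
  have : ∀ x, AgreeOff ∅ z x ↔ x = z := fun x => by simp [AgreeOff, funext_iff]
  simp [cyl, slice, this]

open Classical in
/-- Given an outer configuration off `U ∪ {i}`, a symbol `c` that is possible at `i` can be put at
`i` with conditional probability at least `t`, whatever possible symbol is there. -/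
def Flippable (q : (ι → X) → ℝ) (i : ι) (U : Finset ι) (t : ℝ) : Prop :=
  ∀ z c, 0 < cyl U z (fun x => q (Function.update x i c)) →
    t * cyl U z q ≤ cyl U z (fun x => if 0 < q (Function.update x i c) then q x else 0)

lemma Flippable.mono {q : (ι → X) → ℝ} (hq : ∀ x, 0 ≤ q x) {i : ι} {U : Finset ι} {s t : ℝ}
    (h : Flippable q i U t) (hst : s ≤ t) : Flippable q i U s := fun z c hc =>
  (mul_le_mul_of_nonneg_right hst (cyl_nonneg hq)).trans (h z c hc)

lemma flippable_empty (q : (ι → X) → ℝ) (i : ι) : Flippable q i ∅ 1 := by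
  intro z c hc
  rw [cyl_empty] at *
  simp [cyl_empty, hc]

variable {Q : ι → (ι → X) → X → ℝ} {A : ι → ι → ℝ} {a : ℝ}

-- On a slice, compare `q` with `b`, which is `q` read with `c` forced at `i`. The local laws of `b`
-- differ from `Q` at `l` by at most `A i l` in variation, so `A i` is the source. The test function
-- is the indicator `f` that the symbol at `k` still leaves `c` possible at `i`. It has mean `1`
-- under normalised `b`, hence mean at least `1 - ∑ A i l * G l k` under normalised `q`. For each
-- such symbol the hypothesis on `U.erase k` supplies the factor `t`.
open Classical in
lemma Flippable.step (hQ : IsDobrushin Q A a) {q : (ι → X) → ℝ} (hq0 : ∀ x, 0 ≤ q x)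
    {i k : ι} {U : Finset ι} (hi : i ∉ U) (hk : k ∈ U) (hqU : HasSpec q Q U) {t : ℝ} (ht : 0 ≤ t)
    (h : Flippable q i (U.erase k) t) :
    Flippable q i U ((1 - ∑ l ∈ U, A i l * green A U l k) * t) := by
  intro z c hc
  set b : (ι → X) → ℝ := fun x => q (Function.update x i c) with hb
  have hb0 : ∀ x, 0 ≤ b x := fun x => hq0 _
  rcases (cyl_nonneg hq0 : 0 ≤ cyl U z q).eq_or_lt with h0 | hpos
  · rw [← h0, mul_zero]
    exact cyl_nonneg fun x => by split_ifs; exacts [hq0 x, le_rfl]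
  set C : X → Prop := fun d => 0 < cyl (U.erase k) (Function.update z k d) b with hC
  set f : (ι → X) → ℝ := fun x => if C (x k) then 1 else 0 with hf
  have hbound : (1 - ∑ l ∈ U, A i l * green A U l k) * cyl U z q ≤ ∑ x, slice U z q x * f x := by
    set p' : (ι → X) → ℝ := fun x => (cyl U z b)⁻¹ * slice U z b x with hp'
    set q' : (ι → X) → ℝ := fun x => (cyl U z q)⁻¹ * slice U z q x with hq'
    have hp'0 : ∀ x, 0 ≤ p' x := fun x => mul_nonneg (inv_nonneg.2 hc.le) (slice_nonneg hb0 x)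
    have hq'0 : ∀ x, 0 ≤ q' x := fun x => mul_nonneg (inv_nonneg.2 hpos.le) (slice_nonneg hq0 x)
    have hp'1 : ∑ x, p' x = 1 := by
      rw [hp', ← Finset.mul_sum]; exact inv_mul_cancel₀ hc.ne'
    have hq'1 : ∑ x, q' x = 1 := by
      rw [hq', ← Finset.mul_sum]; exact inv_mul_cancel₀ hpos.ne'
    have hp's : ∀ x, p' x ≠ 0 → AgreeOff U z x := fun x hx => by
      by_contra H; exact hx (by simp [hp', slice, H])
    have hq's : ∀ x, q' x ≠ 0 → AgreeOff U z x := fun x hx => by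
      by_contra H; exact hx (by simp [hq', slice, H])
    have hik : ∀ l ∈ U, l ≠ i := fun l hl e => hi (e ▸ hl)
    have hbspec : HasSpec b (fun l x => Q l (Function.update x i c)) U := by
      intro l hl x d
      simp only [hb]
      have := hqU l hl (Function.update x i c) d
      simpa only [Function.update_comm (hik l hl)] using this
    have hcmp := hQ.green_comparison (S := U) (g := fun l => A i l) (h := f)
      (c := fun l => if l = k then 1 else 0) hp'0 hp'1 hq'0 hq'1
      (fun l hl h => sum_mul_gibbsOp (fun x d => hQ.update_self l x d)
        (((hqU.slice z).const_mul _) l hl) h)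
      (fun l _ => hQ.entry_nonneg i l)
      (fun l hl h c' hh => by
        refine (sum_sub_sum_gibbsOp_le hp'0 (R := fun l x => Q l (Function.update x i c))
          (fun x d => by
            rw [Function.update_comm (hik l hl), hQ.update_self])
          (((hbspec.slice z).const_mul _) l hl)
          (fun x _ => by rw [hQ.sum_eq_one, hQ.sum_eq_one]) hh).trans ?_
        have hc' : 0 ≤ c' := by simpa using hh z (z l) (z l)
        refine mul_le_mul_of_nonneg_right ?_ hc'
        rw [← one_mul (A i l), ← hp'1, Finset.sum_mul]
        refine Finset.sum_le_sum fun x _ => mul_le_mul_of_nonneg_left ?_ (hp'0 x)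
        simpa using hQ.tv_le i l x c (x i) (hik l hl).symm)
      (fun h hh => by
        rw [sum_mul_eq_of_supported hp'1 hp's hh, sum_mul_eq_of_supported hq'1 hq's hh])
      (fun l hl => by
        intro x d d'
        by_cases hlk : l = k
        · simp only [hlk, if_true, hf]
          split_ifs <;> norm_num
        · simp [hlk, hf, Function.update_of_ne (Ne.symm hlk)])
    have hpf : ∑ x, p' x * f x = 1 := by
      rw [← hp'1]
      refine Finset.sum_congr rfl fun x _ => ?_
      by_cases hx : p' x = 0
      · simp [hx]
      have hCx : C (x k) := by
        rcases (cyl_nonneg hb0 : 0 ≤ cyl (U.erase k) (Function.update z k (x k)) b).eq_or_lt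
          with h0 | h0
        · exfalso
          have h1 := (Finset.sum_eq_zero_iff_of_nonneg
            fun x _ => slice_nonneg hb0 x).1 h0.symm x (Finset.mem_univ x)
          have h2 : AgreeOff (U.erase k) (Function.update z k (x k)) x := by
            intro l hl
            by_cases hlk : l = k
            · subst hlk; simp
            · rw [Function.update_of_ne hlk]
              exact hp's x hx l fun h' => hl (Finset.mem_erase.2 ⟨hlk, h'⟩)
          rw [slice, if_pos h2] at h1
          exact hx (by simp [hp', slice, h1])
        · exact h0
      simp [hf, hCx]
    have hqf : ∑ x, q' x * f x = (cyl U z q)⁻¹ * ∑ x, slice U z q x * f x := by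
      rw [Finset.mul_sum]
      exact Finset.sum_congr rfl fun x _ => by rw [hq', mul_assoc]
    rw [hpf, hqf] at hcmp
    simp only [mul_ite, mul_one, mul_zero, Finset.sum_ite_eq', hk, if_true] at hcmp
    have := mul_le_mul_of_nonneg_right hcmp hpos.le
    have h1 := mul_inv_cancel_left₀ hpos.ne' (∑ x, slice U z q x * f x)
    linarith
  have hfs : ∑ x, slice U z q x * f x =
      ∑ d, (if C d then cyl (U.erase k) (Function.update z k d) q else 0) := by
    have : ∑ x, slice U z q x * f x = cyl U z (fun x => q x * f x) :=
      Finset.sum_congr rfl fun x _ => by unfold slice; split_ifs <;> simp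
    rw [this, cyl_eq_sum_erase hk]
    refine Finset.sum_congr rfl fun d _ => ?_
    have hfd : ∀ x, AgreeOff (U.erase k) (Function.update z k d) x →
        f x = if C d then 1 else 0 := fun x hx => by
      have : x k = d := by simpa using hx k (Finset.notMem_erase k U)
      simp [hf, this]
    by_cases hd : C d
    · rw [if_pos hd]
      refine Finset.sum_congr rfl fun x _ => ?_
      unfold slice
      split_ifs with h1
      · change q x * f x = q x
        rw [hfd x h1, if_pos hd, mul_one]
      · rfl
    · rw [if_neg hd]
      refine Finset.sum_eq_zero fun x _ => ?_
      unfold slice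
      split_ifs with h1
      · change q x * f x = 0
        rw [hfd x h1, if_neg hd, mul_zero]
      · rfl
  calc (1 - ∑ l ∈ U, A i l * green A U l k) * t * cyl U z q
      = t * ((1 - ∑ l ∈ U, A i l * green A U l k) * cyl U z q) := by ring
    _ ≤ t * ∑ x, slice U z q x * f x := mul_le_mul_of_nonneg_left hbound ht
    _ = ∑ d, (if C d then t * cyl (U.erase k) (Function.update z k d) q else 0) := by
        rw [hfs, Finset.mul_sum]
        exact Finset.sum_congr rfl fun d _ => by split_ifs <;> simp
    _ ≤ ∑ d, cyl (U.erase k) (Function.update z k d) (fun x => if 0 < b x then q x else 0) := by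
        refine Finset.sum_le_sum fun d _ => ?_
        split_ifs with hd
        · exact h _ c hd
        · exact cyl_nonneg fun x => by split_ifs; exacts [hq0 x, le_rfl]
    _ = _ := (cyl_eq_sum_erase hk z _).symm

/-- Among the sites of `S` there is one that is flippable with parameter `m i / u i`, where
`u = m + A u` on `S`. -/
theorem exists_flippable (hQ : IsDobrushin Q A a) {q : (ι → X) → ℝ} (hq0 : ∀ x, 0 ≤ q x)
    {m : ι → ℝ} (S : Finset ι) (hm : ∀ i ∈ S, 0 < m i) (hS : S.Nonempty) (hqS : HasSpec q Q S) :
    ∃ i ∈ S, Flippable q i (S.erase i) (m i / ∑ l ∈ S, green A S i l * m l) := by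
  induction S using Finset.strongInduction with
  | H S ih =>
    set u : ι → ℝ := fun i => ∑ l ∈ S, green A S i l * m l with hu
    have hmu : ∀ i ∈ S, m i ≤ u i := fun i hi => by
      have h1 := Finset.single_le_sum (f := fun l => green A S i l * m l)
        (fun l hl => mul_nonneg (green_nonneg hQ S i l) (hm l hl).le) hi
      have h2 := one_le_green_self hQ hi
      have h3 := hm i hi
      nlinarith
    -- The choice of `k` is dictated by the final inequality. Returning from `S.erase k` to `S`
    -- costs the factor `1 - G i k / G i i`, while removing `k` lowered `u i` to `v = u i - (G i k /
    -- G k k) * u k`. The gain outweighs the cost when `u k / G k k` is maximal.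
    obtain ⟨k, hk, hmax⟩ := S.exists_max_image (fun k => u k / green A S k k) hS
    rcases (S.erase k).eq_empty_or_nonempty with hT | hT
    · refine ⟨k, hk, ?_⟩
      rw [hT]
      refine (flippable_empty q k).mono hq0 ?_
      exact (div_le_one ((hm k hk).trans_le (hmu k hk))).2 (hmu k hk)
    · obtain ⟨i, hi, hflip⟩ := ih (S.erase k) (Finset.erase_ssubset hk)
        (fun i hi => hm i (Finset.mem_of_mem_erase hi)) hT (hqS.mono (Finset.erase_subset _ _))
      have hiS := Finset.mem_of_mem_erase hi
      have hik : i ≠ k := Finset.ne_of_mem_erase hi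
      have hkU : k ∈ S.erase i := Finset.mem_erase.2 ⟨hik.symm, hk⟩
      refine ⟨i, hiS, ?_⟩
      set v := ∑ l ∈ S.erase k, green A (S.erase k) i l * m l with hv
      have hvm : m i ≤ v := by
        have h1 := Finset.single_le_sum (f := fun l => green A (S.erase k) i l * m l)
          (fun l hl => mul_nonneg (green_nonneg hQ _ i l)
            (hm l (Finset.mem_of_mem_erase hl)).le) hi
        have h2 := one_le_green_self hQ hi
        have h3 := hm i hiS
        nlinarith
      have hm0 := hm i hiS
      have hv0 : 0 < v := hm0.trans_le hvm
      have hvu : v = u i - green A S i k / green A S k k * u k := sum_green_erase_mul hQ hk m hi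
      have hGi := one_le_green_self hQ hiS
      have hGk := one_le_green_self hQ hk
      -- Row `i` of `G`, divided by `G i i`, solves the row equation on `S.erase i` with source `A
      -- i`.
      have hδ : ∑ l ∈ S.erase i, A i l * green A (S.erase i) l k =
          green A S i k / green A S i i := by
        refine (green_unique hQ (w := fun k => green A S i k / green A S i i)
          (fun j hj => ?_) hkU).symm
        have := green_row hQ i (Finset.mem_of_mem_erase hj)
        rw [if_neg (Finset.ne_of_mem_erase hj).symm, zero_add,
          ← Finset.add_sum_erase _ _ hiS] at this
        simp only [div_mul_eq_mul_div, ← Finset.sum_div]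
        rw [this]
        field_simp
      have hstep := Flippable.step hQ hq0 (Finset.notMem_erase i S) hkU
        (hqS.mono (Finset.erase_subset i S)) (div_nonneg hm0.le hv0.le)
        (by rwa [Finset.erase_right_comm])
      rw [hδ] at hstep
      refine hstep.mono hq0 ?_
      rw [← mul_div_assoc, div_le_div_iff₀ (hm0.trans_le (hmu i hiS)) hv0, hvu]
      have h1 := mul_le_mul_of_nonneg_left (hmax i hiS) (green_nonneg hQ S i k)
      have h2 : green A S i k / green A S i i * u i ≤ green A S i k / green A S k k * u k := by
        calc _ = green A S i k * (u i / green A S i i) := by ring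
          _ ≤ _ := h1
          _ = _ := by ring
      calc m i * (u i - green A S i k / green A S k k * u k)
          ≤ m i * (u i - green A S i k / green A S i i * u i) :=
            mul_le_mul_of_nonneg_left (by linarith) hm0.le
        _ = _ := by ring

end Cylinder

/-! ### Dirichlet form and entropy of one marginal -/

section SingleSite

variable {ι X : Type*} [Fintype ι] [DecidableEq ι] [Fintype X]

open Classical in
/-- The law of the `i`-th coordinate. -/
noncomputable def siteMarginal (p : (ι → X) → ℝ) (i : ι) (a : X) : ℝ :=
  ∑ x, if x i = a then p x else 0

lemma sum_siteMarginal_mul (p : (ι → X) → ℝ) (i : ι) (φ : X → ℝ) :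
    ∑ a, siteMarginal p i a * φ a = ∑ x, p x * φ (x i) := by
  classical
  unfold siteMarginal
  simp only [Finset.sum_mul]
  rw [Finset.sum_comm]
  refine Finset.sum_congr rfl fun x _ => ?_
  simp [ite_mul]

lemma sum_siteMarginal (p : (ι → X) → ℝ) (i : ι) : ∑ a, siteMarginal p i a = ∑ x, p x := by
  simpa using sum_siteMarginal_mul p i fun _ => 1

lemma siteMarginal_nonneg {p : (ι → X) → ℝ} (hp : ∀ x, 0 ≤ p x) (i : ι) (a : X) :
    0 ≤ siteMarginal p i a :=
  Finset.sum_nonneg fun x _ => by split_ifs; exacts [hp x, le_rfl]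

lemma eq_zero_of_siteMarginal_eq_zero {p : (ι → X) → ℝ} (hp : ∀ x, 0 ≤ p x) {i : ι} {x : ι → X}
    (h : siteMarginal p i (x i) = 0) : p x = 0 := by
  classical
  have := (Finset.sum_eq_zero_iff_of_nonneg fun x _ => by
    split_ifs; exacts [hp x, le_rfl]).1 h x (Finset.mem_univ x)
  simpa using this

lemma siteMarginal_eq_zero {p q : (ι → X) → ℝ} (hq : ∀ x, 0 ≤ q x) (hpq : ∀ x, q x = 0 → p x = 0)
    {i : ι} {a : X} (h : siteMarginal q i a = 0) : siteMarginal p i a = 0 := by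
  classical
  refine Finset.sum_eq_zero fun x _ => ?_
  split_ifs with hx
  · subst hx
    exact hpq x (eq_zero_of_siteMarginal_eq_zero hq h)
  · rfl

lemma oscLe_comp_eval (i : ι) {φ : X → ℝ} {o : ℝ} (hφ : ∀ a b, φ a - φ b ≤ o) (k : ι) :
    OscLe (fun x : ι → X => φ (x i)) k (if k = i then o else 0) := by
  intro x b c
  by_cases hk : k = i
  · subst hk; simpa using hφ b c
  · simp [hk, Function.update_of_ne (Ne.symm hk)]

variable {Q : ι → (ι → X) → X → ℝ} {A : ι → ι → ℝ} {a : ℝ}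

lemma agreeOff_erase {I : Finset ι} {i : ι} {y x : ι → X} (hx : AgreeOff I y x) :
    AgreeOff (I.erase i) (Function.update y i (x i)) x := by
  intro k hk
  by_cases hki : k = i
  · subst hki; simp
  · rw [Function.update_of_ne hki]
    exact hx k fun h => hk (Finset.mem_erase.2 ⟨hki, h⟩)

lemma agreeOff_of_erase {I : Finset ι} {i : ι} (hi : i ∈ I) {y x : ι → X} {c : X}
    (hx : AgreeOff (I.erase i) (Function.update y i c) x) : x i = c ∧ AgreeOff I y x := by
  refine ⟨by simpa using hx i (Finset.notMem_erase i I), fun k hk => ?_⟩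
  have hki : k ≠ i := by rintro rfl; exact hk hi
  simpa [hki] using hx k fun h => hk (Finset.mem_of_mem_erase h)

open Classical in
lemma slice_erase_eq {I : Finset ι} {i : ι} (hi : i ∈ I) {y : ι → X} {f : (ι → X) → ℝ}
    (hf : ∀ x, f x ≠ 0 → AgreeOff I y x) (c : X) (x : ι → X) :
    slice (I.erase i) (Function.update y i c) f x = if x i = c then f x else 0 := by
  unfold slice
  split_ifs with h1 h2 h2
  · rfl
  · exact absurd (agreeOff_of_erase hi h1).1 h2
  · by_contra H
    exact h1 (h2 ▸ agreeOff_erase (hf x fun h => H h.symm))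
  · rfl

/-- The Dirichlet form of the `i`-th marginal controls the squared oscillation. -/
lemma Flippable.sq_osc_le (hQ : IsDobrushin Q A a) {I : Finset ι} {i : ι} (hi : i ∈ I)
    {q : (ι → X) → ℝ} {y : ι → X} (hq0 : ∀ x, 0 ≤ q x) (hq1 : ∑ x, q x = 1)
    (hqs : ∀ x, q x ≠ 0 → AgreeOff I y x) (hqI : HasSpec q Q I) {α t : ℝ} (hα0 : 0 ≤ α)
    (hα : ∀ x, 0 < q x → α ≤ Q i x (x i)) (hflip : Flippable q i (I.erase i) t)
    (φ : X → ℝ) {b c : X} (hb : 0 < siteMarginal q i b) (hc : 0 < siteMarginal q i c) :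
    α * t * (φ b - φ c) ^ 2 ≤
      4 * ∑ x, q x * (φ (x i) * (φ (x i) - gibbsOp Q i (fun z => φ (z i)) x)) := by
  classical
  -- Given `c` at `i`, the symbol `d` is possible in the same surroundings with conditional
  -- probability at least `t`, and wherever it is possible `Q i` gives it at least `α`.
  have hJ : ∀ d, 0 < siteMarginal q i d → ∀ c, α * t * siteMarginal q i c ≤
      ∑ x, if x i = c then q x * Q i x d else 0 := by
    intro d hd c
    obtain ⟨x₀, hx₀, hq₀⟩ : ∃ x, x i = d ∧ 0 < q x := by
      by_contra! H
      refine hd.ne' (Finset.sum_eq_zero fun x _ => ?_)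
      split_ifs with hx
      · exact le_antisymm (H x hx) (hq0 x)
      · rfl
    have hpos : 0 < cyl (I.erase i) (Function.update y i c)
        (fun x => q (Function.update x i d)) := by
      refine Finset.sum_pos' (fun x _ => slice_nonneg (fun x => hq0 _) x)
        ⟨Function.update x₀ i c, Finset.mem_univ _, ?_⟩
      have h1 : AgreeOff (I.erase i) (Function.update y i c) (Function.update x₀ i c) := by
        have := agreeOff_erase (i := i) ((agreeOff_update hi c).2 (hqs x₀ hq₀.ne'))
        simpa using this
      rw [slice, if_pos h1, Function.update_idem, ← hx₀, Function.update_eq_self]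
      exact hq₀
    have h2 := hflip _ d hpos
    unfold cyl at h2
    have h3 : ∑ x, slice (I.erase i) (Function.update y i c) q x = siteMarginal q i c :=
      Finset.sum_congr rfl fun x _ => slice_erase_eq hi hqs c x
    rw [h3] at h2
    calc α * t * siteMarginal q i c = α * (t * siteMarginal q i c) := by ring
      _ ≤ α * _ := mul_le_mul_of_nonneg_left h2 hα0
      _ ≤ _ := by
        rw [Finset.mul_sum]
        refine Finset.sum_le_sum fun x _ => ?_
        rw [slice_erase_eq hi (fun x hx => hqs x fun h => hx (by simp [h])) c x]
        split_ifs with hxc h4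
        · rw [mul_comm]
          refine mul_le_mul_of_nonneg_left ?_ (hq0 x)
          have := hα _ h4
          rwa [hQ.update_self, Function.update_self] at this
        · rw [mul_zero]
          exact mul_nonneg (hq0 x) (hQ.nonneg _ _ _)
        · rw [mul_zero]
  have hrow : ∀ d, 0 < siteMarginal q i d →
      α * t * ∑ c, siteMarginal q i c * (φ c - φ d) ^ 2 ≤
        ∑ x, q x * (Q i x d * (φ (x i) - φ d) ^ 2) := by
    intro d hd
    calc α * t * ∑ c, siteMarginal q i c * (φ c - φ d) ^ 2
        = ∑ c, α * t * siteMarginal q i c * (φ c - φ d) ^ 2 := by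
          rw [Finset.mul_sum]; exact Finset.sum_congr rfl fun c _ => by ring
      _ ≤ ∑ c, siteMarginal (fun x => q x * Q i x d) i c * (φ c - φ d) ^ 2 :=
          Finset.sum_le_sum fun c _ => mul_le_mul_of_nonneg_right (hJ d hd c) (sq_nonneg _)
      _ = _ := by
          rw [sum_siteMarginal_mul _ i fun c => (φ c - φ d) ^ 2]
          exact Finset.sum_congr rfl fun x _ => by ring
  have hinv : ∀ h : (ι → X) → ℝ, ∑ x, q x * gibbsOp Q i h x = ∑ x, q x * h x := fun h =>
    sum_mul_gibbsOp (fun x c => hQ.update_self i x c) (hqI i hi) h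
  have hE : ∑ x, q x * ∑ d, Q i x d * (φ (x i) - φ d) ^ 2 =
      2 * ∑ x, q x * (φ (x i) * (φ (x i) - gibbsOp Q i (fun z => φ (z i)) x)) := by
    have h1 := hinv fun x => φ (x i) ^ 2
    have h2 : ∀ x, ∑ d, Q i x d * (φ (x i) - φ d) ^ 2 = φ (x i) ^ 2 -
        2 * (φ (x i) * gibbsOp Q i (fun z => φ (z i)) x) + gibbsOp Q i (fun z => φ (z i) ^ 2) x := by
      intro x
      unfold gibbsOp
      simp only [Function.update_self]
      have h3 := hQ.sum_eq_one i x
      calc _ = ∑ d, (Q i x d * φ (x i) ^ 2 - 2 * (φ (x i) * (Q i x d * φ d)) + Q i x d * φ d ^ 2) :=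
            Finset.sum_congr rfl fun d _ => by ring
        _ = _ := by
            rw [Finset.sum_add_distrib, Finset.sum_sub_distrib, ← Finset.sum_mul, h3, one_mul,
              ← Finset.mul_sum, ← Finset.mul_sum]
    simp only [h2, mul_add, mul_sub, Finset.sum_add_distrib, Finset.sum_sub_distrib, Finset.mul_sum]
    rw [h1, ← Finset.sum_sub_distrib, ← Finset.sum_add_distrib, ← Finset.sum_sub_distrib]
    exact Finset.sum_congr rfl fun x _ => by ring
  rcases eq_or_ne b c with hbc | hbc
  · subst hbc
    have : 0 ≤ ∑ x, q x * ∑ d, Q i x d * (φ (x i) - φ d) ^ 2 :=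
      Finset.sum_nonneg fun x _ => mul_nonneg (hq0 x) (Finset.sum_nonneg fun d _ =>
        mul_nonneg (hQ.nonneg _ _ _) (sq_nonneg _))
    rw [sub_self]
    simp only [ne_eq, OfNat.ofNat_ne_zero, not_false_eq_true, zero_pow, mul_zero]
    linarith
  -- Only jumps to `b` and `c` are kept; averaging `(φ b - φ c)² ≤ 2 ((φ d - φ b)² + (φ d - φ c)²)`
  -- over `d` recovers the oscillation. This `2` and the one in `hE` make the constant `4`.
  have h1 : ∑ x, q x * (Q i x b * (φ (x i) - φ b) ^ 2) + ∑ x, q x * (Q i x c * (φ (x i) - φ c) ^ 2)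
      ≤ ∑ x, q x * ∑ d, Q i x d * (φ (x i) - φ d) ^ 2 := by
    rw [← Finset.sum_add_distrib]
    refine Finset.sum_le_sum fun x _ => ?_
    rw [← mul_add]
    refine mul_le_mul_of_nonneg_left ?_ (hq0 x)
    rw [← Finset.sum_pair (f := fun d => Q i x d * (φ (x i) - φ d) ^ 2) hbc]
    exact Finset.sum_le_sum_of_subset_of_nonneg (Finset.subset_univ _) fun d _ _ =>
      mul_nonneg (hQ.nonneg _ _ _) (sq_nonneg _)
  by_cases hκ : 0 ≤ α * t
  · have h2 : (φ b - φ c) ^ 2 ≤ 2 * (∑ d, siteMarginal q i d * (φ d - φ b) ^ 2 +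
        ∑ d, siteMarginal q i d * (φ d - φ c) ^ 2) := by
      have hs1 : ∑ d, siteMarginal q i d = 1 := (sum_siteMarginal q i).trans hq1
      rw [← one_mul ((φ b - φ c) ^ 2), ← hs1, Finset.sum_mul, ← Finset.sum_add_distrib,
        Finset.mul_sum]
      refine Finset.sum_le_sum fun d _ => ?_
      have h3 := siteMarginal_nonneg hq0 i d
      have h4 : (φ b - φ c) ^ 2 ≤ 2 * ((φ d - φ b) ^ 2 + (φ d - φ c) ^ 2) := by
        nlinarith [sq_nonneg ((φ d - φ b) + (φ d - φ c))]
      nlinarith [mul_le_mul_of_nonneg_left h4 h3]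
    have h3 := mul_le_mul_of_nonneg_left h2 hκ
    have h4 := hrow b hb
    have h5 := hrow c hc
    linarith
  · have : 0 ≤ ∑ x, q x * ∑ d, Q i x d * (φ (x i) - φ d) ^ 2 :=
      Finset.sum_nonneg fun x _ => mul_nonneg (hq0 x) (Finset.sum_nonneg fun d _ =>
        mul_nonneg (hQ.nonneg _ _ _) (sq_nonneg _))
    have h2 : α * t * (φ b - φ c) ^ 2 ≤ 0 :=
      mul_nonpos_of_nonpos_of_nonneg (not_le.1 hκ).le (sq_nonneg _)
    linarith

/-- Entropy of the marginal in a flippable site. -/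
theorem Flippable.sum_marginal_log_le (hQ : IsDobrushin Q A a) {I : Finset ι} {i : ι} (hi : i ∈ I)
    {p q : (ι → X) → ℝ} {y : ι → X} (hp0 : ∀ x, 0 ≤ p x) (hp1 : ∑ x, p x = 1)
    (hq0 : ∀ x, 0 ≤ q x) (hq1 : ∑ x, q x = 1) (hpq : ∀ x, q x = 0 → p x = 0)
    (hqs : ∀ x, q x ≠ 0 → AgreeOff I y x) (hqI : HasSpec q Q I)
    {g : ι → ℝ} (hg : ∀ k ∈ I, 0 ≤ g k) (hp : ∀ k ∈ I, ∀ h c, OscLe h k c →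
      ∑ x, p x * h x - ∑ x, p x * gibbsOp Q k h x ≤ g k * c)
    {α t : ℝ} (hα0 : 0 < α) (ht : 0 < t) (hα : ∀ x, 0 < q x → α ≤ Q i x (x i))
    (hflip : Flippable q i (I.erase i) t) :
    α * t * ∑ b, siteMarginal p i b * Real.log (siteMarginal p i b / siteMarginal q i b) ≤
      4 * (∑ l ∈ I, g l * green A I l i) *
        (g i + ∑ k ∈ I.erase i, A k i * ∑ l ∈ I.erase i, g l * green A (I.erase i) l k) := by
  classical
  set r := siteMarginal p i with hr
  set s := siteMarginal q i with hs
  have hr0 : ∀ b, 0 ≤ r b := siteMarginal_nonneg hp0 i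
  have hs0 : ∀ b, 0 ≤ s b := siteMarginal_nonneg hq0 i
  have hrs : ∀ b, s b = 0 → r b = 0 := fun b => siteMarginal_eq_zero hq0 hpq
  have hs1 : ∑ b, s b = 1 := (sum_siteMarginal q i).trans hq1
  have hps : ∀ x, p x ≠ 0 → AgreeOff I y x := fun x hx => hqs x fun h => hx (hpq x h)
  set P : Finset X := Finset.univ.filter fun b => 0 < s b with hP
  have hPn : P.Nonempty := by
    by_contra H
    rw [Finset.not_nonempty_iff_eq_empty, Finset.filter_eq_empty_iff] at H
    have : ∑ b, s b = 0 := Finset.sum_eq_zero fun b hb => le_antisymm (not_lt.1 (H hb)) (hs0 b)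
    linarith
  obtain ⟨b, hbP, hbmax⟩ := P.exists_max_image (fun d => r d / s d) hPn
  obtain ⟨c, hcP, hcmin⟩ := P.exists_min_image (fun d => r d / s d) hPn
  have hsb : 0 < s b := (Finset.mem_filter.1 hbP).2
  have hsc : 0 < s c := (Finset.mem_filter.1 hcP).2
  -- Off the support of `s` the density gets its maximal value, so both extremes are attained at
  -- symbols of positive `q`-mass, as `Flippable.sq_osc_le` requires.
  set f : X → ℝ := fun d => if 0 < s d then r d / s d else r b / s b with hf
  have hfle : ∀ d, f d ≤ f b := fun d => by
    simp only [hf, hsb, if_true]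
    split_ifs with hd
    · exact hbmax d (Finset.mem_filter.2 ⟨Finset.mem_univ _, hd⟩)
    · exact le_rfl
  have hfge : ∀ d, f c ≤ f d := fun d => by
    simp only [hf, hsc, if_true]
    split_ifs with hd
    · exact hcmin d (Finset.mem_filter.2 ⟨Finset.mem_univ _, hd⟩)
    · exact hcmin b hbP
  have hf0 : ∀ d, 0 ≤ f d := fun d => by
    simp only [hf]
    split_ifs
    · exact div_nonneg (hr0 _) (hs0 _)
    · exact div_nonneg (hr0 _) (hs0 _)
  have hrf : ∀ d, r d = s d * f d := fun d => by
    simp only [hf]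
    split_ifs with hd
    · field_simp
    · have : s d = 0 := le_antisymm (not_lt.1 hd) (hs0 d)
      rw [hrs d this, this, zero_mul]
  set o := f b - f c with ho
  have ho0 : 0 ≤ o := by linarith [hfge b]
  have hosc : ∀ d d', f d - f d' ≤ o := fun d d' => by linarith [hfle d, hfge d']
  have hhosc := oscLe_comp_eval (ι := ι) i hosc
  have hq' : ∀ k ∈ I, ∀ h, ∑ x, q x * gibbsOp Q k h x = ∑ x, q x * h x := fun k hk h =>
    sum_mul_gibbsOp (fun x c => hQ.update_self k x c) (hqI k hk) h
  -- the entropy is bounded by the chi-square divergence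
  have hD : ∑ d, r d * Real.log (r d / s d) ≤ (∑ l ∈ I, g l * green A I l i) * o := by
    have h1 : ∑ d, r d * Real.log (r d / s d) ≤ ∑ d, r d * f d - ∑ d, s d * f d := by
      rw [← Finset.sum_sub_distrib]
      refine Finset.sum_le_sum fun d _ => ?_
      rcases (hr0 d).eq_or_lt with h0 | h0
      · have : s d * f d = 0 := by rw [← hrf d, ← h0]
        simp [← h0, this]
      · have hsd : 0 < s d := (hs0 d).lt_of_ne fun h => h0.ne' (hrs d h.symm)
        have hfd : r d / s d = f d := by simp [hf, hsd]
        rw [hfd, ← hrf d, ← mul_sub_one]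
        refine mul_le_mul_of_nonneg_left (Real.log_le_sub_one_of_pos ?_) h0.le
        rw [← hfd]
        positivity
    refine h1.trans ?_
    rw [hr, hs, sum_siteMarginal_mul, sum_siteMarginal_mul]
    refine (hQ.green_comparison hp0 hp1 hq0 hq1 hq' hg hp
      (fun h hh => by rw [sum_mul_eq_of_supported hp1 hps hh, sum_mul_eq_of_supported hq1 hqs hh])
      fun k _ => hhosc k).trans_eq ?_
    simp only [mul_ite, mul_zero, Finset.sum_ite_eq', hi, if_true]
  -- the Dirichlet form of the density
  set yi := g i + ∑ k ∈ I.erase i, A k i * ∑ l ∈ I.erase i, g l * green A (I.erase i) l k with hyi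
  have hE : ∑ x, q x * (f (x i) * (f (x i) - gibbsOp Q i (fun z => f (z i)) x)) ≤ yi * o := by
    -- `w` is `q` reweighted to have the `i`-th marginal of `p`. The conditional laws `Q` survive on
    -- `I.erase i`, so only those sites enter the comparison of `p` with `w`.
    set w : (ι → X) → ℝ := fun x => q x * f (x i) with hw
    have hw0 : ∀ x, 0 ≤ w x := fun x => mul_nonneg (hq0 x) (hf0 _)
    have hlaw : ∀ ψ : X → ℝ, ∑ x, w x * ψ (x i) = ∑ x, p x * ψ (x i) := by
      intro ψ
      rw [← sum_siteMarginal_mul p, ← hr]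
      simp only [hw, hrf, mul_assoc]
      exact (sum_siteMarginal_mul q i fun d => f d * ψ d).symm
    have hw1 : ∑ x, w x = 1 := by
      have := hlaw fun _ => 1
      simpa [hp1] using this
    have hwI : HasSpec w Q (I.erase i) := by
      intro k hk x d
      have hki : i ≠ k := (Finset.ne_of_mem_erase hk).symm
      simp only [hw, Function.update_of_ne hki]
      rw [hqI k (Finset.mem_of_mem_erase hk), ← Finset.sum_mul]
      ring
    have hcmp := hQ.green_comparison (S := I.erase i) (h := gibbsOp Q i fun z => f (z i))
      (c := fun k => A k i * o) hp0 hp1 hw0 hw1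
      (fun k hk h => sum_mul_gibbsOp (fun x c => hQ.update_self k x c) (hwI k hk) h)
      (fun k hk => hg k (Finset.mem_of_mem_erase hk))
      (fun k hk => hp k (Finset.mem_of_mem_erase hk))
      (fun h hh => by
        have hh' : ∀ x, AgreeOff I y x → h x = h (Function.update y i (x i)) := fun x hx =>
          eq_of_update_invariant hh (agreeOff_erase hx)
        have e1 : ∑ x, p x * h x = ∑ x, p x * h (Function.update y i (x i)) :=
          Finset.sum_congr rfl fun x _ => by
            by_cases hx : p x = 0
            · simp [hx]
            · rw [hh' x (hps x hx)]
        have e2 : ∑ x, w x * h x = ∑ x, w x * h (Function.update y i (x i)) :=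
          Finset.sum_congr rfl fun x _ => by
            by_cases hx : q x = 0
            · simp [hw, hx]
            · rw [hh' x (hqs x hx)]
        rw [e1, e2]
        exact (hlaw fun d => h (Function.update y i d)).symm)
      (fun k hk => by
        have hki : k ≠ i := Finset.ne_of_mem_erase hk
        have h1 := hhosc k
        have h2 := hhosc i
        rw [if_neg hki] at h1
        rw [if_pos rfl] at h2
        simpa using hQ.oscLe_gibbsOp hki h1 h2)
    -- The Dirichlet form is `(p f - p Γ_i f) + (p - w)(Γ_i f)`: the source at `i` bounds the first
    -- bracket, `hcmp` the second.
    have hsrc := hp i hi (fun z => f (z i)) o (by simpa using hhosc i)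
    have e3 : ∑ x, q x * (f (x i) * (f (x i) - gibbsOp Q i (fun z => f (z i)) x)) =
        ∑ x, p x * f (x i) - ∑ x, w x * gibbsOp Q i (fun z => f (z i)) x := by
      rw [← hlaw, ← Finset.sum_sub_distrib]
      exact Finset.sum_congr rfl fun x _ => by simp only [hw]; ring
    have e4 : ∑ k ∈ I.erase i, (∑ l ∈ I.erase i, g l * green A (I.erase i) l k) * (A k i * o) =
        (∑ k ∈ I.erase i, A k i * ∑ l ∈ I.erase i, g l * green A (I.erase i) l k) * o := by
      rw [Finset.sum_mul]
      exact Finset.sum_congr rfl fun k _ => by ring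
    rw [e4] at hcmp
    rw [e3, hyi, add_mul]
    linarith
  have hsq := hflip.sq_osc_le hQ hi hq0 hq1 hqs hqI hα0.le hα f hsb hsc
  rw [← ho] at hsq
  have hxi : 0 ≤ ∑ l ∈ I, g l * green A I l i :=
    Finset.sum_nonneg fun l hl => mul_nonneg (hg l hl) (green_nonneg hQ I l i)
  have hyi0 : 0 ≤ yi := add_nonneg (hg i hi) (Finset.sum_nonneg fun k _ =>
    mul_nonneg (hQ.entry_nonneg k i) (Finset.sum_nonneg fun l hl =>
      mul_nonneg (hg l (Finset.mem_of_mem_erase hl)) (green_nonneg hQ _ l k)))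
  have hκ : 0 < α * t := mul_pos hα0 ht
  have hκo : α * t * o ≤ 4 * yi := by
    rcases ho0.eq_or_lt with h0 | h0
    · rw [← h0]; linarith
    · refine le_of_mul_le_mul_right ?_ h0
      calc α * t * o * o = α * t * o ^ 2 := by ring
        _ ≤ 4 * (yi * o) := by linarith
        _ = _ := by ring
  calc α * t * ∑ d, r d * Real.log (r d / s d) ≤ α * t * ((∑ l ∈ I, g l * green A I l i) * o) :=
        mul_le_mul_of_nonneg_left hD hκ.le
    _ = (∑ l ∈ I, g l * green A I l i) * (α * t * o) := by ring
    _ ≤ (∑ l ∈ I, g l * green A I l i) * (4 * yi) := mul_le_mul_of_nonneg_left hκo hxi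
    _ = _ := by ring

end SingleSite

/-! ### Peeling off coordinates by the chain rule -/

section Induction

variable {X : Type*} [Fintype X] [DecidableEq X] {n : ℕ}

lemma condSite_update (p : (Fin n → X) → ℝ) (k : Fin n) (x : Fin n → X) (c : X) :
    condSite p k (Function.update x k c) = condSite p k x := by
  unfold condSite
  simp

lemma hasSpec_condSite {p : (Fin n → X) → ℝ} (hp : ∀ x, 0 ≤ p x) (S : Finset (Fin n)) :
    HasSpec p (condSite p) S := by
  intro k _ x c
  unfold condSite
  by_cases h : ∑ b, p (Function.update x k b) = 0
  · rw [h, zero_mul]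
    exact (Finset.sum_eq_zero_iff_of_nonneg fun b _ => hp _).1 h c (Finset.mem_univ c)
  · field_simp

lemma sum_update_pos {p : (Fin n → X) → ℝ} (hp : ∀ x, 0 ≤ p x) (k : Fin n) {x : Fin n → X}
    (hx : 0 < p x) : 0 < ∑ b, p (Function.update x k b) :=
  Finset.sum_pos' (fun b _ => hp _) ⟨x k, Finset.mem_univ _, by simpa using hx⟩

lemma sum_condSite {p : (Fin n → X) → ℝ} (hp : ∀ x, 0 ≤ p x) (k : Fin n) {x : Fin n → X}
    (hx : 0 < p x) : ∑ c, condSite p k x c = 1 := by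
  unfold condSite
  rw [← Finset.sum_div]
  exact div_self (sum_update_pos hp k hx).ne'

lemma condSite_nonneg {p : (Fin n → X) → ℝ} (hp : ∀ x, 0 ≤ p x) (k : Fin n) (x : Fin n → X)
    (c : X) : 0 ≤ condSite p k x c :=
  div_nonneg (hp _) (Finset.sum_nonneg fun _ _ => hp _)

lemma siteGapSq_nonneg (p : (Fin n → X) → ℝ) (Q : Fin n → (Fin n → X) → X → ℝ) (k : Fin n)
    (x : Fin n → X) : 0 ≤ siteGapSq p Q k x := sq_nonneg _

/-- Nonnegativity of the variance. -/
lemma sum_mul_le_of_sum_sq_le {Z : Type*} [Fintype Z] {p f : Z → ℝ} (hp : ∀ z, 0 ≤ p z)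
    (hp1 : ∑ z, p z = 1) {g : ℝ} (hg : 0 ≤ g) (h : ∑ z, p z * f z ^ 2 ≤ g ^ 2) :
    ∑ z, p z * f z ≤ g := by
  set m := ∑ z, p z * f z with hm
  have h1 : 0 ≤ ∑ z, p z * (f z - m) ^ 2 :=
    Finset.sum_nonneg fun z _ => mul_nonneg (hp z) (sq_nonneg _)
  have h2 : ∑ z, p z * (f z - m) ^ 2 = ∑ z, p z * f z ^ 2 - 2 * m * ∑ z, p z * f z +
      m ^ 2 * ∑ z, p z := by
    rw [Finset.mul_sum _ p, Finset.mul_sum _ fun z => p z * f z, ← Finset.sum_sub_distrib,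
      ← Finset.sum_add_distrib]
    exact Finset.sum_congr rfl fun z _ => by ring
  rw [hp1, ← hm] at h2
  exact abs_le_of_sq_le_sq' (by nlinarith) hg |>.2

variable {Q : Fin n → (Fin n → X) → X → ℝ} {A : Fin n → Fin n → ℝ} {a : ℝ}

lemma IsDobrushin.source_le (hQ : IsDobrushin Q A a) {p : (Fin n → X) → ℝ} (hp0 : ∀ x, 0 ≤ p x)
    (hp1 : ∑ x, p x = 1) {k : Fin n} {g : ℝ} (hg : 0 ≤ g)
    (hs : ∑ x, p x * siteGapSq p Q k x ≤ g ^ 2) {h : (Fin n → X) → ℝ} {c : ℝ}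
    (hc : OscLe h k c) : ∑ x, p x * h x - ∑ x, p x * gibbsOp Q k h x ≤ g * c := by
  refine (sum_sub_sum_gibbsOp_le hp0 (R := condSite p) (fun x c => condSite_update p k x c)
    (hasSpec_condSite hp0 Finset.univ k (Finset.mem_univ k))
    (fun x hx => by rw [sum_condSite hp0 k hx, hQ.sum_eq_one]) hc).trans ?_
  obtain ⟨x⟩ : Nonempty (Fin n → X) := by
    by_contra H
    rw [not_nonempty_iff] at H
    simp at hp1
  have hc0 : 0 ≤ c := by simpa using hc x (x k) (x k)
  exact mul_le_mul_of_nonneg_right (sum_mul_le_of_sum_sq_le hp0 hp1 hg hs) hc0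

/-- The loss in squared Euclidean norm of `x = g G` when the site `i` is removed. -/
lemma green_energy_decrease (hQ : IsDobrushin Q A a) {I : Finset (Fin n)} {i : Fin n} (hi : i ∈ I)
    {g : Fin n → ℝ} (hg : ∀ k ∈ I, 0 ≤ g k) :
    (g i + ∑ k ∈ I.erase i, A k i * ∑ l ∈ I.erase i, g l * green A (I.erase i) l k) *
        (∑ k ∈ I, green A I i k * ∑ l ∈ I, g l * green A I l k) +
      ∑ k ∈ I.erase i, (∑ l ∈ I.erase i, g l * green A (I.erase i) l k) ^ 2 ≤
    ∑ k ∈ I, (∑ l ∈ I, g l * green A I l k) ^ 2 := by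
  have hG := one_le_green_self hQ hi
  have hGpos : 0 < green A I i i := by linarith
  set x : Fin n → ℝ := fun k => ∑ l ∈ I, g l * green A I l k with hx
  set δ : Fin n → ℝ := fun k => green A I i k / green A I i i with hδ
  have hx0 : ∀ k, 0 ≤ x k := fun k =>
    Finset.sum_nonneg fun l hl => mul_nonneg (hg l hl) (green_nonneg hQ I l k)
  have hδ0 : ∀ k, 0 ≤ δ k := fun k => div_nonneg (green_nonneg hQ I i k) hGpos.le
  have hx' : ∀ k ∈ I.erase i, ∑ l ∈ I.erase i, g l * green A (I.erase i) l k = x k - x i * δ k :=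
    fun k hk => sum_mul_green_erase hQ hi g hk
  have hx'0 : ∀ k ∈ I.erase i, 0 ≤ x k - x i * δ k := fun k hk => by
    rw [← hx' k hk]
    exact Finset.sum_nonneg fun l hl => mul_nonneg (hg l (Finset.mem_of_mem_erase hl))
      (green_nonneg hQ _ l k)
  have hxi : x i = g i + ∑ k ∈ I.erase i, A k i * x k := by
    have := sum_mul_green_row hQ g hi
    rwa [← Finset.add_sum_erase I (fun j => A j i * _) hi, hQ.diag, zero_mul, zero_add] at this
  have hGi : green A I i i = 1 + ∑ k ∈ I.erase i, green A I i k * A k i := by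
    have := green_row hQ i hi
    rwa [if_pos rfl, ← Finset.add_sum_erase I _ hi, hQ.diag, mul_zero, zero_add] at this
  have hδs : ∑ k ∈ I.erase i, A k i * δ k = 1 - 1 / green A I i i := by
    have h1 : ∑ k ∈ I.erase i, A k i * δ k =
        (∑ k ∈ I.erase i, green A I i k * A k i) / green A I i i := by
      rw [Finset.sum_div]
      exact Finset.sum_congr rfl fun k _ => by simp only [hδ]; ring
    have h2 : ∑ k ∈ I.erase i, green A I i k * A k i = green A I i i - 1 := by linarith
    rw [h1, h2]
    field_simp
  have hy : g i + ∑ k ∈ I.erase i, A k i * ∑ l ∈ I.erase i, g l * green A (I.erase i) l k =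
      x i / green A I i i := by
    rw [Finset.sum_congr rfl fun k hk => by rw [hx' k hk]]
    have h1 : ∑ k ∈ I.erase i, A k i * (x k - x i * δ k) =
        ∑ k ∈ I.erase i, A k i * x k - x i * ∑ k ∈ I.erase i, A k i * δ k := by
      rw [Finset.mul_sum, ← Finset.sum_sub_distrib]
      exact Finset.sum_congr rfl fun k _ => by ring
    rw [h1, hδs]
    linear_combination -hxi
  have hu : ∑ k ∈ I, green A I i k * x k =
      green A I i i * (x i + ∑ k ∈ I.erase i, δ k * x k) := by
    rw [← Finset.add_sum_erase I _ hi, mul_add, Finset.mul_sum _ fun k => δ k * x k]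
    congr 1
    exact Finset.sum_congr rfl fun k _ => by simp only [hδ]; field_simp
  have hsq : ∑ k ∈ I.erase i, (∑ l ∈ I.erase i, g l * green A (I.erase i) l k) ^ 2 =
      ∑ k ∈ I.erase i, (x k - x i * δ k) ^ 2 :=
    Finset.sum_congr rfl fun k hk => by rw [hx' k hk]
  rw [hy, hu, hsq, ← Finset.add_sum_erase I (fun k => x k ^ 2) hi]
  have h1 : x i / green A I i i * (green A I i i * (x i + ∑ k ∈ I.erase i, δ k * x k)) =
      x i ^ 2 + ∑ k ∈ I.erase i, x i * (δ k * x k) := by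
    rw [← Finset.mul_sum]
    field_simp
  rw [h1, add_assoc, ← Finset.sum_add_distrib]
  gcongr with k hk
  -- The slack at site `k` is exactly `x i * δ k * (x k - x i * δ k)`.
  nlinarith [mul_nonneg (mul_nonneg (hx0 i) (hδ0 k)) (hx'0 k hk)]

/-- A weighted Minkowski inequality in `ℓ₂`. -/
lemma sum_mul_sum_sq_le {Y ι : Type*} [Fintype Y] {T : Finset ι} {r : Y → ℝ} (hr : ∀ y, 0 ≤ r y)
    {g w : ι → ℝ} (hg : ∀ l ∈ T, 0 < g l) (hw : ∀ l ∈ T, 0 ≤ w l) {G : Y → ι → ℝ}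
    (hG : ∀ l ∈ T, ∑ y, r y * G y l ^ 2 ≤ g l ^ 2) :
    ∑ y, r y * (∑ l ∈ T, G y l * w l) ^ 2 ≤ (∑ l ∈ T, g l * w l) ^ 2 := by
  -- Cauchy–Schwarz with `G y l * w l` split between `g l * w l` and `(w l / g l) * G y l ^ 2`;
  -- dividing by `g l` is why sources are kept strictly positive.
  have h1 : ∀ y, (∑ l ∈ T, G y l * w l) ^ 2 ≤
      (∑ l ∈ T, g l * w l) * ∑ l ∈ T, w l / g l * G y l ^ 2 := fun y =>
    Finset.sum_sq_le_sum_mul_sum_of_sq_le_mul T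
      (fun l hl => mul_nonneg (hg l hl).le (hw l hl))
      (fun l hl => mul_nonneg (div_nonneg (hw l hl) (hg l hl).le) (sq_nonneg _))
      (fun l hl => by have := hg l hl; field_simp; exact le_rfl)
  have h0 : 0 ≤ ∑ l ∈ T, g l * w l :=
    Finset.sum_nonneg fun l hl => mul_nonneg (hg l hl).le (hw l hl)
  calc ∑ y, r y * (∑ l ∈ T, G y l * w l) ^ 2
      ≤ ∑ y, r y * ((∑ l ∈ T, g l * w l) * ∑ l ∈ T, w l / g l * G y l ^ 2) :=
        Finset.sum_le_sum fun y _ => mul_le_mul_of_nonneg_left (h1 y) (hr y)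
    _ = (∑ l ∈ T, g l * w l) * ∑ l ∈ T, w l / g l * ∑ y, r y * G y l ^ 2 := by
        simp only [Finset.mul_sum]
        rw [Finset.sum_comm]
        refine Finset.sum_congr rfl fun l _ => Finset.sum_congr rfl fun y _ => ?_
        ring_nf
    _ ≤ (∑ l ∈ T, g l * w l) * ∑ l ∈ T, w l / g l * g l ^ 2 :=
        mul_le_mul_of_nonneg_left (Finset.sum_le_sum fun l hl =>
          mul_le_mul_of_nonneg_left (hG l hl) (div_nonneg (hw l hl) (hg l hl).le)) h0
    _ = _ := by
        rw [sq]
        congr 1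
        refine Finset.sum_congr rfl fun l hl => ?_
        have := hg l hl
        field_simp

/-- `p` conditioned on the value `c` of the `i`-th coordinate. -/
noncomputable def pin (p : (Fin n → X) → ℝ) (i : Fin n) (c : X) (x : Fin n → X) : ℝ :=
  if x i = c then p x / siteMarginal p i c else 0

lemma pin_nonneg {p : (Fin n → X) → ℝ} (hp : ∀ x, 0 ≤ p x) (i : Fin n) (c : X) (x : Fin n → X) :
    0 ≤ pin p i c x := by
  unfold pin
  split_ifs
  exacts [div_nonneg (hp x) (siteMarginal_nonneg hp i c), le_rfl]

lemma siteMarginal_mul_sum_pin {p : (Fin n → X) → ℝ} (hp : ∀ x, 0 ≤ p x) (i : Fin n) (c : X)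
    (f : (Fin n → X) → ℝ) :
    siteMarginal p i c * ∑ x, pin p i c x * f x = ∑ x, if x i = c then p x * f x else 0 := by
  rw [Finset.mul_sum]
  refine Finset.sum_congr rfl fun x _ => ?_
  unfold pin
  split_ifs with hx
  · by_cases h : siteMarginal p i c = 0
    · have : p x = 0 := eq_zero_of_siteMarginal_eq_zero hp (hx ▸ h)
      simp [this]
    · field_simp
  · simp

lemma sum_pin {p : (Fin n → X) → ℝ} {i : Fin n} {c : X} (h : siteMarginal p i c ≠ 0) :
    ∑ x, pin p i c x = 1 := by
  rw [← div_self h]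
  conv_rhs => rw [siteMarginal]
  rw [Finset.sum_div]
  refine Finset.sum_congr rfl fun x _ => ?_
  unfold pin
  split_ifs with hx
  · simp [siteMarginal]
  · simp

/-- The normalising mass cancels, so pinning `i` leaves the local gaps at the other sites unchanged
and the induction sees the same `siteGapSq`. -/
lemma condSite_pin {p : (Fin n → X) → ℝ} {i k : Fin n} (hik : i ≠ k) {c : X}
    (h : siteMarginal p i c ≠ 0) {x : Fin n → X} (hx : x i = c) :
    condSite (pin p i c) k x = condSite p k x := by
  ext b
  unfold condSite pin
  simp only [Function.update_of_ne hik, hx, if_true]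
  rw [← Finset.sum_div, div_div_div_cancel_right₀ h]

/-- The chain rule of relative entropy. -/
lemma sum_mul_log_eq_add_pin {p q : (Fin n → X) → ℝ} (hp : ∀ x, 0 ≤ p x) (hq : ∀ x, 0 ≤ q x)
    (hpq : ∀ x, q x = 0 → p x = 0) (i : Fin n) :
    ∑ x, p x * Real.log (p x / q x) =
      ∑ c, siteMarginal p i c * Real.log (siteMarginal p i c / siteMarginal q i c) +
      ∑ c, siteMarginal p i c * ∑ x, pin p i c x * Real.log (pin p i c x / pin q i c x) := by
  simp only [siteMarginal_mul_sum_pin hp]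
  rw [sum_siteMarginal_mul p i fun c => Real.log (siteMarginal p i c / siteMarginal q i c),
    Finset.sum_comm, ← Finset.sum_add_distrib]
  refine Finset.sum_congr rfl fun x _ => ?_
  simp only [Finset.sum_ite_eq, Finset.mem_univ, if_true]
  rcases (hp x).eq_or_lt with h0 | h0
  · simp [← h0]
  have hqx : 0 < q x := (hq x).lt_of_ne fun h => h0.ne' (hpq x h.symm)
  have hr : siteMarginal p i (x i) ≠ 0 := fun h =>
    h0.ne' (eq_zero_of_siteMarginal_eq_zero hp h)
  have hs : siteMarginal q i (x i) ≠ 0 := fun h =>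
    hqx.ne' (eq_zero_of_siteMarginal_eq_zero hq h)
  unfold pin
  simp only [if_true]
  rw [Real.log_div h0.ne' hqx.ne', Real.log_div hr hs,
    Real.log_div (div_ne_zero h0.ne' hr) (div_ne_zero hqx.ne' hs), Real.log_div h0.ne' hr,
    Real.log_div hqx.ne' hs]
  ring

/-- Entropy is bounded by the squared norm of the propagated local gaps. -/
theorem IsDobrushin.entropy_le_green (hQ : IsDobrushin Q A a) {α : ℝ} (hα0 : 0 < α)
    (I : Finset (Fin n)) {p q : (Fin n → X) → ℝ} {y : Fin n → X} (hp0 : ∀ x, 0 ≤ p x)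
    (hp1 : ∑ x, p x = 1) (hq0 : ∀ x, 0 ≤ q x) (hq1 : ∑ x, q x = 1) (hpq : ∀ x, q x = 0 → p x = 0)
    (hqs : ∀ x, q x ≠ 0 → AgreeOff I y x) (hqI : HasSpec q Q I)
    (hα : ∀ i ∈ I, ∀ x, 0 < q x → α ≤ Q i x (x i)) {g : Fin n → ℝ} (hg : ∀ k ∈ I, 0 < g k)
    (hsrc : ∀ k ∈ I, ∑ x, p x * siteGapSq p Q k x < g k ^ 2) :
    α * ∑ x, p x * Real.log (p x / q x) ≤ 4 * ∑ k ∈ I, (∑ l ∈ I, g l * green A I l k) ^ 2 := by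
  induction I using Finset.strongInduction generalizing p q y g with
  | H I ih =>
  rcases I.eq_empty_or_nonempty with rfl | hI
  · have hqy : ∀ x, x ≠ y → q x = 0 := fun x hx => by
      by_contra H
      exact hx (funext fun k => hqs x H k (Finset.notMem_empty k))
    have hq1' : q y = 1 := by
      rw [← hq1]
      exact (Finset.sum_eq_single y (fun x _ hx => hqy x hx) (by simp)).symm
    have hp1' : p y = 1 := by
      rw [← hp1]
      exact (Finset.sum_eq_single y (fun x _ hx => hpq x (hqy x hx)) (by simp)).symm
    rw [Finset.sum_eq_single y (fun x _ hx => by rw [hpq x (hqy x hx), zero_mul]) (by simp)]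
    simp [hq1', hp1']
  set x : Fin n → ℝ := fun k => ∑ l ∈ I, g l * green A I l k with hx
  have hxpos : ∀ k ∈ I, 0 < x k := fun k hk => by
    have h1 := Finset.single_le_sum (f := fun l => g l * green A I l k)
      (fun l hl => mul_nonneg (hg l hl).le (green_nonneg hQ I l k)) hk
    have h2 := one_le_green_self hQ hk
    have h3 := hg k hk
    exact (mul_pos h3 (by linarith)).trans_le h1
  -- Taking `m = x` gives the parameter `x i / u`; its numerator cancels the factor `x i` of the
  -- marginal entropy bound.
  obtain ⟨i, hi, hflip⟩ := exists_flippable hQ hq0 I hxpos hI hqI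
  set u := ∑ l ∈ I, green A I i l * x l with hu
  have hu0 : 0 < u := by
    have h1 := Finset.single_le_sum (f := fun l => green A I i l * x l)
      (fun l hl => mul_nonneg (green_nonneg hQ I i l) (hxpos l hl).le) hi
    exact (mul_pos (by linarith [one_le_green_self hQ hi]) (hxpos i hi)).trans_le h1
  have hmarg := hflip.sum_marginal_log_le hQ hi hp0 hp1 hq0 hq1 hpq hqs hqI
    (fun k hk => (hg k hk).le)
    (fun k hk h c hc => hQ.source_le hp0 hp1 (hg k hk).le (hsrc k hk).le hc) hα0
    (div_pos (hxpos i hi) hu0) (hα i hi)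
  set D := ∑ b, siteMarginal p i b * Real.log (siteMarginal p i b / siteMarginal q i b) with hD
  set yi := g i + ∑ k ∈ I.erase i, A k i * ∑ l ∈ I.erase i, g l * green A (I.erase i) l k with hyi
  have hmarg' : α * D ≤ 4 * (yi * u) := by
    have hxi := hxpos i hi
    have h1 : α * (x i / u) * D = x i * (α * D) / u := by ring
    change α * (x i / u) * D ≤ 4 * x i * yi at hmarg
    rw [h1, div_le_iff₀ hu0] at hmarg
    refine le_of_mul_le_mul_left ?_ hxi
    linarith
  set r := siteMarginal p i with hr
  have hr0 : ∀ c, 0 ≤ r c := siteMarginal_nonneg hp0 i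
  have hr1 : ∑ c, r c = 1 := (sum_siteMarginal p i).trans hp1
  -- The sources after pinning: the conditional mean square gap plus the unchanged slack of `hsrc`.
  -- The slack keeps the inequality strict for the next stage, and the mean of `G c k ^ 2` over `c`
  -- does not exceed `g k ^ 2`.
  set G : X → Fin n → ℝ := fun c k => Real.sqrt (∑ z, pin p i c z * siteGapSq p Q k z +
    (g k ^ 2 - ∑ z, p z * siteGapSq p Q k z)) with hG
  have hpinsum : ∀ c k, 0 ≤ ∑ z, pin p i c z * siteGapSq p Q k z := fun c k =>
    Finset.sum_nonneg fun z _ => mul_nonneg (pin_nonneg hp0 i c z) (siteGapSq_nonneg p Q k z)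
  have hGsq : ∀ c, ∀ k ∈ I, G c k ^ 2 = ∑ z, pin p i c z * siteGapSq p Q k z +
      (g k ^ 2 - ∑ z, p z * siteGapSq p Q k z) := fun c k hk =>
    Real.sq_sqrt (by linarith [hsrc k hk, hpinsum c k])
  have hGpos : ∀ c, ∀ k ∈ I, 0 < G c k := fun c k hk =>
    Real.sqrt_pos.2 (by linarith [hsrc k hk, hpinsum c k])
  have hGmean : ∀ k ∈ I, ∑ c, r c * G c k ^ 2 ≤ g k ^ 2 := fun k hk => by
    simp only [hGsq _ k hk, mul_add, Finset.sum_add_distrib]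
    rw [← Finset.sum_mul, hr1]
    simp only [hr, siteMarginal_mul_sum_pin hp0]
    rw [Finset.sum_comm]
    simp
  have hcond : ∀ c, r c * (α * ∑ z, pin p i c z * Real.log (pin p i c z / pin q i c z)) ≤
      r c * (4 * ∑ k ∈ I.erase i, (∑ l ∈ I.erase i, G c l * green A (I.erase i) l k) ^ 2) := by
    intro c
    rcases (hr0 c).eq_or_lt with h0 | h0
    · rw [← h0, zero_mul, zero_mul]
    have hs0 : siteMarginal q i c ≠ 0 := fun h => h0.ne' (siteMarginal_eq_zero hq0 hpq h)
    have hpinq : ∀ z, pin q i c z ≠ 0 → z i = c ∧ q z ≠ 0 := fun z hz => by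
      unfold pin at hz
      split_ifs at hz with h
      · exact ⟨h, fun h' => hz (by simp [h'])⟩
      · exact absurd rfl hz
    refine mul_le_mul_of_nonneg_left ?_ h0.le
    refine ih (I.erase i) (Finset.erase_ssubset hi) (y := Function.update y i c)
      (pin_nonneg hp0 i c) (sum_pin h0.ne') (pin_nonneg hq0 i c) (sum_pin hs0)
      (fun z hz => ?_) (fun z hz => ?_) ?_ (fun k hk z hz => ?_)
      (fun k hk => hGpos c k (Finset.mem_of_mem_erase hk)) (fun k hk => ?_)
    · unfold pin at hz ⊢
      split_ifs at hz ⊢ with h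
      · rw [div_eq_zero_iff, or_iff_left hs0] at hz
        rw [hpq z hz, zero_div]
      · rfl
    · obtain ⟨h1, h2⟩ := hpinq z hz
      exact h1 ▸ agreeOff_erase (hqs z h2)
    · intro k hk z d
      have hik : i ≠ k := (Finset.ne_of_mem_erase hk).symm
      unfold pin
      simp only [Function.update_of_ne hik]
      split_ifs
      · rw [hqI k (Finset.mem_of_mem_erase hk), ← Finset.sum_div]
        ring
      · simp
    · obtain ⟨-, h2⟩ := hpinq z hz.ne'
      exact hα k (Finset.mem_of_mem_erase hk) z ((hq0 z).lt_of_ne h2.symm)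
    · have hik : i ≠ k := (Finset.ne_of_mem_erase hk).symm
      have hkI := Finset.mem_of_mem_erase hk
      rw [hGsq c k hkI]
      have : ∑ z, pin p i c z * siteGapSq (pin p i c) Q k z =
          ∑ z, pin p i c z * siteGapSq p Q k z := by
        refine Finset.sum_congr rfl fun z _ => ?_
        by_cases hz : z i = c
        · unfold siteGapSq
          rw [condSite_pin hik h0.ne' hz]
        · simp [pin, hz]
      rw [this]
      linarith [hsrc k hkI]
  have hmink : ∑ c, r c * (4 * ∑ k ∈ I.erase i,
        (∑ l ∈ I.erase i, G c l * green A (I.erase i) l k) ^ 2) ≤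
      4 * ∑ k ∈ I.erase i, (∑ l ∈ I.erase i, g l * green A (I.erase i) l k) ^ 2 := by
    have h1 : ∀ k ∈ I.erase i, ∑ c, r c * (∑ l ∈ I.erase i, G c l * green A (I.erase i) l k) ^ 2 ≤
        (∑ l ∈ I.erase i, g l * green A (I.erase i) l k) ^ 2 := fun k _ =>
      sum_mul_sum_sq_le hr0 (fun l hl => hg l (Finset.mem_of_mem_erase hl))
        (fun l _ => green_nonneg hQ _ l k) (fun l hl => hGmean l (Finset.mem_of_mem_erase hl))
    have h2 := Finset.sum_le_sum h1
    rw [Finset.sum_comm] at h2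
    calc _ = 4 * ∑ c, ∑ k ∈ I.erase i,
          r c * (∑ l ∈ I.erase i, G c l * green A (I.erase i) l k) ^ 2 := by
          rw [Finset.mul_sum]
          refine Finset.sum_congr rfl fun c _ => ?_
          rw [← Finset.mul_sum]
          ring
      _ ≤ _ := mul_le_mul_of_nonneg_left h2 (by norm_num)
  rw [sum_mul_log_eq_add_pin hp0 hq0 hpq i, mul_add]
  have h3 : α * ∑ c, r c * ∑ z, pin p i c z * Real.log (pin p i c z / pin q i c z) ≤
      4 * ∑ k ∈ I.erase i, (∑ l ∈ I.erase i, g l * green A (I.erase i) l k) ^ 2 := by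
    rw [Finset.mul_sum _ fun c => r c * _]
    exact (Finset.sum_le_sum fun c _ => le_of_eq_of_le (by ring) (hcond c)).trans hmink
  have h4 := green_energy_decrease hQ hi fun k hk => (hg k hk).le
  change yi * u + _ ≤ ∑ k ∈ I, x k ^ 2 at h4
  linarith

end Induction

/-! ### From the Green matrix to the operator norm -/

section Entropy

variable {X : Type*} [Fintype X] [DecidableEq X] {n : ℕ}
variable {Q : Fin n → (Fin n → X) → X → ℝ} {A : Fin n → Fin n → ℝ} {a : ℝ}

lemma sum_mul_le_of_sum_sq_le_mul {ι : Type*} [Fintype ι] {a : ℝ} (ha : 0 ≤ a) {v w : ι → ℝ}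
    (h : ∑ k, w k ^ 2 ≤ a ^ 2 * ∑ k, v k ^ 2) : ∑ k, v k * w k ≤ a * ∑ k, v k ^ 2 := by
  have hN : 0 ≤ ∑ k, v k ^ 2 := Finset.sum_nonneg fun k _ => sq_nonneg _
  have h1 := Finset.sum_mul_sq_le_sq_mul_sq Finset.univ v w
  refine (abs_le_of_sq_le_sq' ?_ (mul_nonneg ha hN)).2
  calc _ ≤ _ := h1
    _ ≤ (∑ k, v k ^ 2) * (a ^ 2 * ∑ k, v k ^ 2) := mul_le_mul_of_nonneg_left h hN
    _ = _ := by ring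

/-- Pairing `x = g + x A` with `x` gives `|x|² ≤ ⟨x, g⟩ + a |x|²`; Cauchy–Schwarz does the rest. -/
lemma sum_sq_green_le (hQ : IsDobrushin Q A a) (g : Fin n → ℝ) :
    (1 - a) ^ 2 * ∑ k, (∑ l, g l * green A Finset.univ l k) ^ 2 ≤ ∑ k, g k ^ 2 := by
  set x : Fin n → ℝ := fun k => ∑ l, g l * green A Finset.univ l k with hx
  have hxk : ∀ k, x k = g k + ∑ j, A j k * x j := fun k =>
    sum_mul_green_row hQ g (Finset.mem_univ k)
  have h1 := sum_mul_le_of_sum_sq_le_mul hQ.norm_nonneg (hQ.quad x)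
  have h2 : ∑ k, x k ^ 2 = ∑ k, x k * g k + ∑ k, x k * ∑ j, A j k * x j := by
    rw [← Finset.sum_add_distrib]
    refine Finset.sum_congr rfl fun k _ => ?_
    rw [← mul_add, ← hxk k, sq]
  have h3 := Finset.sum_mul_sq_le_sq_mul_sq Finset.univ x g
  have hN : 0 ≤ ∑ k, x k ^ 2 := Finset.sum_nonneg fun k _ => sq_nonneg _
  have hM : 0 ≤ ∑ k, g k ^ 2 := Finset.sum_nonneg fun k _ => sq_nonneg _
  change (1 - a) ^ 2 * ∑ k, x k ^ 2 ≤ _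
  rcases hN.eq_or_lt with h0 | h0
  · rw [← h0, mul_zero]; exact hM
  have h4 : (1 - a) * ∑ k, x k ^ 2 ≤ ∑ k, x k * g k := by linarith
  have h5 : ((1 - a) * ∑ k, x k ^ 2) ^ 2 ≤ (∑ k, x k * g k) ^ 2 :=
    pow_le_pow_left₀ (mul_nonneg (by linarith [hQ.norm_lt_one]) hN) h4 2
  refine le_of_mul_le_mul_left ?_ h0
  calc (∑ k, x k ^ 2) * ((1 - a) ^ 2 * ∑ k, x k ^ 2) = ((1 - a) * ∑ k, x k ^ 2) ^ 2 := by ring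
    _ ≤ _ := h5.trans h3

/-- Entropy is bounded by the mean squared local gaps. -/
theorem IsDobrushin.entropy_le (hQ : IsDobrushin Q A a) {α : ℝ} (hα0 : 0 < α)
    {p q : (Fin n → X) → ℝ} (hp0 : ∀ x, 0 ≤ p x)
    (hp1 : ∑ x, p x = 1) (hq0 : ∀ x, 0 ≤ q x) (hq1 : ∑ x, q x = 1) (hpq : ∀ x, q x = 0 → p x = 0)
    (hqQ : HasSpec q Q Finset.univ) (hα : ∀ i x, 0 < q x → α ≤ Q i x (x i)) :
    ∑ x, p x * Real.log (p x / q x) ≤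
      4 / α * (1 / (1 - a) ^ 2) * ∑ i, ∑ y, p y * siteGapSq p Q i y := by
  obtain ⟨y⟩ : Nonempty (Fin n → X) := by
    by_contra H
    rw [not_nonempty_iff] at H
    simp at hp1
  have ha : 0 < (1 - a) ^ 2 := by
    have := hQ.norm_lt_one
    have : 0 < 1 - a := by linarith
    positivity
  have hS : ∀ i, 0 ≤ ∑ y, p y * siteGapSq p Q i y := fun i =>
    Finset.sum_nonneg fun y _ => mul_nonneg (hp0 y) (siteGapSq_nonneg p Q i y)
  -- Sources must strictly exceed the gaps, so `η` is spread over the sites and then sent to `0`.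
  have key : ∀ η : ℝ, 0 < η → α * (1 - a) ^ 2 * ∑ x, p x * Real.log (p x / q x) ≤
      4 * ∑ i, ∑ y, p y * siteGapSq p Q i y + η := by
    intro η hη
    have hη' : 0 < η / (4 * (n + 1)) := by positivity
    have hg : ∀ i, 0 < ∑ y, p y * siteGapSq p Q i y + η / (4 * (n + 1)) := fun i => by
      linarith [hS i]
    have h1 := hQ.entropy_le_green hα0 Finset.univ (y := y) hp0 hp1 hq0 hq1 hpq
      (fun x _ k hk => absurd (Finset.mem_univ k) hk) hqQ (fun i _ => hα i)
      (g := fun i => Real.sqrt (∑ y, p y * siteGapSq p Q i y + η / (4 * (n + 1))))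
      (fun i _ => Real.sqrt_pos.2 (hg i)) (fun i _ => by
        rw [Real.sq_sqrt (hg i).le]; linarith)
    have h2 := sum_sq_green_le hQ
      fun i => Real.sqrt (∑ y, p y * siteGapSq p Q i y + η / (4 * (n + 1)))
    simp only [Real.sq_sqrt (hg _).le, Finset.sum_add_distrib, Finset.sum_const, Finset.card_univ,
      Fintype.card_fin, nsmul_eq_mul] at h2
    have h3 : 4 * ((n : ℝ) * (η / (4 * (n + 1)))) ≤ η := by
      rw [show 4 * ((n : ℝ) * (η / (4 * (n + 1)))) = η * (n / (n + 1)) by field_simp]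
      refine mul_le_of_le_one_right hη.le ?_
      rw [div_le_one (by positivity)]
      linarith
    have h4 := mul_le_mul_of_nonneg_left h1 ha.le
    linarith
  have h5 := le_of_forall_pos_le_add key
  have hα2 : 0 < α * (1 - a) ^ 2 := mul_pos hα0 ha
  rw [show 4 / α * (1 / (1 - a) ^ 2) * ∑ i, ∑ y, p y * siteGapSq p Q i y =
    (4 * ∑ i, ∑ y, p y * siteGapSq p Q i y) / (α * (1 - a) ^ 2) by field_simp,
    le_div_iff₀ hα2]
  linarith

end Entropy

/-! ### Pinsker's inequality -/

section Pinsker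

/-- The rational function is `3 (t - 1)² ≤ (2 t + 4)(t log t - t + 1)` solved for `log t`. The cube
in the derivative carries the sign of `t - 1`, so the difference is minimal at `t = 1`, where it
vanishes. -/
lemma hasDerivAt_log_sub_rational {t : ℝ} (ht : 0 < t) :
    HasDerivAt (fun t : ℝ => Real.log t - (t - 1) * (5 * t + 1) / (2 * t * (t + 2)))
      ((t - 1) ^ 3 / (t ^ 2 * (t + 2) ^ 2)) t := by
  have h1 : HasDerivAt (fun t : ℝ => (t - 1) * (5 * t + 1)) (1 * (5 * t + 1) + (t - 1) * (5 * 1)) t :=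
    ((hasDerivAt_id t).sub_const 1).mul (((hasDerivAt_id t).const_mul 5).add_const 1)
  have h2 : HasDerivAt (fun t : ℝ => 2 * t * (t + 2)) (2 * 1 * (t + 2) + 2 * t * 1) t :=
    ((hasDerivAt_id t).const_mul 2).mul ((hasDerivAt_id t).add_const 2)
  have h3 : 2 * t * (t + 2) ≠ 0 := by positivity
  refine ((Real.hasDerivAt_log ht.ne').sub (h1.div h2 h3)).congr_deriv ?_
  have : t + 2 ≠ 0 := by positivity
  field_simp
  ring

lemma rational_le_log {t : ℝ} (ht : 0 < t) :
    (t - 1) * (5 * t + 1) / (2 * t * (t + 2)) ≤ Real.log t := by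
  set φ : ℝ → ℝ := fun t => Real.log t - (t - 1) * (5 * t + 1) / (2 * t * (t + 2)) with hφ
  have h1 : φ 1 = 0 := by simp [hφ]
  suffices φ 1 ≤ φ t by
    rw [h1] at this
    simp only [hφ] at this
    linarith
  rcases le_total 1 t with h | h
  · refine monotoneOn_of_deriv_nonneg (convex_Ici (1 : ℝ))
      (fun s hs => (hasDerivAt_log_sub_rational
        (zero_lt_one.trans_le hs)).continuousAt.continuousWithinAt)
      (fun s hs => ?_) (fun s hs => ?_) (Set.mem_Ici.2 le_rfl) (Set.mem_Ici.2 h) h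
    · rw [interior_Ici] at hs
      exact (hasDerivAt_log_sub_rational
        (zero_lt_one.trans hs)).differentiableAt.differentiableWithinAt
    · rw [interior_Ici] at hs
      rw [(hasDerivAt_log_sub_rational (zero_lt_one.trans hs)).deriv]
      have : (0 : ℝ) ≤ s - 1 := by linarith [Set.mem_Ioi.1 hs]
      positivity
  · refine antitoneOn_of_deriv_nonpos (convex_Icc t 1)
      (fun s hs => (hasDerivAt_log_sub_rational
        (ht.trans_le hs.1)).continuousAt.continuousWithinAt)
      (fun s hs => ?_) (fun s hs => ?_) (Set.left_mem_Icc.2 h) (Set.right_mem_Icc.2 h) h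
    · rw [interior_Icc] at hs
      exact (hasDerivAt_log_sub_rational
        (ht.trans hs.1)).differentiableAt.differentiableWithinAt
    · rw [interior_Icc] at hs
      rw [(hasDerivAt_log_sub_rational (ht.trans hs.1)).deriv]
      refine div_nonpos_of_nonpos_of_nonneg ?_ (by positivity)
      have : s - 1 ≤ 0 := by linarith [hs.2]
      exact Odd.pow_nonpos (by decide) this

lemma three_mul_sq_le_log {r s : ℝ} (hr : 0 ≤ r) (hs : 0 ≤ s) (hrs : s = 0 → r = 0) :
    (r - s) ^ 2 ≤ (2 * r + 4 * s) / 3 * (r * Real.log (r / s) - r + s) := by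
  rcases hs.eq_or_lt with h0 | h0
  · simp [← h0, hrs h0.symm]
  rcases hr.eq_or_lt with h1 | h1
  · rw [← h1]
    simp
    nlinarith
  have h := rational_le_log (div_pos h1 h0)
  have h2 : (r / s - 1) * (5 * (r / s) + 1) / (2 * (r / s) * (r / s + 2)) =
      (r - s) * (5 * r + s) / (2 * r * (r + 2 * s)) := by
    have : r + 2 * s ≠ 0 := by positivity
    have : r / s + 2 ≠ 0 := by positivity
    field_simp
  rw [h2, div_le_iff₀ (by positivity)] at h
  nlinarith

/-- Pinsker's inequality. -/
lemma two_mul_tvDist_sq_le {Z : Type*} [Fintype Z] {r s : Z → ℝ} (hr : ∀ z, 0 ≤ r z)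
    (hs : ∀ z, 0 ≤ s z) (hr1 : ∑ z, r z = 1) (hs1 : ∑ z, s z = 1) (hrs : ∀ z, s z = 0 → r z = 0) :
    2 * tvDist r s ^ 2 ≤ ∑ z, r z * Real.log (r z / s z) := by
  classical
  -- Cauchy–Schwarz on the pointwise bound: the first factor sums to `2`, and in the second `- r +
  -- s` cancels.
  have hc : (∑ z, |r z - s z|) ^ 2 ≤ (∑ z, (2 * r z + 4 * s z) / 3) *
      ∑ z, (r z * Real.log (r z / s z) - r z + s z) := by
    refine Finset.sum_sq_le_sum_mul_sum_of_sq_le_mul _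
      (fun z _ => by have := hr z; have := hs z; positivity) (fun z _ => ?_) fun z _ => ?_
    · have h := three_mul_sq_le_log (hr z) (hs z) (hrs z)
      rcases (hs z).eq_or_lt with h0 | h0
      · simp [← h0, hrs z h0.symm]
      · refine le_of_mul_le_mul_left ?_
          (show 0 < (2 * r z + 4 * s z) / 3 by have := hr z; positivity)
        rw [mul_zero]
        exact (sq_nonneg _).trans h
    · rw [sq_abs]
      exact three_mul_sq_le_log (hr z) (hs z) (hrs z)
  have e1 : ∑ z, (2 * r z + 4 * s z) / 3 = 2 := by
    rw [← Finset.sum_div, Finset.sum_add_distrib, ← Finset.mul_sum, ← Finset.mul_sum, hr1, hs1]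
    norm_num
  have e2 : ∑ z, (r z * Real.log (r z / s z) - r z + s z) =
      ∑ z, r z * Real.log (r z / s z) := by
    rw [Finset.sum_add_distrib, Finset.sum_sub_distrib, hr1, hs1]
    ring
  rw [e1, e2] at hc
  have htv : tvDist r s ≤ (∑ z, |r z - s z|) / 2 := by
    refine tvDist_le fun B => ?_
    rw [← Finset.sum_sub_distrib]
    have h1 : ∑ z ∈ B, (r z - s z) + ∑ z ∈ Bᶜ, (r z - s z) = 0 := by
      rw [Finset.sum_add_sum_compl, Finset.sum_sub_distrib, hr1, hs1, sub_self]
    have h2 := Finset.sum_add_sum_compl B fun z => |r z - s z|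
    have h3 := Finset.abs_sum_le_sum_abs (fun z => r z - s z) B
    have h4 := Finset.abs_sum_le_sum_abs (fun z => r z - s z) Bᶜ
    have h5 : ∑ z ∈ Bᶜ, (r z - s z) = -∑ z ∈ B, (r z - s z) := by linarith
    rw [h5, abs_neg] at h4
    linarith
  have := pow_le_pow_left₀ (tvDist_nonneg r s) htv 2
  nlinarith

end Pinsker

/-! ### From the stated hypotheses to `HasSpec` and `IsDobrushin` -/

section Setup

variable {X : Type*} [Fintype X] [DecidableEq X] {n : ℕ}

/-- At outer configurations of mass zero both sides vanish, so the arbitrary values of `Q` there are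
harmless. -/
lemma IsLocalSpec.hasSpec {q : (Fin n → X) → ℝ} (hq : ∀ x, 0 ≤ q x)
    {Q : Fin n → (Fin n → X) → X → ℝ} (hQ : IsLocalSpec q Q) : HasSpec q Q Finset.univ := by
  intro k hk x c
  rcases (Finset.sum_nonneg fun b _ => hq (Function.update x k b) :
    0 ≤ ∑ b, q (Function.update x k b)).eq_or_lt with h0 | h0
  · rw [← h0, zero_mul]
    exact (Finset.sum_eq_zero_iff_of_nonneg fun b _ => hq _).1 h0.symm c (Finset.mem_univ c)
  · rw [hQ.2.2 k x h0]
    exact hasSpec_condSite hq Finset.univ k hk x c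

lemma sum_sq_mulVec_le (M : Matrix (Fin n) (Fin n) ℝ) (v : Fin n → ℝ) :
    ∑ j, (∑ k, M j k * v k) ^ 2 ≤ l2Norm M ^ 2 * ∑ k, v k ^ 2 := by
  have h := (Matrix.toEuclideanCLM (n := Fin n) (𝕜 := ℝ) M).le_opNorm (WithLp.toLp 2 v)
  have h2 := pow_le_pow_left₀ (norm_nonneg _) h 2
  rw [mul_pow, EuclideanSpace.norm_sq_eq, EuclideanSpace.norm_sq_eq] at h2
  simpa [Matrix.mulVec, dotProduct, l2Norm] using h2

/-- Weights propagate as row vectors `v A`, so `quad` concerns the transpose. -/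
lemma l2Norm_transpose (M : Matrix (Fin n) (Fin n) ℝ) : l2Norm M.transpose = l2Norm M := by
  have : M.transpose = star M := by
    ext i j
    simp [Matrix.star_apply]
  unfold l2Norm
  rw [this, map_star, ContinuousLinearMap.star_eq_adjoint]
  exact LinearIsometryEquiv.norm_map ContinuousLinearMap.adjoint _

/-- Two distinct symbols are needed to read `0 ≤ A k i` off the condition; with one symbol it is
vacuous off the diagonal. -/
lemma DobrushinL2.isDobrushin [Nontrivial X] {q : (Fin n → X) → ℝ}
    {Q : Fin n → (Fin n → X) → X → ℝ} (hQ : IsLocalSpec q Q) {A : Matrix (Fin n) (Fin n) ℝ}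
    (hA : DobrushinL2 Q A) : IsDobrushin Q A (l2Norm A) where
  entry_nonneg k i := by
    by_cases hki : k = i
    · rw [hki, hA.2.1]
    · obtain ⟨b, c, hbc⟩ := exists_pair_ne X
      exact (tvDist_nonneg _ _).trans (hA.1 k i hki (Function.update (fun _ => b) k b)
        (Function.update (fun _ => b) k c) (by simpa using hbc) fun l hl => by simp [hl])
  diag := hA.2.1
  nonneg i x c := (hQ.1 i x).1 c
  sum_eq_one i x := (hQ.1 i x).2
  update_self i x c := hQ.2.1 i _ _ fun k hk => by simp [hk]
  tv_le k i x b c hki := by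
    by_cases hbc : b = c
    · subst hbc
      rw [tvDist_self]
      obtain ⟨b, c, hbc⟩ := exists_pair_ne X
      exact (tvDist_nonneg _ _).trans (hA.1 k i hki (Function.update x k b)
        (Function.update x k c) (by simpa using hbc) fun l hl => by simp [hl])
    · exact hA.1 k i hki _ _ (by simpa using hbc) fun l hl => by simp [hl]
  norm_nonneg := norm_nonneg _
  norm_lt_one := hA.2.2
  quad v := by
    have := sum_sq_mulVec_le A.transpose v
    rwa [l2Norm_transpose] at this

lemma minLocal_le {q : (Fin n → X) → ℝ} {Q : Fin n → (Fin n → X) → X → ℝ}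
    (hQ : IsLocalSpec q Q) (i : Fin n) {x : Fin n → X} (hx : 0 < q x) :
    minLocal q Q ≤ Q i x (x i) :=
  csInf_le ⟨0, by rintro _ ⟨j, z, -, rfl⟩; exact (hQ.1 j z).1 _⟩ ⟨i, x, hx, rfl⟩

/-- The infimum over a nonempty finite set is attained, and the value `0` at `x` would force `q x =
0`. -/
lemma minLocal_pos (hn : 1 ≤ n) {q : (Fin n → X) → ℝ} (hq0 : ∀ x, 0 ≤ q x) (hq1 : ∑ x, q x = 1)
    {Q : Fin n → (Fin n → X) → X → ℝ} (hQ : IsLocalSpec q Q) : 0 < minLocal q Q := by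
  have hfin : {a : ℝ | ∃ (i : Fin n) (x : Fin n → X), 0 < q x ∧ a = Q i x (x i)}.Finite := by
    refine (Set.finite_range fun w : Fin n × (Fin n → X) => Q w.1 w.2 (w.2 w.1)).subset ?_
    rintro _ ⟨i, x, -, rfl⟩
    exact ⟨(i, x), rfl⟩
  have hne : {a : ℝ | ∃ (i : Fin n) (x : Fin n → X), 0 < q x ∧ a = Q i x (x i)}.Nonempty := by
    obtain ⟨x, -, hx⟩ := Finset.exists_ne_zero_of_sum_ne_zero (hq1.trans_ne one_ne_zero)
    exact ⟨_, ⟨0, hn⟩, x, (hq0 x).lt_of_ne hx.symm, rfl⟩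
  obtain ⟨i, x, hx, h⟩ := hne.csInf_mem hfin
  have h1 := hQ.hasSpec hq0 i (Finset.mem_univ i) x (x i)
  rw [Function.update_eq_self] at h1
  unfold minLocal
  rw [h]
  refine ((hQ.1 i x).1 _).lt_of_ne fun h0 => hx.ne' ?_
  rw [h1, ← h0, mul_zero]

lemma condSite_eq_zero {p q : (Fin n → X) → ℝ} (hq0 : ∀ x, 0 ≤ q x)
    (hpq : ∀ x, q x = 0 → p x = 0) {Q : Fin n → (Fin n → X) → X → ℝ} (hQ : IsLocalSpec q Q)
    (i : Fin n) (y : Fin n → X) (c : X) (hc : Q i y c = 0) : condSite p i y c = 0 := by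
  have h := hQ.hasSpec hq0 i (Finset.mem_univ i) y c
  rw [hc, mul_zero] at h
  unfold condSite
  rw [hpq _ h, zero_div]

end Setup

/-! ### Entropy along the Gibbs sampler -/

section Sampler

variable {X : Type*} [Fintype X] [DecidableEq X] {n : ℕ}

lemma sum_ite_agree (i : Fin n) (z : Fin n → X) (F : (Fin n → X) → ℝ) :
    ∑ y, (if ∀ k, k ≠ i → y k = z k then F y else 0) = ∑ b, F (Function.update z i b) := by
  have h1 : ∀ y, (if ∀ k, k ≠ i → y k = z k then F y else 0) =
      ∑ b, if y = Function.update z i b then F y else 0 := by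
    intro y
    have h2 : ∀ b, y = Function.update z i b ↔ y i = b ∧ ∀ k, k ≠ i → y k = z k := fun b => by
      rw [Function.eq_update_iff]
    simp only [h2]
    split_ifs with h
    · rw [Finset.sum_eq_single (y i) (fun b _ hb => if_neg fun h' => hb h'.1.symm) (by simp),
        if_pos ⟨rfl, h⟩]
    · exact (Finset.sum_eq_zero fun b _ => if_neg fun h' => h h'.2).symm
  simp only [h1]
  rw [Finset.sum_comm]
  simp

variable {Q : Fin n → (Fin n → X) → X → ℝ}

/-- The law of the configuration after resampling the coordinate `i`. -/
noncomputable def siteStep (Q : Fin n → (Fin n → X) → X → ℝ) (i : Fin n) (p : (Fin n → X) → ℝ)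
    (z : Fin n → X) : ℝ :=
  (∑ b, p (Function.update z i b)) * Q i z (z i)

lemma gibbsStep_eq (hQ : ∀ i x c, Q i (Function.update x i c) = Q i x) (p : (Fin n → X) → ℝ)
    (z : Fin n → X) : gibbsStep Q p z = ∑ i, 1 / (n : ℝ) * siteStep Q i p z := by
  unfold gibbsStep gibbs
  have h : ∀ i, ∑ y, p y * gibbsSite Q i y z = siteStep Q i p z := by
    intro i
    unfold gibbsSite siteStep
    simp only [mul_ite, mul_zero]
    rw [sum_ite_agree i z fun y => p y * Q i y (z i), Finset.sum_mul]
    simp only [hQ]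
  rw [← Finset.mul_sum, ← Finset.sum_congr rfl fun i _ => h i, Finset.sum_comm, Finset.mul_sum]
  refine Finset.sum_congr rfl fun y _ => ?_
  rw [← Finset.mul_sum]
  ring

lemma siteStep_eq_zero {p q : (Fin n → X) → ℝ} (hq0 : ∀ x, 0 ≤ q x)
    (hpq : ∀ x, q x = 0 → p x = 0) (hqQ : HasSpec q Q Finset.univ) (i : Fin n) {z : Fin n → X}
    (hz : q z = 0) : siteStep Q i p z = 0 := by
  have h := hqQ i (Finset.mem_univ i) z (z i)
  rw [Function.update_eq_self, hz, eq_comm, mul_eq_zero] at h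
  unfold siteStep
  rcases h with h | h
  · rw [Finset.sum_eq_zero_iff_of_nonneg fun b _ => hq0 _] at h
    rw [Finset.sum_eq_zero fun b hb => hpq _ (h b hb), zero_mul]
  · rw [h, mul_zero]

/-- The entropy loss in one step of the sampler at a fixed site. -/
lemma entropy_siteStep {p q : (Fin n → X) → ℝ} (hp0 : ∀ x, 0 ≤ p x)
    (hpq : ∀ x, q x = 0 → p x = 0) (hqQ : HasSpec q Q Finset.univ)
    (hQ : ∀ i x c, Q i (Function.update x i c) = Q i x)
    (hQ1 : ∀ i x, ∑ c, Q i x c = 1) (i : Fin n) :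
    ∑ z, siteStep Q i p z * Real.log (siteStep Q i p z / q z) =
      ∑ z, p z * Real.log (p z / q z) -
        ∑ y, p y * ∑ c, condSite p i y c * Real.log (condSite p i y c / Q i y c) := by
  -- `L` is the log-density of the laws of the coordinates other than `i`. After the update the
  -- conditional laws at `i` agree and the entropy is `∑ p * L`; before it, the log-ratio of the
  -- conditional laws is added.
  set L : (Fin n → X) → ℝ := fun z =>
    Real.log ((∑ b, p (Function.update z i b)) / ∑ b, q (Function.update z i b)) with hL
  have hLu : ∀ z c, L (Function.update z i c) = L z := fun z c => by simp [hL]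
  have hqz : ∀ z, q z = (∑ b, q (Function.update z i b)) * Q i z (z i) := fun z => by
    simpa using hqQ i (Finset.mem_univ i) z (z i)
  have hpz : ∀ z, p z = (∑ b, p (Function.update z i b)) * condSite p i z (z i) := fun z => by
    simpa using hasSpec_condSite hp0 Finset.univ i (Finset.mem_univ i) z (z i)
  have h1 : ∑ z, siteStep Q i p z * Real.log (siteStep Q i p z / q z) = ∑ z, p z * L z := by
    have h2 : ∀ z, siteStep Q i p z * Real.log (siteStep Q i p z / q z) =
        ∑ b, p (Function.update z i b) * Q i z (z i) * L z := by
      intro z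
      rw [← Finset.sum_mul, ← Finset.sum_mul]
      change siteStep Q i p z * _ = siteStep Q i p z * _
      by_cases hQz : Q i z (z i) = 0
      · simp [siteStep, hQz]
      · rw [hqz z, siteStep, mul_div_mul_right _ _ hQz]
    simp only [h2]
    rw [sum_sum_update_swap i]
    refine Finset.sum_congr rfl fun z _ => ?_
    simp only [Function.update_idem, Function.update_eq_self, Function.update_self, hQ, hLu]
    rw [← Finset.sum_mul, ← Finset.mul_sum, hQ1, mul_one]
  have h3 := sum_mul_gibbsOp (fun x c => condSite_update p i x c)
    (hasSpec_condSite hp0 Finset.univ i (Finset.mem_univ i))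
    fun z => Real.log (condSite p i z (z i) / Q i z (z i))
  unfold gibbsOp at h3
  simp only [condSite_update, hQ, Function.update_self] at h3
  rw [h1, h3, ← Finset.sum_sub_distrib]
  refine Finset.sum_congr rfl fun z _ => ?_
  rcases (hp0 z).eq_or_lt with h0 | h0
  · simp [← h0]
  have hqpos : q z ≠ 0 := fun h => h0.ne' (hpq z h)
  have hq' := hqz z ▸ hqpos
  have hp' := hpz z ▸ h0.ne'
  rw [← mul_sub]
  congr 1
  conv_rhs => rw [hqz z]
  rw [show Real.log (p z / _) = Real.log ((∑ b, p (Function.update z i b)) *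
    condSite p i z (z i) / ((∑ b, q (Function.update z i b)) * Q i z (z i))) by rw [← hpz z],
    mul_div_mul_comm, Real.log_mul (div_ne_zero (left_ne_zero_of_mul hp') (left_ne_zero_of_mul hq'))
      (div_ne_zero (right_ne_zero_of_mul hp') (right_ne_zero_of_mul hq'))]
  ring

/-- Convexity of relative entropy along the random choice of the site. -/
lemma entropy_gibbsStep_le (hn : 1 ≤ n) {p q : (Fin n → X) → ℝ} (hp0 : ∀ x, 0 ≤ p x)
    (hq0 : ∀ x, 0 ≤ q x) (hpq : ∀ x, q x = 0 → p x = 0) (hqQ : HasSpec q Q Finset.univ)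
    (hQ : ∀ i x c, Q i (Function.update x i c) = Q i x) (hQ0 : ∀ i x c, 0 ≤ Q i x c) :
    ∑ z, gibbsStep Q p z * Real.log (gibbsStep Q p z / q z) ≤
      1 / (n : ℝ) * ∑ i, ∑ z, siteStep Q i p z * Real.log (siteStep Q i p z / q z) := by
  have hn0 : (n : ℝ) ≠ 0 := by positivity
  rw [Finset.sum_comm, Finset.mul_sum]
  refine Finset.sum_le_sum fun z _ => ?_
  rw [gibbsStep_eq hQ]
  have hs0 : ∀ i, 0 ≤ siteStep Q i p z := fun i =>
    mul_nonneg (Finset.sum_nonneg fun b _ => hp0 _) (hQ0 _ _ _)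
  rcases (hq0 z).eq_or_lt with h0 | h0
  · simp [siteStep_eq_zero hq0 hpq hqQ _ h0.symm]
  have h := Real.convexOn_mul_log.map_sum_le (t := Finset.univ) (w := fun _ : Fin n => 1 / (n : ℝ))
    (p := fun i => siteStep Q i p z / q z) (fun i _ => by positivity)
    (by simp [hn0]) (fun i _ => Set.mem_Ici.2 (div_nonneg (hs0 i) h0.le))
  simp only [smul_eq_mul] at h
  have h2 := mul_le_mul_of_nonneg_left h h0.le
  have e1 : ∑ i, 1 / (n : ℝ) * (siteStep Q i p z / q z) =
      (∑ i, 1 / (n : ℝ) * siteStep Q i p z) / q z := by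
    rw [Finset.sum_div]
    exact Finset.sum_congr rfl fun i _ => by ring
  rw [e1, Finset.mul_sum, ← mul_assoc, mul_div_cancel₀ _ h0.ne'] at h2
  refine h2.trans_eq ?_
  rw [Finset.mul_sum]
  refine Finset.sum_congr rfl fun i _ => ?_
  field_simp

end Sampler

/-! ### Extended-valued entropies as real sums -/

section ERealForms

variable {X : Type*} [Fintype X] [DecidableEq X] {n : ℕ}
variable {Q : Fin n → (Fin n → X) → X → ℝ}

lemma relEntropy_eq_coe {Z : Type*} [Fintype Z] {r s : Z → ℝ} (h : ∀ u, s u = 0 → r u = 0) :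
    relEntropy r s = ((∑ u, r u * Real.log (r u / s u) : ℝ) : EReal) :=
  if_pos h

lemma EReal.coe_sum_real {κ : Type*} (s : Finset κ) (f : κ → ℝ) :
    ((∑ i ∈ s, f i : ℝ) : EReal) = ∑ i ∈ s, (f i : EReal) := by
  classical
  induction s using Finset.induction_on with
  | empty => simp
  | insert i s hi ih => rw [Finset.sum_insert hi, Finset.sum_insert hi, EReal.coe_add, ih]

lemma sum_mul_relEntropy_condSite {p q : (Fin n → X) → ℝ} (hq0 : ∀ x, 0 ≤ q x)
    (hpq : ∀ x, q x = 0 → p x = 0) (hQ : IsLocalSpec q Q) :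
    ∑ i, ∑ y, (p y : EReal) * relEntropy (condSite p i y) (Q i y) =
      ((∑ i, ∑ y, p y * ∑ c, condSite p i y c * Real.log (condSite p i y c / Q i y c) : ℝ) :
        EReal) := by
  rw [EReal.coe_sum_real]
  refine Finset.sum_congr rfl fun i _ => ?_
  rw [EReal.coe_sum_real]
  refine Finset.sum_congr rfl fun y _ => ?_
  rw [relEntropy_eq_coe (condSite_eq_zero hq0 hpq hQ i y), EReal.coe_mul]

lemma two_mul_sum_siteGapSq_le {p q : (Fin n → X) → ℝ} (hp0 : ∀ x, 0 ≤ p x) (hq0 : ∀ x, 0 ≤ q x)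
    (hpq : ∀ x, q x = 0 → p x = 0) (hQ : IsLocalSpec q Q) :
    2 * ∑ i, ∑ y, p y * siteGapSq p Q i y ≤
      ∑ i, ∑ y, p y * ∑ c, condSite p i y c * Real.log (condSite p i y c / Q i y c) := by
  simp only [Finset.mul_sum (a := (2 : ℝ))]
  refine Finset.sum_le_sum fun i _ => Finset.sum_le_sum fun y _ => ?_
  rcases (hp0 y).eq_or_lt with h0 | h0
  · simp [← h0]
  rw [mul_left_comm]
  exact mul_le_mul_of_nonneg_left (two_mul_tvDist_sq_le (condSite_nonneg hp0 i y)
    (hQ.1 i y).1 (sum_condSite hp0 i h0) (hQ.1 i y).2 (condSite_eq_zero hq0 hpq hQ i y)) h0.le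

end ERealForms

/-! ### Transportation by resampling a coupling -/

section Transport

variable {ι X : Type*} [Fintype ι] [DecidableEq ι] [Fintype X] [DecidableEq X]

/-- A maximal coupling of two laws on a finite set. -/
lemma exists_maximal_coupling {r s : X → ℝ} (hr : ∀ c, 0 ≤ r c) (hs : ∀ c, 0 ≤ s c)
    (hr1 : ∑ c, r c = 1) (hs1 : ∑ c, s c = 1) :
    ∃ κ : X → X → ℝ, (∀ b c, 0 ≤ κ b c) ∧ (∀ b, ∑ c, κ b c = r b) ∧ (∀ c, ∑ b, κ b c = s c) ∧
      ∑ b, ∑ c, (if b ≠ c then κ b c else 0) ≤ tvDist r s := by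
  set m : X → ℝ := fun c => min (r c) (s c) with hm
  set t : ℝ := 1 - ∑ c, m c with ht
  have hrm : ∀ c, 0 ≤ r c - m c := fun c => sub_nonneg.2 (min_le_left _ _)
  have hsm : ∀ c, 0 ≤ s c - m c := fun c => sub_nonneg.2 (min_le_right _ _)
  have hrt : ∑ c, (r c - m c) = t := by rw [Finset.sum_sub_distrib, hr1]
  have hst : ∑ c, (s c - m c) = t := by rw [Finset.sum_sub_distrib, hs1]
  have ht0 : 0 ≤ t := hrt ▸ Finset.sum_nonneg fun c _ => hrm c
  -- If `t = 0` both remainders vanish, so dividing by `t` does no harm.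
  have hcancel : ∀ f : X → ℝ, (∀ c, 0 ≤ f c) → ∑ c, f c = t → ∀ c, f c * t / t = f c := by
    intro f hf hft c
    rcases ht0.eq_or_lt with h0 | h0
    · rw [← h0] at hft
      rw [(Finset.sum_eq_zero_iff_of_nonneg fun c _ => hf c).1 hft c (Finset.mem_univ c)]
      simp
    · exact mul_div_cancel_right₀ _ h0.ne'
  -- Common mass stays on the diagonal; the remainders are coupled independently.
  refine ⟨fun b c => (if b = c then m b else 0) + (r b - m b) * (s c - m c) / t,
    fun b c => ?_, fun b => ?_, fun c => ?_, ?_⟩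
  · refine add_nonneg ?_ (div_nonneg (mul_nonneg (hrm b) (hsm c)) ht0)
    split_ifs
    exacts [le_min (hr b) (hs b), le_rfl]
  · rw [Finset.sum_add_distrib, Finset.sum_ite_eq, if_pos (Finset.mem_univ b), ← Finset.sum_div,
      ← Finset.mul_sum, hst, hcancel _ hrm hrt b]
    ring
  · rw [Finset.sum_add_distrib, Finset.sum_ite_eq', if_pos (Finset.mem_univ c), ← Finset.sum_div,
      ← Finset.sum_mul, hrt, mul_comm, hcancel _ hsm hst c]
    ring
  · calc ∑ b, ∑ c, (if b ≠ c then (if b = c then m b else 0) + (r b - m b) * (s c - m c) / t else 0)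
        ≤ ∑ b, ∑ c, (r b - m b) * (s c - m c) / t := by
          refine Finset.sum_le_sum fun b _ => Finset.sum_le_sum fun c _ => ?_
          have := div_nonneg (mul_nonneg (hrm b) (hsm c)) ht0
          by_cases h : b = c
          · simpa [h] using this
          · simp [h]
      _ = ∑ b, (r b - m b) := by
          refine Finset.sum_congr rfl fun b _ => ?_
          rw [← Finset.sum_div, ← Finset.mul_sum, hst, hcancel _ hrm hrt b]
      _ = ∑ b ∈ Finset.univ.filter (fun b => s b ≤ r b), (r b - s b) := by
          rw [Finset.sum_filter]
          refine Finset.sum_congr rfl fun b _ => ?_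
          simp only [hm]
          split_ifs with h
          · rw [min_eq_right h]
          · rw [min_eq_left (not_le.1 h).le, sub_self]
      _ ≤ _ := by
          rw [Finset.sum_sub_distrib]
          exact (le_abs_self _).trans (abs_sum_sub_sum_le_tvDist r s _)

variable {Q : ι → (ι → X) → X → ℝ} {A : ι → ι → ℝ} {a : ℝ}

/-- Interpolate from `y` to `z` one coordinate at a time; coordinate `j` itself costs nothing. -/
lemma IsDobrushin.tvDist_le_sum (hQ : IsDobrushin Q A a) (j : ι) (y z : ι → X) :
    tvDist (Q j y) (Q j z) ≤ ∑ k, A k j * (if y k ≠ z k then 1 else 0) := by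
  have key : ∀ V : Finset ι, tvDist (Q j y) (Q j (V.piecewise z y)) ≤
      ∑ k ∈ V, A k j * (if y k ≠ z k then 1 else 0) := by
    intro V
    induction V using Finset.induction_on with
    | empty => simp [tvDist_self]
    | insert k V hk ih =>
      rw [Finset.piecewise_insert, Finset.sum_insert hk, add_comm]
      refine (tvDist_triangle _ (Q j (V.piecewise z y)) _).trans (add_le_add ih ?_)
      have hself : Q j (V.piecewise z y) =
          Q j (Function.update (V.piecewise z y) k (y k)) := by
        congr 1
        rw [eq_comm, Function.update_eq_self_iff, Finset.piecewise_eq_of_notMem _ _ _ hk]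
      by_cases hkj : k = j
      · subst hkj
        rw [hQ.update_self, tvDist_self, hQ.diag, zero_mul]
      · split_ifs with h
        · rw [hself, mul_one]
          exact hQ.tv_le k j _ _ _ hkj
        · rw [not_not] at h
          rw [hself, h, tvDist_self, mul_zero]
  simpa using key Finset.univ

/-- Resampling of the coordinate `i` of a coupling by the kernel `κ`. -/
noncomputable def resample (κ : (ι → X) × (ι → X) → X → X → ℝ) (i : ι)
    (π : (ι → X) × (ι → X) → ℝ) (v : (ι → X) × (ι → X)) : ℝ :=
  ∑ w, ∑ b, ∑ c, if v = (Function.update w.1 i b, Function.update w.2 i c) then π w * κ w b c else 0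

lemma sum_resample_mul (κ : (ι → X) × (ι → X) → X → X → ℝ) (i : ι) (π : (ι → X) × (ι → X) → ℝ)
    (F : (ι → X) × (ι → X) → ℝ) :
    ∑ v, resample κ i π v * F v =
      ∑ w, π w * ∑ b, ∑ c, κ w b c * F (Function.update w.1 i b, Function.update w.2 i c) := by
  unfold resample
  simp only [Finset.sum_mul, Finset.mul_sum]
  rw [Finset.sum_comm]
  refine Finset.sum_congr rfl fun w _ => ?_
  rw [Finset.sum_comm]
  refine Finset.sum_congr rfl fun b _ => ?_
  rw [Finset.sum_comm]
  refine Finset.sum_congr rfl fun c _ => ?_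
  simp only [ite_mul, zero_mul]
  rw [Finset.sum_ite_eq' Finset.univ, if_pos (Finset.mem_univ _), mul_assoc]

lemma IsCoupling.sum_fst {Z : Type*} [Fintype Z] {r s : Z → ℝ} {π : Z × Z → ℝ}
    (h : IsCoupling r s π) (f : Z → ℝ) : ∑ w, π w * f w.1 = ∑ z, r z * f z := by
  rw [Fintype.sum_prod_type]
  refine Finset.sum_congr rfl fun z _ => ?_
  simp only [← Finset.sum_mul, h.2.1 z]

lemma IsCoupling.sum_snd {Z : Type*} [Fintype Z] {r s : Z → ℝ} {π : Z × Z → ℝ}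
    (h : IsCoupling r s π) (f : Z → ℝ) : ∑ w, π w * f w.2 = ∑ z, s z * f z := by
  rw [Fintype.sum_prod_type_right]
  refine Finset.sum_congr rfl fun z _ => ?_
  simp only [← Finset.sum_mul, h.2.2 z]

lemma IsCoupling.fst_pos {Z : Type*} [Fintype Z] {r s : Z → ℝ} {π : Z × Z → ℝ}
    (h : IsCoupling r s π) {w : Z × Z} (hw : 0 < π w) : 0 < r w.1 := by
  rw [← h.2.1 w.1]
  exact Finset.sum_pos' (fun u _ => h.1.1 _) ⟨w.2, Finset.mem_univ _, hw⟩

lemma isCoupling_of_sum {Z : Type*} [Fintype Z] [DecidableEq Z] {r s : Z → ℝ} {π : Z × Z → ℝ}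
    (h0 : ∀ w, 0 ≤ π w) (hr1 : ∑ z, r z = 1)
    (hr : ∀ f : Z → ℝ, ∑ w, π w * f w.1 = ∑ z, r z * f z)
    (hs : ∀ f : Z → ℝ, ∑ w, π w * f w.2 = ∑ z, s z * f z) : IsCoupling r s π := by
  refine ⟨⟨h0, ?_⟩, fun z => ?_, fun z => ?_⟩
  · simpa [hr1] using hr fun _ => 1
  · have := hr fun x => if x = z then 1 else 0
    rw [Fintype.sum_prod_type_right] at this
    simpa using this
  · have := hs fun x => if x = z then 1 else 0
    rw [Fintype.sum_prod_type] at this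
    simpa using this

lemma disagreeProb_eq (π : (ι → X) × (ι → X) → ℝ) (i : ι) :
    disagreeProb π i = ∑ w, π w * (if w.1 i ≠ w.2 i then 1 else 0) := by
  simp [disagreeProb]

lemma disagreeProb_nonneg {π : (ι → X) × (ι → X) → ℝ} (h : ∀ w, 0 ≤ π w) (i : ι) :
    0 ≤ disagreeProb π i :=
  Finset.sum_nonneg fun w _ => by split_ifs; exacts [h w, le_rfl]

/-- One lazy resampling step of a coupling. -/
lemma IsDobrushin.exists_coupling_step (hQ : IsDobrushin Q A a) {p q : (ι → X) → ℝ}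
    (hp1 : ∑ x, p x = 1)
    {R : ι → (ι → X) → X → ℝ} (hR0 : ∀ i x c, 0 ≤ R i x c)
    (hR1 : ∀ i x, 0 < p x → ∑ c, R i x c = 1)
    (hRp : ∀ i h, ∑ x, p x * gibbsOp R i h x = ∑ x, p x * h x)
    (hQq : ∀ i h, ∑ x, q x * gibbsOp Q i h x = ∑ x, q x * h x)
    {π : (ι → X) × (ι → X) → ℝ} (hπ : IsCoupling p q π) :
    ∃ π', IsCoupling p q π' ∧ ∀ j, disagreeProb π' j ≤ 1 / ((Fintype.card ι : ℝ) + 1) *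
      (Fintype.card ι * disagreeProb π j + (∑ x, p x * tvDist (R j x) (Q j x) +
        ∑ k, A k j * disagreeProb π k)) := by
  -- Where `p` vanishes `R` need not be a probability law, but the coupling has no mass there and
  -- any kernel will do.
  have hker : ∀ i (w : (ι → X) × (ι → X)), ∃ κ : X → X → ℝ, (∀ b c, 0 ≤ κ b c) ∧ (0 < p w.1 →
      (∀ b, ∑ c, κ b c = R i w.1 b) ∧ (∀ c, ∑ b, κ b c = Q i w.2 c) ∧
      ∑ b, ∑ c, (if b ≠ c then κ b c else 0) ≤ tvDist (R i w.1) (Q i w.2)) := by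
    intro i w
    by_cases hw : 0 < p w.1
    · obtain ⟨κ, h0, h1⟩ := exists_maximal_coupling (hR0 i w.1) (hQ.nonneg i w.2) (hR1 i w.1 hw)
        (hQ.sum_eq_one i w.2)
      exact ⟨κ, h0, fun _ => h1⟩
    · exact ⟨0, fun _ _ => le_rfl, fun h => absurd h hw⟩
  choose κ hκ0 hκ using hker
  set N : ℝ := (Fintype.card ι : ℝ) + 1 with hN
  have hN0 : 0 < N := by positivity
  set π' : (ι → X) × (ι → X) → ℝ := fun v => 1 / N * (π v + ∑ i, resample (κ i) i π v) with hπ'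
  have hsum : ∀ F : (ι → X) × (ι → X) → ℝ, ∑ v, π' v * F v =
      1 / N * (∑ w, π w * F w + ∑ i, ∑ w, π w * ∑ b, ∑ c,
        κ i w b c * F (Function.update w.1 i b, Function.update w.2 i c)) := by
    intro F
    simp only [← sum_resample_mul]
    rw [Finset.sum_comm, ← Finset.sum_add_distrib, Finset.mul_sum]
    refine Finset.sum_congr rfl fun v _ => ?_
    rw [← Finset.sum_mul, ← add_mul, ← mul_assoc]
  have hcount : ∀ t : ℝ, 1 / N * (t + ∑ _i : ι, t) = t := by
    intro t
    rw [Finset.sum_const, Finset.card_univ, nsmul_eq_mul, hN]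
    field_simp
    ring
  have hpos : ∀ {w}, π w ≠ 0 → 0 < p w.1 := fun {w} hw =>
    hπ.fst_pos ((hπ.1.1 w).lt_of_ne hw.symm)
  refine ⟨π', isCoupling_of_sum (fun v => ?_) hp1 (fun f => ?_) (fun f => ?_), fun j => ?_⟩
  · refine mul_nonneg (by positivity) (add_nonneg (hπ.1.1 v) (Finset.sum_nonneg fun i _ =>
      Finset.sum_nonneg fun w _ => Finset.sum_nonneg fun b _ => Finset.sum_nonneg fun c _ => ?_))
    split_ifs
    exacts [mul_nonneg (hπ.1.1 w) (hκ0 i w b c), le_rfl]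
  · rw [hsum fun v => f v.1, hπ.sum_fst]
    have : ∀ i, ∑ w, π w * ∑ b, ∑ c, κ i w b c * f (Function.update w.1 i b) =
        ∑ z, p z * f z := by
      intro i
      rw [← hRp i f, ← hπ.sum_fst]
      refine Finset.sum_congr rfl fun w _ => ?_
      by_cases hw : π w = 0
      · simp [hw]
      congr 1
      refine Finset.sum_congr rfl fun b _ => ?_
      rw [← Finset.sum_mul, (hκ i w (hpos hw)).1 b]
    simp only [this]
    exact hcount _
  · rw [hsum fun v => f v.2, hπ.sum_snd]
    have : ∀ i, ∑ w, π w * ∑ b, ∑ c, κ i w b c * f (Function.update w.2 i c) =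
        ∑ z, q z * f z := by
      intro i
      rw [← hQq i f, ← hπ.sum_snd]
      refine Finset.sum_congr rfl fun w _ => ?_
      by_cases hw : π w = 0
      · simp [hw]
      congr 1
      rw [Finset.sum_comm]
      refine Finset.sum_congr rfl fun c _ => ?_
      rw [← Finset.sum_mul, (hκ i w (hpos hw)).2.1 c]
    simp only [this]
    exact hcount _
  · rw [disagreeProb_eq π', hsum, ← disagreeProb_eq]
    refine mul_le_mul_of_nonneg_left ?_ (by positivity)
    have hother : ∀ i, i ≠ j → ∑ w, π w * ∑ b, ∑ c, κ i w b c *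
        (if Function.update w.1 i b j ≠ Function.update w.2 i c j then (1 : ℝ) else 0) =
        disagreeProb π j := by
      intro i hij
      rw [disagreeProb_eq]
      refine Finset.sum_congr rfl fun w _ => ?_
      by_cases hw : π w = 0
      · simp [hw]
      congr 1
      simp only [Function.update_of_ne hij.symm, ← Finset.sum_mul]
      rw [Finset.sum_congr rfl fun b _ => (hκ i w (hpos hw)).1 b, hR1 i _ (hpos hw), one_mul]
    have hself : ∑ w, π w * ∑ b, ∑ c, κ j w b c *
        (if Function.update w.1 j b j ≠ Function.update w.2 j c j then (1 : ℝ) else 0) ≤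
        ∑ x, p x * tvDist (R j x) (Q j x) + ∑ k, A k j * disagreeProb π k := by
      calc _ ≤ ∑ w, π w * (tvDist (R j w.1) (Q j w.1) +
            ∑ k, A k j * (if w.1 k ≠ w.2 k then 1 else 0)) := by
            refine Finset.sum_le_sum fun w _ => ?_
            by_cases hw : π w = 0
            · simp [hw]
            refine mul_le_mul_of_nonneg_left ?_ (hπ.1.1 w)
            simp only [Function.update_self, mul_ite, mul_one, mul_zero]
            refine ((hκ j w (hpos hw)).2.2.trans
              (tvDist_triangle _ (Q j w.1) _)).trans ?_
            have := hQ.tvDist_le_sum j w.1 w.2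
            simp only [mul_ite, mul_one, mul_zero] at this
            linarith
        _ = _ := by
            simp only [mul_add, Finset.sum_add_distrib]
            rw [hπ.sum_fst fun x => tvDist (R j x) (Q j x)]
            congr 1
            simp only [disagreeProb_eq, Finset.mul_sum]
            rw [Finset.sum_comm]
            exact Finset.sum_congr rfl fun k _ => Finset.sum_congr rfl fun w _ => by ring
    -- The idle term and the `card - 1` updates at other sites each preserve the disagreement at
    -- `j`, `card` copies in all.
    rw [← Finset.add_sum_erase Finset.univ _ (Finset.mem_univ j),
      Finset.sum_congr rfl fun i hi => hother i (Finset.ne_of_mem_erase hi), Finset.sum_const,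
      Finset.card_erase_of_mem (Finset.mem_univ j), Finset.card_univ, nsmul_eq_mul,
      Nat.cast_sub (Fintype.card_pos_iff.2 ⟨j⟩), Nat.cast_one]
    linarith

lemma sqrt_sum_sq_add_le (u v : ι → ℝ) :
    Real.sqrt (∑ i, (u i + v i) ^ 2) ≤ Real.sqrt (∑ i, u i ^ 2) + Real.sqrt (∑ i, v i ^ 2) := by
  have := norm_add_le (WithLp.toLp 2 u) (WithLp.toLp 2 v)
  simpa [EuclideanSpace.norm_eq] using this

lemma sqrt_sum_sq_smul {t : ℝ} (ht : 0 ≤ t) (u : ι → ℝ) :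
    Real.sqrt (∑ i, (t * u i) ^ 2) = t * Real.sqrt (∑ i, u i ^ 2) := by
  simp only [mul_pow]
  rw [← Finset.mul_sum, Real.sqrt_mul (sq_nonneg t), Real.sqrt_sq ht]

lemma W2_nonneg (r s : (ι → X) → ℝ) : 0 ≤ W2 r s :=
  Real.sInf_nonneg (by rintro _ ⟨π, -, rfl⟩; exact Real.sqrt_nonneg _)

/-- Transportation distance is bounded by the mean local gaps. -/
theorem IsDobrushin.W2_le (hQ : IsDobrushin Q A a) {p q : (ι → X) → ℝ} (hp0 : ∀ x, 0 ≤ p x)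
    (hp1 : ∑ x, p x = 1) (hq0 : ∀ x, 0 ≤ q x) (hq1 : ∑ x, q x = 1)
    {R : ι → (ι → X) → X → ℝ} (hR0 : ∀ i x c, 0 ≤ R i x c)
    (hR1 : ∀ i x, 0 < p x → ∑ c, R i x c = 1)
    (hRp : ∀ i h, ∑ x, p x * gibbsOp R i h x = ∑ x, p x * h x)
    (hQq : ∀ i h, ∑ x, q x * gibbsOp Q i h x = ∑ x, q x * h x) :
    (1 - a) * W2 p q ≤ Real.sqrt (∑ j, (∑ x, p x * tvDist (R j x) (Q j x)) ^ 2) := by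
  set G := Real.sqrt (∑ j, (∑ x, p x * tvDist (R j x) (Q j x)) ^ 2) with hG
  set N : ℝ := (Fintype.card ι : ℝ) + 1 with hN
  have hN0 : 0 < N := by positivity
  have ha := hQ.norm_nonneg
  -- `c` is the Euclidean contraction factor of one lazy step; `N * (1 - c) = 1 - a` gives the
  -- constant once the infimum satisfies `W2 ≤ c * W2 + G / N`.
  set c : ℝ := 1 / N * (Fintype.card ι + a) with hc
  have hc0 : 0 ≤ c := by positivity
  have key : ∀ π, IsCoupling p q π →
      W2 p q ≤ c * Real.sqrt (∑ i, disagreeProb π i ^ 2) + 1 / N * G := by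
    intro π hπ
    obtain ⟨π', hπ', hle⟩ := hQ.exists_coupling_step hp1 hR0 hR1 hRp hQq hπ
    have h1 : W2 p q ≤ Real.sqrt (∑ i, disagreeProb π' i ^ 2) :=
      csInf_le ⟨0, by rintro _ ⟨π, -, rfl⟩; exact Real.sqrt_nonneg _⟩ ⟨π', hπ', rfl⟩
    have h2 : Real.sqrt (∑ i, disagreeProb π' i ^ 2) ≤
        Real.sqrt (∑ j, (1 / N * (Fintype.card ι * disagreeProb π j +
          (∑ x, p x * tvDist (R j x) (Q j x) + ∑ k, A k j * disagreeProb π k))) ^ 2) :=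
      Real.sqrt_le_sqrt (Finset.sum_le_sum fun j _ =>
        pow_le_pow_left₀ (disagreeProb_nonneg hπ'.1.1 j) (hle j) 2)
    rw [sqrt_sum_sq_smul (by positivity)] at h2
    have h3 := sqrt_sum_sq_add_le (fun j => (Fintype.card ι : ℝ) * disagreeProb π j)
      fun j => ∑ x, p x * tvDist (R j x) (Q j x) + ∑ k, A k j * disagreeProb π k
    rw [sqrt_sum_sq_smul (Nat.cast_nonneg _)] at h3
    have h4 := sqrt_sum_sq_add_le (fun j => ∑ x, p x * tvDist (R j x) (Q j x))
      fun j => ∑ k, A k j * disagreeProb π k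
    have h5 : Real.sqrt (∑ j, (∑ k, A k j * disagreeProb π k) ^ 2) ≤
        a * Real.sqrt (∑ i, disagreeProb π i ^ 2) := by
      refine (Real.sqrt_le_sqrt (hQ.quad _)).trans_eq ?_
      rw [Real.sqrt_mul (sq_nonneg a), Real.sqrt_sq ha]
    refine h1.trans (h2.trans ?_)
    calc _ ≤ 1 / N * (Fintype.card ι * Real.sqrt (∑ i, disagreeProb π i ^ 2) +
          (G + a * Real.sqrt (∑ i, disagreeProb π i ^ 2))) :=
          mul_le_mul_of_nonneg_left (by linarith) (by positivity)
      _ = _ := by rw [hc]; ring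
  have hprod : IsCoupling p q fun w => p w.1 * q w.2 := by
    refine isCoupling_of_sum (fun w => mul_nonneg (hp0 _) (hq0 _)) hp1 (fun f => ?_) fun f => ?_
    · rw [Fintype.sum_prod_type]
      refine Finset.sum_congr rfl fun z _ => ?_
      simp only [← Finset.sum_mul, ← Finset.mul_sum, hq1, mul_one]
    · rw [Fintype.sum_prod_type_right]
      refine Finset.sum_congr rfl fun z _ => ?_
      simp only [← Finset.sum_mul, hp1, one_mul]
  have hfin : W2 p q ≤ c * W2 p q + 1 / N * G := by
    rcases hc0.eq_or_lt with h0 | h0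
    · have := key _ hprod
      rw [← h0, zero_mul] at this ⊢
      exact this
    · have h1 : (W2 p q - 1 / N * G) / c ≤ W2 p q := by
        refine le_csInf ⟨_, _, hprod, rfl⟩ ?_
        rintro _ ⟨π, hπ, rfl⟩
        rw [div_le_iff₀ h0]
        linarith [key π hπ]
      rw [div_le_iff₀ h0] at h1
      linarith
  have h2 := mul_le_mul_of_nonneg_left hfin hN0.le
  have h3 : N * (c * W2 p q + 1 / N * G) = (Fintype.card ι + a) * W2 p q + G := by
    rw [hc]; field_simp
  rw [h3, hN] at h2
  linarith

end Transport

/-! ### Restriction to conditional laws -/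

section Conditional

variable {X : Type*} [Fintype X] [DecidableEq X] {n : ℕ}

/-- With a single symbol `A` may have negative entries, and the zero matrix replaces it; a bound `a'
≤ l2Norm A` is all that is used later. -/
lemma DobrushinL2.exists_isDobrushin {q : (Fin n → X) → ℝ} {Q : Fin n → (Fin n → X) → X → ℝ}
    (hQ : IsLocalSpec q Q) {A : Matrix (Fin n) (Fin n) ℝ} (hA : DobrushinL2 Q A) :
    ∃ A' a', IsDobrushin Q A' a' ∧ a' ≤ l2Norm A := by
  rcases subsingleton_or_nontrivial X with hX | hX
  · refine ⟨0, 0, ⟨fun _ _ => le_rfl, fun _ => rfl, fun i x c => (hQ.1 i x).1 c,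
      fun i x => (hQ.1 i x).2, fun i x c => by rw [Subsingleton.elim (Function.update x i c) x],
      fun k i x b c _ => ?_, le_rfl, zero_lt_one, fun v => by simp⟩, norm_nonneg _⟩
    rw [Subsingleton.elim b c, tvDist_self]
    rfl
  · exact ⟨A, l2Norm A, hA.isDobrushin hQ, le_rfl⟩

lemma glue_update (I : Finset (Fin n)) (u : {k // k ∈ I} → X) (y : Fin n → X) (k : {k // k ∈ I})
    (c : X) : glue I (Function.update u k c) y = Function.update (glue I u y) k c := by
  ext l
  unfold glue
  by_cases hl : l ∈ I
  · by_cases hlk : l = k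
    · subst hlk; simp
    · have : (⟨l, hl⟩ : {k // k ∈ I}) ≠ k := fun h => hlk (congrArg Subtype.val h)
      simp [hl, hlk, this]
  · have : l ≠ k := fun h => hl (h ▸ k.2)
    simp [hl, this]

/-- Freezing the coordinates off `I` restricts the coupling matrix to `I`; extending vectors by zero
shows that the norm bound persists. -/
lemma IsDobrushin.conditional {Q : Fin n → (Fin n → X) → X → ℝ} {A : Fin n → Fin n → ℝ} {a : ℝ}
    (hQ : IsDobrushin Q A a) (I : Finset (Fin n)) (y : Fin n → X) :
    IsDobrushin (ι := {k // k ∈ I}) (fun i u => Q i (glue I u y)) (fun k i => A k i) a where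
  entry_nonneg k i := hQ.entry_nonneg k i
  diag i := hQ.diag i
  nonneg i u c := hQ.nonneg i _ c
  sum_eq_one i u := hQ.sum_eq_one i _
  update_self i u c := by simp only [glue_update, hQ.update_self]
  tv_le k i u b c hki := by
    simp only [glue_update]
    exact hQ.tv_le k i _ b c fun h => hki (Subtype.ext h)
  norm_nonneg := hQ.norm_nonneg
  norm_lt_one := hQ.norm_lt_one
  quad v := by
    set w : Fin n → ℝ := fun k => if h : k ∈ I then v ⟨k, h⟩ else 0 with hw
    have hv : ∀ k : {k // k ∈ I}, w k = v k := fun k => by simp [hw]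
    have hext : ∀ f : Fin n → ℝ, (∀ k, k ∉ I → f k = 0) → ∑ k : {k // k ∈ I}, f k = ∑ k, f k := by
      intro f hf
      rw [Finset.sum_coe_sort I f]
      exact Finset.sum_subset (Finset.subset_univ I) fun k _ hk => hf k hk
    have hw0 : ∀ k, k ∉ I → w k = 0 := fun k hk => by simp [hw, hk]
    have h1 : ∀ j, ∑ k : {k // k ∈ I}, A k j * v k = ∑ k, A k j * w k := fun j => by
      rw [← hext (fun k => A k j * w k) fun k hk => by rw [hw0 k hk, mul_zero]]
      exact Finset.sum_congr rfl fun k _ => by rw [hv]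
    have h2 : ∑ k : {k // k ∈ I}, v k ^ 2 = ∑ k, w k ^ 2 := by
      rw [← hext (fun k => w k ^ 2) fun k hk => by rw [hw0 k hk]; norm_num]
      exact Finset.sum_congr rfl fun k _ => by rw [hv]
    rw [h2]
    simp only [h1]
    refine le_trans ?_ (hQ.quad w)
    rw [Finset.sum_coe_sort I fun j => (∑ k, A k j * w k) ^ 2]
    exact Finset.sum_le_sum_of_subset_of_nonneg (Finset.subset_univ I) fun j _ _ => sq_nonneg _

lemma condLaw_nonneg {p : (Fin n → X) → ℝ} (hp : ∀ x, 0 ≤ p x) (I : Finset (Fin n))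
    (y : Fin n → X) (u : {k // k ∈ I} → X) : 0 ≤ condLaw p I y u :=
  div_nonneg (hp _) (Finset.sum_nonneg fun _ _ => hp _)

lemma sum_condLaw {p : (Fin n → X) → ℝ} {I : Finset (Fin n)} {y : Fin n → X}
    (h : 0 < outerMass p I y) : ∑ u, condLaw p I y u = 1 := by
  unfold condLaw
  rw [← Finset.sum_div]
  exact div_self h.ne'

lemma HasSpec.conditional {p : (Fin n → X) → ℝ} {R : Fin n → (Fin n → X) → X → ℝ}
    (h : HasSpec p R Finset.univ) (I : Finset (Fin n)) (y : Fin n → X) :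
    HasSpec (condLaw p I y) (fun i u => R i (glue I u y)) Finset.univ := by
  intro k _ u c
  unfold condLaw
  simp only [glue_update]
  rw [h k (Finset.mem_univ _), ← Finset.sum_div]
  ring

/-- The transportation bound for conditional laws. -/
theorem IsDobrushin.W2_condLaw_sq_le {q : (Fin n → X) → ℝ} {Q : Fin n → (Fin n → X) → X → ℝ}
    {A : Fin n → Fin n → ℝ} {a : ℝ} (hQ : IsDobrushin Q A a) (hqQ : HasSpec q Q Finset.univ)
    {p : (Fin n → X) → ℝ} (hp0 : ∀ x, 0 ≤ p x) (hq0 : ∀ x, 0 ≤ q x)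
    (hpq : ∀ x, q x = 0 → p x = 0) {I : Finset (Fin n)} {y : Fin n → X}
    (hy : 0 < outerMass p I y) :
    (1 - a) ^ 2 * W2 (condLaw p I y) (condLaw q I y) ^ 2 ≤
      ∑ u, condLaw p I y u * ∑ i ∈ I, siteGapSq p Q i (glue I u y) := by
  have hqy : 0 < outerMass q I y := by
    refine (Finset.sum_nonneg fun u _ => hq0 _ : 0 ≤ outerMass q I y).lt_of_ne fun h => hy.ne' ?_
    refine Finset.sum_eq_zero fun u hu => hpq _ ?_
    exact (Finset.sum_eq_zero_iff_of_nonneg fun u _ => hq0 _).1 h.symm u hu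
  have hp1 := sum_condLaw hy
  have hp'0 := condLaw_nonneg hp0 I y
  have hpos : ∀ u, 0 < condLaw p I y u → 0 < p (glue I u y) := fun u hu => by
    refine (hp0 _).lt_of_ne fun h => hu.ne' ?_
    rw [condLaw, ← h, zero_div]
  have hW := (hQ.conditional I y).W2_le (p := condLaw p I y) (q := condLaw q I y)
    (R := fun i u => condSite p i (glue I u y)) hp'0 hp1 (condLaw_nonneg hq0 I y)
    (sum_condLaw hqy) (fun i u c => condSite_nonneg hp0 i _ c)
    (fun i u hu => sum_condSite hp0 i (hpos u hu))
    (fun i h => sum_mul_gibbsOp (fun u c => by simp only [glue_update, condSite_update])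
      ((hasSpec_condSite hp0 Finset.univ).conditional I y i (Finset.mem_univ i)) h)
    (fun i h => sum_mul_gibbsOp (fun u c => by simp only [glue_update, hQ.update_self])
      (hqQ.conditional I y i (Finset.mem_univ i)) h)
  have hsq := pow_le_pow_left₀ (mul_nonneg (by linarith [hQ.norm_lt_one]) (W2_nonneg _ _)) hW 2
  rw [mul_pow, Real.sq_sqrt (Finset.sum_nonneg fun _ _ => sq_nonneg _)] at hsq
  refine hsq.trans ?_
  -- The coupling argument yields squares of mean gaps; convexity passes to means of squares.
  have hj : ∀ j : {k // k ∈ I}, (∑ u, condLaw p I y u *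
      tvDist (condSite p j (glue I u y)) (Q j (glue I u y))) ^ 2 ≤
      ∑ u, condLaw p I y u * siteGapSq p Q j (glue I u y) := by
    intro j
    have h0 : 0 ≤ ∑ u, condLaw p I y u * siteGapSq p Q j (glue I u y) :=
      Finset.sum_nonneg fun u _ => mul_nonneg (hp'0 u) (siteGapSq_nonneg _ _ _ _)
    refine (Real.le_sqrt (Finset.sum_nonneg fun u _ => mul_nonneg (hp'0 u)
      (tvDist_nonneg _ _)) h0).1 ?_
    refine sum_mul_le_of_sum_sq_le hp'0 hp1 (Real.sqrt_nonneg _) ?_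
    rw [Real.sq_sqrt h0]
    rfl
  refine (Finset.sum_le_sum fun j _ => hj j).trans_eq ?_
  rw [Finset.sum_comm]
  refine Finset.sum_congr rfl fun u _ => ?_
  rw [← Finset.mul_sum, Finset.sum_coe_sort I fun j => siteGapSq p Q j (glue I u y)]

end Conditional

/-! ### Assembly of the three claims -/

theorem theorem2 {X : Type*} [Fintype X] [DecidableEq X] {n : ℕ} (hn : 1 ≤ n)
    (q : (Fin n → X) → ℝ) (hq : q ∈ stdSimplex ℝ (Fin n → X))
    (Q : Fin n → (Fin n → X) → X → ℝ) (hQ : IsLocalSpec q Q)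
    (A : Matrix (Fin n) (Fin n) ℝ) (hA : DobrushinL2 Q A)
    (p : (Fin n → X) → ℝ) (hp : p ∈ stdSimplex ℝ (Fin n → X))
    (hpq : ∀ x, q x = 0 → p x = 0) :
    (∀ (I : Finset (Fin n)) (y : Fin n → X), 0 < outerMass p I y →
      W2 (condLaw p I y) (condLaw q I y) ^ 2 ≤
        1 / (1 - l2Norm A) ^ 2 *
          ∑ u, condLaw p I y u * ∑ i ∈ I, siteGapSq p Q i (glue I u y)) ∧
    relEntropy p q ≤
      ((4 / minLocal q Q * (1 / (1 - l2Norm A) ^ 2) *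
        ∑ i, ∑ y, p y * siteGapSq p Q i y : ℝ) : EReal) ∧
    ((4 / minLocal q Q * (1 / (1 - l2Norm A) ^ 2) *
        ∑ i, ∑ y, p y * siteGapSq p Q i y : ℝ) : EReal) ≤
      ((2 / minLocal q Q * (1 / (1 - l2Norm A) ^ 2) : ℝ) : EReal) *
        ∑ i, ∑ y, (p y : EReal) * relEntropy (condSite p i y) (Q i y) ∧
    relEntropy (gibbsStep Q p) q ≤
      ((1 - 1 / (n : ℝ) * (minLocal q Q / 2) * (1 - l2Norm A) ^ 2 : ℝ) : EReal) *
        relEntropy p q := by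
  have hp0 := hp.1
  have hp1 := hp.2
  have hq0 := hq.1
  have hq1 := hq.2
  have hqQ := hQ.hasSpec hq0
  obtain ⟨A', a, hD, ha⟩ := hA.exists_isDobrushin hQ
  have hα := minLocal_pos hn hq0 hq1 hQ
  have ha1 : 0 < 1 - l2Norm A := by linarith [hA.2.2]
  have hsq : (1 - l2Norm A) ^ 2 ≤ (1 - a) ^ 2 := pow_le_pow_left₀ ha1.le (by linarith) 2
  have hsqpos : 0 < (1 - l2Norm A) ^ 2 := by positivity
  have hS0 : 0 ≤ ∑ i, ∑ y, p y * siteGapSq p Q i y :=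
    Finset.sum_nonneg fun i _ => Finset.sum_nonneg fun y _ =>
      mul_nonneg (hp0 y) (siteGapSq_nonneg p Q i y)
  have hent : ∑ x, p x * Real.log (p x / q x) ≤
      4 / minLocal q Q * (1 / (1 - l2Norm A) ^ 2) * ∑ i, ∑ y, p y * siteGapSq p Q i y := by
    refine (hD.entropy_le hα hp0 hp1 hq0 hq1 hpq hqQ fun i x hx => minLocal_le hQ i hx).trans ?_
    gcongr
  have hpin := two_mul_sum_siteGapSq_le hp0 hq0 hpq hQ
  set K := ∑ i, ∑ y, p y * ∑ c, condSite p i y c * Real.log (condSite p i y c / Q i y c) with hK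
  have hSK : 4 / minLocal q Q * (1 / (1 - l2Norm A) ^ 2) *
      ∑ i, ∑ y, p y * siteGapSq p Q i y ≤ 2 / minLocal q Q * (1 / (1 - l2Norm A) ^ 2) * K := by
    calc _ = 2 / minLocal q Q * (1 / (1 - l2Norm A) ^ 2) *
          (2 * ∑ i, ∑ y, p y * siteGapSq p Q i y) := by ring
      _ ≤ _ := mul_le_mul_of_nonneg_left hpin (by positivity)
  refine ⟨fun I y hy => ?_, ?_, ?_, ?_⟩
  · have h := hD.W2_condLaw_sq_le hqQ hp0 hq0 hpq hy
    have h1 := mul_le_mul_of_nonneg_right hsq (sq_nonneg (W2 (condLaw p I y) (condLaw q I y)))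
    rw [one_div_mul_eq_div, le_div_iff₀ hsqpos, mul_comm]
    exact h1.trans h
  · rw [relEntropy_eq_coe hpq]
    exact EReal.coe_le_coe_iff.2 hent
  · rw [sum_mul_relEntropy_condSite hq0 hpq hQ, ← EReal.coe_mul]
    exact EReal.coe_le_coe_iff.2 hSK
  · have hstep0 : ∀ z, q z = 0 → gibbsStep Q p z = 0 := fun z hz => by
      rw [gibbsStep_eq hD.update_self]
      exact Finset.sum_eq_zero fun i _ => by rw [siteStep_eq_zero hq0 hpq hqQ i hz, mul_zero]
    rw [relEntropy_eq_coe hpq, relEntropy_eq_coe hstep0, ← EReal.coe_mul]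
    refine EReal.coe_le_coe_iff.2 ?_
    have h1 := entropy_gibbsStep_le hn hp0 hq0 hpq hqQ hD.update_self hD.nonneg
    simp only [entropy_siteStep hp0 hpq hqQ hD.update_self hD.sum_eq_one] at h1
    rw [Finset.sum_sub_distrib, Finset.sum_const, Finset.card_univ, Fintype.card_fin, nsmul_eq_mul,
      ← hK] at h1
    have h2 := hent.trans hSK
    set D := ∑ x, p x * Real.log (p x / q x) with hDdef
    have hn0 : (0 : ℝ) < n := by exact_mod_cast hn
    -- The second claim read backwards: the total loss `K` of the `n` single-site updates is at
    -- least a fixed fraction of `D`.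
    have h3 : minLocal q Q / 2 * (1 - l2Norm A) ^ 2 * D ≤ K := by
      have h4 := mul_le_mul_of_nonneg_left h2
        (show 0 ≤ minLocal q Q / 2 * (1 - l2Norm A) ^ 2 by positivity)
      refine h4.trans_eq ?_
      field_simp
    have h5 := mul_le_mul_of_nonneg_left h3 (one_div_nonneg.2 hn0.le)
    have h6 : 1 / (n : ℝ) * (n * D - K) = D - 1 / n * K := by field_simp
    rw [h6] at h1
    linarith
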